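/- For $\lambda\in\mathbb R$ let $M_\lambda(t)(x,y,z)=(x\cos t-y\sin t,\;x\sin t+y\cos t,\;z+\lambda t)$ be the helicoidal motions of pitch $\lambda$ around the $z$-axis. A helicoidal surface is an immersion $(u,v)\mapsto M_\lambda(v)\mathbf c(u)$, $u\in I$, $v\in\mathbb R$, with a smooth curve $\mathbf c$ on an open interval $I$ in $\mathbb E^3$; it is a cmc-$H$ helicoid if its mean curvature is a constant $H\neq0$. The cgc-companion of a surface $\mathbf x$ with constant mean curvature $H\ne 0$ and Gauss map $\mathbf n$ is the parallel surface $\check{\mathbf x}=\mathbf x+\frac1{2H}\mathbf n$ (possibly with singular points). Let $p(x,y,z)=(x,y,0)$. Let $\mathfrak M=\{(\mu,b): b\ge1,\ 0\le\mu\le1/b\}$. For $(\mu,b)\in\mathfrak M$ and $H\neq0$ put $c_1=\sqrt{(1-\mu^2b^2)(b^2-1)}$, $g(u)=\frac{c_1}{b}\Pi(\mathrm{am}(u,\mu),\mu^2b^2,\mu)$, and let $\mathbf x_{\mu,b,H}:\mathbb R^2\to\mathbb C\times\mathbb R=\mathbb E^3$ be given by $$-2H\,\mathbf x_{\mu,b,H}(u,v)=\begin{pmatrix}e^{i(v/b+g(u))}\Big(\rho+\frac{\mu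 b\,(b\,\mathrm{cn}\,\mathrm{dn}-ic_1\mathrm{sn})}{\rho}\Big)\\ -\mu b\,\mathrm{sn}+(b-\tfrac1b)u-bE(\mathrm{am}(u,\mu),\mu)+\frac{c_1v}{b}\end{pmatrix},\qquad \rho=\sqrt{1-\mu^2b^2\mathrm{sn}^2},$$ where $\mathrm{sn},\mathrm{cn},\mathrm{dn}$ are taken at $(u,\mu)$, $\Pi(\varphi,n,k)=\int_0^\varphi\frac{d\theta}{(1-n\sin^2\theta)\sqrt{1-k^2\sin^2\theta}}$, $E(\varphi,k)=\int_0^\varphi\sqrt{1-k^2\sin^2\theta}\,d\theta$, and, if $\mu b=1$, one reads $\rho=\mathrm{cn}$, $\mathrm{cn}\,\mathrm{dn}/\rho=\mathrm{dn}$ and $g=0$. The case $b=1$ is called an unduloid; $(\mu,b)=(1,1)$ is the round sphere without its two points on the axis. We say that a helicoidal surface is parametrized by $\mathbf y$ if, up to a translation along the $z$-axis and possibly the reflection $z\mapsto-z$, it equals $\mathbf y(s(u),bv+t(u))$ with smooth $s,t$ on $I$, $s'\neq0$. **(1)** For every cmc-$H$ helicoid $\mathbf x$ there is $(\mu,b)\in\mathfrak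 M$ such that $\mathbf x$ is parametrized by $\mathbf x_{\mu,b,H}$, and everywhere on $\mathbf x$ and on its cgc-companion $\check{\mathbf x}$ $$\frac{|1-\mu b^2|}{|2H|}\le|p(\mathbf x)|\le\frac{1+\mu b^2}{|2H|},\qquad \frac{\mu b\sqrt{b^2-1}}{|2H|}\le|p(\check{\mathbf x})|\le\frac{\mu b^2}{|2H|}.$$ **(2)** For every helicoidal surface $\mathbf y$ of constant Gaussian curvature $K>0$ there is $(\mu,b)\in\mathfrak M$ with $\mu>0$ such that $\mathbf y$ is parametrized by the cgc-companion of $\mathbf x_{\mu,b,H}$, $H=\sqrt K/2$, and everywhere on $\mathbf y$ $$\frac{\mu b\sqrt{b^2-1}}{\sqrt K}\le|p(\mathbf y)|\le\frac{\mu b^2}{\sqrt K}.$$ The inner radius $\mu b\sqrt{b^2-1}/\sqrt K$ is positive if and only if $b\neq1$, that is, except when $\mathbf y$ is the parallel surface of an unduloid. **(3)** For all $(\mu,b)\in\mathfrak M$ and $H\neq0$, $\mathbf x_{\mu,b,H}$ is a cmc-$H$ helicoid of pitch $-c_1/(2H)$ with generating curve $u\mapsto\mathbf x_{\mu,b,H}(u,0)$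 (the angle of rotation being $v/b$), and the bounds are sharp: on $\mathbf x_{\mu,b,H}$ the maximum of $|p|$ is $(1+\mu b^2)/|2H|$ and its infimum is $|1-\mu b^2|/|2H|$; on the cgc-companion of $\mathbf x_{\mu,b,H}$ the maximum of $|p|$ is $\mu b^2/|2H|$ and its infimum is $\mu b\sqrt{b^2-1}/|2H|$. Both infima are attained, except possibly for the round sphere $(\mu,b)=(1,1)$. -/

import Mathlib

open scoped ContDiff Matrix

/-! ### Elliptic integrals and Jacobi's elliptic functions, with modulus `k ∈ [0, 1]` -/

/-- Incomplete elliptic integral of the first kind, `F(φ, k)`. -/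
noncomputable def ellipticF (φ k : ℝ) : ℝ :=
  ∫ θ in (0 : ℝ)..φ, 1 / √(1 - k ^ 2 * Real.sin θ ^ 2)

/-- Incomplete elliptic integral of the second kind, `E(φ, k)`. -/
noncomputable def ellipticE (φ k : ℝ) : ℝ :=
  ∫ θ in (0 : ℝ)..φ, √(1 - k ^ 2 * Real.sin θ ^ 2)

/-- Incomplete elliptic integral of the third kind, `Π(φ, n, k)`. -/
noncomputable def ellipticPi (φ n k : ℝ) : ℝ :=
  ∫ θ in (0 : ℝ)..φ, 1 / ((1 - n * Real.sin θ ^ 2) * √(1 - k ^ 2 * Real.sin θ ^ 2))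

/-- Jacobi's amplitude `am(u, k)`. For `0 ≤ k < 1` the map `F(·, k)` is a bijection of `ℝ` and
`am(·, k)` is its inverse. For `k = 1` the amplitude is the inverse of `F(·, 1)` on
`(-π/2, π/2)`, which is the Gudermannian function. -/
noncomputable def jacobiAm (u k : ℝ) : ℝ :=
  if k < 1 then Function.invFun (fun φ : ℝ => ellipticF φ k) u
  else Real.arctan (Real.sinh u)

/-- `sn(u, k)`. -/
noncomputable def jacobiSn (u k : ℝ) : ℝ := Real.sin (jacobiAm u k)

/-- `cn(u, k)`. -/
noncomputable def jacobiCn (u k : ℝ) : ℝ := Real.cos (jacobiAm u k)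

/-- `dn(u, k)`. -/
noncomputable def jacobiDn (u k : ℝ) : ℝ := √(1 - k ^ 2 * jacobiSn u k ^ 2)

/-! ### Parametrized surfaces in Euclidean 3-space -/

/-- Euclidean 3-space with its Cartesian coordinates; lengths and angles are always taken with
respect to the dot product `⬝ᵥ` (the sup norm on this type is never used). -/
abbrev E3 : Type := Fin 3 → ℝ

/-- The partial derivative `x_u`. -/
noncomputable def partialU (x : ℝ → ℝ → E3) : ℝ → ℝ → E3 :=
  fun u v => deriv (fun s => x s v) u

/-- The partial derivative `x_v`. -/
noncomputable def partialV (x : ℝ → ℝ → E3) : ℝ → ℝ → E3 :=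
  fun u v => deriv (fun t => x u t) v

/-- The Gauss map `(x_u × x_v) / |x_u × x_v|`. -/
noncomputable def gaussMap (x : ℝ → ℝ → E3) (u v : ℝ) : E3 :=
  let w : E3 := crossProduct (partialU x u v) (partialV x u v)
  (1 / √(w ⬝ᵥ w)) • w

/-- Coefficient `E` of the first fundamental form. -/
noncomputable def fffE (x : ℝ → ℝ → E3) (u v : ℝ) : ℝ := partialU x u v ⬝ᵥ partialU x u v

/-- Coefficient `F` of the first fundamental form. -/
noncomputable def fffF (x : ℝ → ℝ → E3) (u v : ℝ) : ℝ := partialU x u v ⬝ᵥ partialV x u v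

/-- Coefficient `G` of the first fundamental form. -/
noncomputable def fffG (x : ℝ → ℝ → E3) (u v : ℝ) : ℝ := partialV x u v ⬝ᵥ partialV x u v

/-- Coefficient `L` of the second fundamental form. -/
noncomputable def sffL (x : ℝ → ℝ → E3) (u v : ℝ) : ℝ :=
  partialU (partialU x) u v ⬝ᵥ gaussMap x u v

/-- Coefficient `M` of the second fundamental form. -/
noncomputable def sffM (x : ℝ → ℝ → E3) (u v : ℝ) : ℝ :=
  partialU (partialV x) u v ⬝ᵥ gaussMap x u v

/-- Coefficient `N` of the second fundamental form. -/
noncomputable def sffN (x : ℝ → ℝ → E3) (u v : ℝ) : ℝ :=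
  partialV (partialV x) u v ⬝ᵥ gaussMap x u v

/-- The mean curvature (half the sum of the principal curvatures), with respect to the Gauss
map `gaussMap x`. -/
noncomputable def meanCurvature (x : ℝ → ℝ → E3) (u v : ℝ) : ℝ :=
  (fffG x u v * sffL x u v - 2 * fffF x u v * sffM x u v + fffE x u v * sffN x u v) /
    (2 * (fffE x u v * fffG x u v - fffF x u v ^ 2))

/-- The Gaussian curvature. -/
noncomputable def gaussCurvature (x : ℝ → ℝ → E3) (u v : ℝ) : ℝ :=
  (sffL x u v * sffN x u v - sffM x u v ^ 2) /
    (fffE x u v * fffG x u v - fffF x u v ^ 2)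

/-- Distance to the `z`-axis, i.e. `|p(x)|` for the projection `p(x, y, z) = (x, y, 0)`. A set
lies inside (outside) the circular cylinder of radius `r` around the `z`-axis iff this distance
is at most (at least) `r` on it. -/
noncomputable def axisDist (q : E3) : ℝ := √(q 0 ^ 2 + q 1 ^ 2)

/-! ### Helicoidal surfaces -/

/-- The helicoidal motion `M_pitch(t)` around the `z`-axis. -/
noncomputable def helicoidalMotion (pitch t : ℝ) (q : E3) : E3 :=
  ![Real.cos t * q 0 - Real.sin t * q 1, Real.sin t * q 0 + Real.cos t * q 1, q 2 + pitch * t]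

/-- The trajectory `(u, v) ↦ M_pitch(v) (c u)` of a space curve `c`. -/
noncomputable def helicoidalSurface (pitch : ℝ) (c : ℝ → E3) : ℝ → ℝ → E3 :=
  fun u v => helicoidalMotion pitch v (c u)

/-- The trajectory of the smooth curve `c : I → E3`, `I` an open interval, under the helicoidal
motions of the given pitch is an immersed surface. -/
structure IsHelicoidalImmersion (pitch : ℝ) (I : Set ℝ) (c : ℝ → E3) : Prop where
  isOpen : IsOpen I
  ordConnected : I.OrdConnected
  smooth : ContDiffOn ℝ ∞ c I
  immersion : ∀ u ∈ I, ∀ v : ℝ,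
    crossProduct (partialU (helicoidalSurface pitch c) u v)
      (partialV (helicoidalSurface pitch c) u v) ≠ 0

/-- A cmc-`H` helicoid: a helicoidal surface of non-zero constant mean curvature `H`. -/
structure IsCmcHelicoid (H pitch : ℝ) (I : Set ℝ) (c : ℝ → E3) : Prop
    extends IsHelicoidalImmersion pitch I c where
  ne_zero : H ≠ 0
  meanCurvature_eq : ∀ u ∈ I, ∀ v : ℝ, meanCurvature (helicoidalSurface pitch c) u v = H

/-- A helicoidal surface of positive constant Gaussian curvature `K`. -/
structure IsCgcHelicoid (K pitch : ℝ) (I : Set ℝ) (c : ℝ → E3) : Prop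
    extends IsHelicoidalImmersion pitch I c where
  pos : 0 < K
  gaussCurvature_eq : ∀ u ∈ I, ∀ v : ℝ, gaussCurvature (helicoidalSurface pitch c) u v = K

/-- The cgc-companion `x + (1 / 2H) n` of a surface `x` with Gauss map `n`, a parallel surface
of `x` (possibly with singular points). -/
noncomputable def cgcCompanion (H : ℝ) (x : ℝ → ℝ → E3) : ℝ → ℝ → E3 :=
  fun u v => x u v + (1 / (2 * H)) • gaussMap x u v

/-! ### The explicit cmc-`H` helicoids -/

/-- The parameter space `{(μ, b) | 0 ≤ μ ≤ 1 / b, 1 ≤ b}`. -/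
def helicoidParams : Set (ℝ × ℝ) := {q | 0 ≤ q.1 ∧ 1 ≤ q.2 ∧ q.1 * q.2 ≤ 1}

/-- `c₁ = √((1 - μ² b²) (b² - 1))`. -/
noncomputable def helC (μ b : ℝ) : ℝ := √((1 - μ ^ 2 * b ^ 2) * (b ^ 2 - 1))

/-- `g(u) = (c₁ / b) Π(am(u, μ), μ² b², μ)`. -/
noncomputable def helG (μ b u : ℝ) : ℝ :=
  helC μ b / b * ellipticPi (jacobiAm u μ) (μ ^ 2 * b ^ 2) μ

/-- The vector `n₀(u)` of `ℂ × ℝ = E3`. For `μ b = 1` (nodoids) the function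
`√(1 - μ² b² sn²) = √(cn²)` is to be read as the smooth function `cn`. -/
noncomputable def helN0 (μ b u : ℝ) : E3 :=
  if μ * b = 1 then ![jacobiCn u μ, 0, - jacobiSn u μ]
  else ![√(1 - μ ^ 2 * b ^ 2 * jacobiSn u μ ^ 2), 0, - (μ * b * jacobiSn u μ)]

/-- The vector `x̌₀(u)` of `ℂ × ℝ = E3`, whose complex component is
`μ b (b cn dn - i c₁ sn) / √(1 - μ² b² sn²)`. For `μ b = 1` one has `c₁ = 0`, and the quotient,
read with `cn` for the root as in `helN0`, is `b dn`. -/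
noncomputable def helX0 (μ b u : ℝ) : E3 :=
  if μ * b = 1 then
    ![b * jacobiDn u μ, 0, (b - 1 / b) * u - b * ellipticE (jacobiAm u μ) μ]
  else
    ![μ * b * (b * jacobiCn u μ * jacobiDn u μ) / √(1 - μ ^ 2 * b ^ 2 * jacobiSn u μ ^ 2),
      - (μ * b * (helC μ b * jacobiSn u μ)) / √(1 - μ ^ 2 * b ^ 2 * jacobiSn u μ ^ 2),
      (b - 1 / b) * u - b * ellipticE (jacobiAm u μ) μ]

/-- The cmc-`H` helicoid with parameters `(μ, b)`, defined on the whole `uv`-plane: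
`-2H x = diag(e^{iv/b}, 1) diag(e^{ig(u)}, 1) (n₀(u) + x̌₀(u)) + (0, c₁ v / b)`.
For `b = 1` it is, by definition, an unduloid, and for `μ b = 1` a nodoid; `(μ, b) = (1, 1)` is
the round sphere (without its two points on the axis) and `μ = 0` is the circular cylinder. -/
noncomputable def cmcHelicoid (μ b H : ℝ) : ℝ → ℝ → E3 :=
  fun u v => (-1 / (2 * H)) •
    helicoidalMotion (helC μ b) (v / b)
      (helicoidalMotion 0 (helG μ b u) (helN0 μ b u + helX0 μ b u))

/-- The helicoidal surface `x`, with parameters `u ∈ I`, `v ∈ ℝ`, is parametrized by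
(a part of) `y`: up to a translation along the `z`-axis and possibly the reflection `z ↦ -z`, it
arises from `y` by a smooth regular change of parameters `(u, v) ↦ (s(u), b v + t(u))`. -/
def ParametrizedBy (I : Set ℝ) (x : ℝ → ℝ → E3) (b : ℝ) (y : ℝ → ℝ → E3) : Prop :=
  ∃ (ε h : ℝ) (s t : ℝ → ℝ), (ε = 1 ∨ ε = -1) ∧
    ContDiffOn ℝ ∞ s I ∧ ContDiffOn ℝ ∞ t I ∧ (∀ u ∈ I, deriv s u ≠ 0) ∧
    ∀ u ∈ I, ∀ v : ℝ,
      x u v = ![y (s u) (b * v + t u) 0, y (s u) (b * v + t u) 1,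
        ε * y (s u) (b * v + t u) 2 + h]

/-! ### Calculus on the line -/

/-! Scaling by -2H normalizes the mean curvature to -1/2. Everything then takes place along the
generating curve, in the frame formed by the Killing field k of the motions, the unit normal m and k
× m. The velocity is c' = r (k × m) + τ k. Of m', all but one component is fixed by |m| = 1 and by
the symmetry of the second fundamental form; the mean curvature fixes the last one (`normal_frame`).

Let ξ, ν be the horizontal parts of c, m, let n be the vertical part of m, κ = |k|, and q = Re(ν
ξ̄). The structure equations give q' = κr · κn and (κn)' = κr (1 - q). Hence (q, κn) runs on a
circle about (1, 0): q - 1 - iκn = R exp(iθ) with R constant and θ' = κr. Moreover |ξ|² = q² + (κn)²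
= 1 + R² + 2R cos θ, which is the source of the bounds for |p(x)|. For given R and pitch l, the Gram
matrix of (ξ, ν) depends on θ alone, so two solutions with the same R, l and phase differ by a
rotation. The structure equations turn that rotation at rate τ, and they move the height accordingly
(`HelicoidData.congruent`).

It remains to recognize the explicit surfaces among the solutions. For `helCurve` one finds r = 1/b,
τ = 0, l = c₁, R = μb² and θ = am + arcsin(μ sn), the amplitude of Landen's transformation
(`helicoidData_helCurve`). Every R ≥ 0 and l ≥ 0 occurs (`exists_helicoidParams`), negative pitch is
a reflection, and solving for the phase gives the reparametrization s. Only on the sphere is the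
range of the model phase bounded; there κ > 0 keeps θ inside it.

For constant K > 0, Bonnet's theorem applies: the parallel surface at distance 1/√K, on the side
where it is immersed, has constant mean curvature and the same normal, and the given surface is its
companion (`IsCgcHelicoid.exists_parallel`). On the explicit companion |x̌₀|² = μ²b⁴ - μ²b² sn²,
whose extreme values are the stated radii. -/

lemma contDiff_of_hasDerivAt {f f' : ℝ → ℝ} (h : ∀ x, HasDerivAt f (f' x) x)
    (hf' : ContDiff ℝ ∞ f') : ContDiff ℝ ∞ f := by
  rw [contDiff_infty_iff_deriv]
  refine ⟨fun x => (h x).differentiableAt, ?_⟩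
  have : deriv f = f' := funext fun x => (h x).deriv
  rwa [this]

lemma contDiffOn_of_hasDerivAt {f f' : ℝ → ℝ} {I : Set ℝ} (hI : IsOpen I)
    (h : ∀ x ∈ I, HasDerivAt f (f' x) x) (hf' : ContDiffOn ℝ ∞ f' I) : ContDiffOn ℝ ∞ f I := by
  rw [contDiffOn_infty_iff_deriv_of_isOpen hI]
  refine ⟨fun x hx => (h x hx).differentiableAt.differentiableWithinAt, ?_⟩
  exact hf'.congr fun x hx => (h x hx).deriv

lemma exists_antideriv {p : ℝ → ℝ} {I : Set ℝ} (hI : IsOpen I) (hc : I.OrdConnected)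
    (hp : ContDiffOn ℝ ∞ p I) {u₀ : ℝ} (hu₀ : u₀ ∈ I) :
    ∃ P : ℝ → ℝ, ContDiffOn ℝ ∞ P I ∧ P u₀ = 0 ∧ ∀ u ∈ I, HasDerivAt P (p u) u := by
  have hd : ∀ u ∈ I, HasDerivAt (fun x => ∫ t in u₀..x, p t) (p u) u := by
    intro u hu
    apply intervalIntegral.integral_hasDerivAt_right
    · apply ContinuousOn.intervalIntegrable
      exact hp.continuousOn.mono (hc.uIcc_subset hu₀ hu)
    · exact hp.continuousOn.stronglyMeasurableAtFilter hI u hu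
    · exact hp.continuousOn.continuousAt (hI.mem_nhds hu)
  exact ⟨_, contDiffOn_of_hasDerivAt hI hd hp, by simp, hd⟩

lemma eq_of_hasDerivAt_eq {E : Type*} [NormedAddCommGroup E] [NormedSpace ℝ E]
    {f : ℝ → E} {I : Set ℝ} (hc : I.OrdConnected)
    (h : ∀ u ∈ I, HasDerivAt f 0 u) {x y : ℝ} (hx : x ∈ I) (hy : y ∈ I) : f x = f y := by
  have hconv : Convex ℝ I := hc.convex
  have := hconv.norm_image_sub_le_of_norm_hasDerivWithin_le (C := 0)
    (fun u hu => (h u hu).hasDerivWithinAt) (fun u _ => by simp) hy hx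
  simpa [sub_eq_zero] using this

/-- The inverse function theorem provides a smooth local inverse, with which any global left inverse
must agree near f x. It serves both for the amplitude and for inverting the phase `landenAm`. -/
lemma contDiffAt_leftInverse {f g : ℝ → ℝ} (hf : ContDiff ℝ ∞ f) (hf' : ∀ x, 0 < deriv f x)
    (hg : ∀ x, g (f x) = x) (x : ℝ) : ContDiffAt ℝ ∞ g (f x) := by
  have hd : HasFDerivAt f ((ContinuousLinearEquiv.unitsEquivAut ℝ
      (Units.mk0 (deriv f x) (hf' x).ne') : ℝ ≃L[ℝ] ℝ) : ℝ →L[ℝ] ℝ) x := by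
    have h1 := ((hf.differentiable (by simp)) x).hasDerivAt.hasFDerivAt
    refine h1.congr_fderiv ?_
    ext
    simp
  have h := hf.contDiffAt (x := x)
  have hn : (∞ : WithTop ℕ∞) ≠ 0 := by simp
  have h1 := h.to_localInverse hd hn
  refine h1.congr_of_eventuallyEq ?_
  have h2 := (h.hasStrictFDerivAt' hd hn).eventually_right_inverse
  filter_upwards [h2] with y hy
  have h3 : f (h.localInverse hd hn y) = y := hy
  conv_lhs => rw [← h3]
  exact hg _

/-! ### Elliptic integrals and Jacobi's functions -/

lemma one_sub_sq_mul_sin_sq_pos {k : ℝ} (h0 : 0 ≤ k) (h1 : k < 1) (θ : ℝ) :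
    0 < 1 - k ^ 2 * Real.sin θ ^ 2 := by
  have := Real.sin_sq_le_one θ
  nlinarith [sq_nonneg k, sq_nonneg (Real.sin θ)]

lemma contDiff_ellipticF_integrand {k : ℝ} (h0 : 0 ≤ k) (h1 : k < 1) :
    ContDiff ℝ ∞ (fun θ : ℝ => 1 / √(1 - k ^ 2 * Real.sin θ ^ 2)) := by
  refine ContDiff.div contDiff_const (ContDiff.sqrt ?_ ?_) ?_
  · fun_prop
  · exact fun x => (one_sub_sq_mul_sin_sq_pos h0 h1 x).ne'
  · exact fun x => (Real.sqrt_pos.2 (one_sub_sq_mul_sin_sq_pos h0 h1 x)).ne'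

lemma hasDerivAt_ellipticF {k : ℝ} (h0 : 0 ≤ k) (h1 : k < 1) (φ : ℝ) :
    HasDerivAt (fun φ => ellipticF φ k) (1 / √(1 - k ^ 2 * Real.sin φ ^ 2)) φ :=
  ((contDiff_ellipticF_integrand h0 h1).continuous.integral_hasStrictDerivAt 0 φ).hasDerivAt

lemma ellipticF_deriv_ge_one {k : ℝ} (h0 : 0 ≤ k) (h1 : k < 1) (φ : ℝ) :
    1 ≤ 1 / √(1 - k ^ 2 * Real.sin φ ^ 2) := by
  have := one_sub_sq_mul_sin_sq_pos h0 h1 φ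
  rw [le_div_iff₀ (Real.sqrt_pos.2 this), one_mul, Real.sqrt_le_one]
  nlinarith [mul_nonneg (sq_nonneg k) (sq_nonneg (Real.sin φ))]

lemma ellipticF_zero (k : ℝ) : ellipticF 0 k = 0 := by simp [ellipticF]

lemma ellipticF_strictMono {k : ℝ} (h0 : 0 ≤ k) (h1 : k < 1) :
    StrictMono (fun φ => ellipticF φ k) := by
  apply strictMono_of_deriv_pos
  intro x
  rw [(hasDerivAt_ellipticF h0 h1 x).deriv]
  linarith [ellipticF_deriv_ge_one h0 h1 x]

/-- The integrand is at least 1, so F(φ) - φ is monotone and F dominates the identity at both ends.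
-/
lemma ellipticF_surjective {k : ℝ} (h0 : 0 ≤ k) (h1 : k < 1) :
    Function.Surjective (fun φ => ellipticF φ k) := by
  have hmono : Monotone (fun φ => ellipticF φ k - φ) := by
    apply monotone_of_deriv_nonneg
    · exact fun x => ((hasDerivAt_ellipticF h0 h1 x).sub (hasDerivAt_id x)).differentiableAt
    · intro x
      rw [((hasDerivAt_ellipticF h0 h1 x).fun_sub (hasDerivAt_id' x)).deriv]
      linarith [ellipticF_deriv_ge_one h0 h1 x]
  have hz := ellipticF_zero k
  apply Continuous.surjective
  · exact continuous_iff_continuousAt.2 fun x => (hasDerivAt_ellipticF h0 h1 x).continuousAt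
  · refine Filter.tendsto_atTop_mono' _ ?_ Filter.tendsto_id
    filter_upwards [Filter.eventually_ge_atTop 0] with x hx
    have := hmono hx
    simp only [hz, id] at this ⊢
    linarith
  · refine Filter.tendsto_atBot_mono' _ ?_ Filter.tendsto_id
    filter_upwards [Filter.eventually_le_atBot 0] with x hx
    have := hmono hx
    simp only [hz, id] at this ⊢
    linarith

lemma ellipticF_jacobiAm {k : ℝ} (h0 : 0 ≤ k) (h1 : k < 1) (u : ℝ) :
    ellipticF (jacobiAm u k) k = u := by
  rw [jacobiAm, if_pos h1]
  exact Function.rightInverse_invFun (ellipticF_surjective h0 h1) u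

lemma jacobiAm_ellipticF {k : ℝ} (h0 : 0 ≤ k) (h1 : k < 1) (φ : ℝ) :
    jacobiAm (ellipticF φ k) k = φ := by
  rw [jacobiAm, if_pos h1]
  exact Function.leftInverse_invFun (ellipticF_strictMono h0 h1).injective φ

lemma jacobiAm_one (u : ℝ) : jacobiAm u 1 = Real.arctan (Real.sinh u) := by simp [jacobiAm]

lemma jacobiCn_one (u : ℝ) : jacobiCn u 1 = 1 / Real.cosh u := by
  rw [jacobiCn, jacobiAm_one, Real.cos_arctan]
  congr 1
  rw [← Real.sqrt_sq (Real.cosh_pos u).le, Real.cosh_sq']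

lemma jacobiDn_one (u : ℝ) : jacobiDn u 1 = 1 / Real.cosh u := by
  rw [← jacobiCn_one, jacobiDn, jacobiSn, jacobiCn, one_pow, one_mul, ← Real.cos_sq',
    Real.sqrt_sq]
  have := jacobiCn_one u
  rw [jacobiCn] at this
  rw [this]
  exact (one_div_pos.2 (Real.cosh_pos u)).le

lemma jacobiSn_sq_add_jacobiCn_sq (u k : ℝ) : jacobiSn u k ^ 2 + jacobiCn u k ^ 2 = 1 :=
  Real.sin_sq_add_cos_sq _

section

variable {k : ℝ} (h0 : 0 ≤ k) (h1 : k ≤ 1)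
include h0 h1

/-- Modulus 1 is included because there the expression is cn² = 1/cosh², which never vanishes. -/
lemma one_sub_sq_mul_jacobiSn_sq_pos (u : ℝ) : 0 < 1 - k ^ 2 * jacobiSn u k ^ 2 := by
  rcases h1.lt_or_eq with h | rfl
  · exact one_sub_sq_mul_sin_sq_pos h0 h _
  · have := jacobiSn_sq_add_jacobiCn_sq u 1
    rw [jacobiCn_one] at this
    have h2 : 0 < (1 / Real.cosh u) ^ 2 := by have := Real.cosh_pos u; positivity
    linarith

lemma jacobiDn_pos (u : ℝ) : 0 < jacobiDn u k :=
  Real.sqrt_pos.2 (one_sub_sq_mul_jacobiSn_sq_pos h0 h1 u)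

lemma jacobiDn_sq (u : ℝ) : jacobiDn u k ^ 2 = 1 - k ^ 2 * jacobiSn u k ^ 2 :=
  Real.sq_sqrt (one_sub_sq_mul_jacobiSn_sq_pos h0 h1 u).le

lemma contDiff_jacobiAm : ContDiff ℝ ∞ (fun u => jacobiAm u k) := by
  rcases h1.lt_or_eq with h | rfl
  · rw [contDiff_iff_contDiffAt]
    intro u
    have hd : deriv (fun φ => ellipticF φ k) = fun φ => 1 / √(1 - k ^ 2 * Real.sin φ ^ 2) :=
      funext fun φ => (hasDerivAt_ellipticF h0 h φ).deriv
    have := contDiffAt_leftInverse (f := fun φ => ellipticF φ k) (g := fun u => jacobiAm u k)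
      (contDiff_of_hasDerivAt (hasDerivAt_ellipticF h0 h) (contDiff_ellipticF_integrand h0 h))
      (fun x => by rw [hd]; exact zero_lt_one.trans_le (ellipticF_deriv_ge_one h0 h x))
      (jacobiAm_ellipticF h0 h) (jacobiAm u k)
    simpa only [ellipticF_jacobiAm h0 h] using this
  · simp only [jacobiAm_one]
    exact Real.contDiff_arctan.comp Real.contDiff_sinh

lemma hasDerivAt_jacobiAm (u : ℝ) : HasDerivAt (fun u => jacobiAm u k) (jacobiDn u k) u := by
  rcases h1.lt_or_eq with h | rfl
  · have hpos := jacobiDn_pos h0 h1 u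
    have := HasDerivAt.of_local_left_inverse
      ((contDiff_jacobiAm h0 h1).continuous.continuousAt (x := u))
      (hasDerivAt_ellipticF h0 h (jacobiAm u k))
      (by have := ellipticF_deriv_ge_one h0 h (jacobiAm u k); positivity)
      (Filter.Eventually.of_forall (ellipticF_jacobiAm h0 h))
    refine this.congr_deriv ?_
    simp [jacobiDn, jacobiSn]
  · simp only [jacobiAm_one]
    refine (Real.hasDerivAt_sinh u).arctan.congr_deriv ?_
    rw [jacobiDn_one, ← Real.cosh_sq']
    have := Real.cosh_pos u
    field_simp

lemma jacobiAm_zero : jacobiAm 0 k = 0 := by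
  rcases h1.lt_or_eq with h | rfl
  · have := jacobiAm_ellipticF h0 h 0
    rwa [ellipticF_zero] at this
  · simp [jacobiAm_one]

lemma hasDerivAt_jacobiSn (u : ℝ) :
    HasDerivAt (fun u => jacobiSn u k) (jacobiCn u k * jacobiDn u k) u :=
  (hasDerivAt_jacobiAm h0 h1 u).sin

lemma hasDerivAt_jacobiCn (u : ℝ) :
    HasDerivAt (fun u => jacobiCn u k) (-jacobiSn u k * jacobiDn u k) u :=
  (hasDerivAt_jacobiAm h0 h1 u).cos

lemma contDiff_jacobiSn : ContDiff ℝ ∞ (fun u => jacobiSn u k) :=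
  (contDiff_jacobiAm h0 h1).sin

lemma contDiff_jacobiCn : ContDiff ℝ ∞ (fun u => jacobiCn u k) :=
  (contDiff_jacobiAm h0 h1).cos

lemma contDiff_jacobiDn : ContDiff ℝ ∞ (fun u => jacobiDn u k) := by
  refine ContDiff.sqrt ?_ fun x => (one_sub_sq_mul_jacobiSn_sq_pos h0 h1 x).ne'
  have := contDiff_jacobiSn h0 h1
  fun_prop

lemma hasDerivAt_jacobiDn (u : ℝ) :
    HasDerivAt (fun u => jacobiDn u k) (-(k ^ 2 * jacobiSn u k * jacobiCn u k)) u := by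
  have hd := jacobiDn_pos h0 h1 u
  have := ((((hasDerivAt_jacobiSn h0 h1 u).fun_pow 2).const_mul (k ^ 2)).const_sub 1).sqrt
    (one_sub_sq_mul_jacobiSn_sq_pos h0 h1 u).ne'
  refine this.congr_deriv ?_
  change _ / (2 * jacobiDn u k) = _
  field_simp
  norm_num
  ring

lemma hasDerivAt_ellipticE_jacobiAm (u : ℝ) :
    HasDerivAt (fun u => ellipticE (jacobiAm u k) k) (jacobiDn u k ^ 2) u := by
  have hc : Continuous (fun θ : ℝ => √(1 - k ^ 2 * Real.sin θ ^ 2)) := by fun_prop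
  have h := ((hc.integral_hasStrictDerivAt 0 (jacobiAm u k)).hasDerivAt).comp u
    (hasDerivAt_jacobiAm h0 h1 u)
  rw [pow_two]
  exact h

lemma contDiff_ellipticE_jacobiAm : ContDiff ℝ ∞ (fun u => ellipticE (jacobiAm u k) k) :=
  contDiff_of_hasDerivAt (hasDerivAt_ellipticE_jacobiAm h0 h1)
    ((contDiff_jacobiDn h0 h1).pow 2)

end

lemma jacobiAm_surjective {k : ℝ} (h0 : 0 ≤ k) (h1 : k < 1) :
    Function.Surjective (fun u => jacobiAm u k) :=
  fun φ => ⟨_, jacobiAm_ellipticF h0 h1 φ⟩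

lemma hasDerivAt_ellipticPi_jacobiAm {k n : ℝ} (h0 : 0 ≤ k) (h1 : k < 1) (hn : n < 1) (u : ℝ) :
    HasDerivAt (fun u => ellipticPi (jacobiAm u k) n k) (1 / (1 - n * jacobiSn u k ^ 2)) u := by
  have hpos : ∀ θ : ℝ, 0 < 1 - n * Real.sin θ ^ 2 := by
    intro θ
    have := Real.sin_sq_le_one θ
    rcases (sq_nonneg (Real.sin θ)).eq_or_lt with h | h
    · rw [← h]; norm_num
    · nlinarith
  have hc : Continuous
      (fun θ : ℝ => 1 / ((1 - n * Real.sin θ ^ 2) * √(1 - k ^ 2 * Real.sin θ ^ 2))) := by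
    refine Continuous.div continuous_const (by fun_prop) fun θ => ?_
    exact (mul_pos (hpos θ) (Real.sqrt_pos.2 (one_sub_sq_mul_sin_sq_pos h0 h1 θ))).ne'
  have h := ((hc.integral_hasStrictDerivAt 0 (jacobiAm u k)).hasDerivAt).comp u
    (hasDerivAt_jacobiAm h0 h1.le u)
  refine h.congr_deriv ?_
  change 1 / ((1 - n * jacobiSn u k ^ 2) * jacobiDn u k) * jacobiDn u k = _
  have := jacobiDn_pos h0 h1.le u
  have h2 : 0 < 1 - n * jacobiSn u k ^ 2 := hpos _
  field_simp

lemma arcsin_mul_jacobiSn_hasDerivAt {k : ℝ} (h0 : 0 ≤ k) (h1 : k ≤ 1) (u : ℝ) :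
    HasDerivAt (fun u => Real.arcsin (k * jacobiSn u k)) (k * jacobiCn u k) u := by
  have hp := one_sub_sq_mul_jacobiSn_sq_pos h0 h1 u
  have hlt : |k * jacobiSn u k| < 1 := by
    rw [← sq_lt_one_iff_abs_lt_one]; nlinarith
  have hd := jacobiDn_pos h0 h1 u
  have := (Real.hasDerivAt_arcsin (abs_lt.1 hlt).1.ne' (abs_lt.1 hlt).2.ne).comp u
    ((hasDerivAt_jacobiSn h0 h1 u).const_mul k)
  refine this.congr_deriv ?_
  rw [mul_pow]
  change 1 / jacobiDn u k * _ = _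
  field_simp

/-- The amplitude of the modulus related to `k` by Landen's transformation. -/
noncomputable def landenAm (u k : ℝ) : ℝ := jacobiAm u k + Real.arcsin (k * jacobiSn u k)

section

variable {k : ℝ} (h0 : 0 ≤ k) (h1 : k ≤ 1)
include h0 h1

lemma landenAm_zero : landenAm 0 k = 0 := by
  simp [landenAm, jacobiSn, jacobiAm_zero h0 h1]

lemma hasDerivAt_landenAm (u : ℝ) :
    HasDerivAt (fun u => landenAm u k) (jacobiDn u k + k * jacobiCn u k) u :=
  (hasDerivAt_jacobiAm h0 h1 u).add (arcsin_mul_jacobiSn_hasDerivAt h0 h1 u)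

lemma contDiff_landenAm : ContDiff ℝ ∞ (fun u => landenAm u k) := by
  refine contDiff_of_hasDerivAt (hasDerivAt_landenAm h0 h1) ?_
  have := contDiff_jacobiDn h0 h1
  have := contDiff_jacobiCn h0 h1
  fun_prop

/-- For k < 1 this rests on dn² - k² cn² = 1 - k² > 0; for k = 1 both terms equal 1/cosh. -/
lemma jacobiDn_add_pos (u : ℝ) : 0 < jacobiDn u k + k * jacobiCn u k := by
  have hd := jacobiDn_pos h0 h1 u
  rcases h1.lt_or_eq with h | rfl
  · have h2 := jacobiDn_sq h0 h1 u
    have h3 := jacobiSn_sq_add_jacobiCn_sq u k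
    by_contra hn
    nlinarith
  · rw [jacobiCn_one] at *
    have := Real.cosh_pos u
    positivity

lemma abs_mul_jacobiSn_le (u : ℝ) : |k * jacobiSn u k| ≤ 1 := by
  have hp := one_sub_sq_mul_jacobiSn_sq_pos h0 h1 u
  rw [← sq_le_one_iff_abs_le_one]; nlinarith

lemma sin_landenAm (u : ℝ) :
    Real.sin (landenAm u k) = jacobiSn u k * (jacobiDn u k + k * jacobiCn u k) := by
  have := abs_le.1 (abs_mul_jacobiSn_le h0 h1 u)
  rw [landenAm, Real.sin_add, Real.cos_arcsin, Real.sin_arcsin this.1 this.2, mul_pow]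
  change jacobiSn u k * jacobiDn u k + jacobiCn u k * _ = _
  ring

lemma cos_landenAm (u : ℝ) :
    Real.cos (landenAm u k) = jacobiCn u k * jacobiDn u k - k * jacobiSn u k ^ 2 := by
  have := abs_le.1 (abs_mul_jacobiSn_le h0 h1 u)
  rw [landenAm, Real.cos_add, Real.cos_arcsin, Real.sin_arcsin this.1 this.2, mul_pow]
  change jacobiCn u k * jacobiDn u k - jacobiSn u k * _ = _
  ring

lemma landenAm_strictMono : StrictMono (fun u => landenAm u k) := by
  apply strictMono_of_deriv_pos
  intro x
  rw [(hasDerivAt_landenAm h0 h1 x).deriv]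
  exact jacobiDn_add_pos h0 h1 x

end

/-- The phase differs from the amplitude, which is onto, by at most π/2. -/
lemma landenAm_surjective {k : ℝ} (h0 : 0 ≤ k) (h1 : k < 1) :
    Function.Surjective (fun u => landenAm u k) := by
  intro φ
  have hc := (contDiff_landenAm h0 h1.le).continuous
  obtain ⟨x, hx⟩ := jacobiAm_surjective h0 h1 (φ - Real.pi / 2)
  obtain ⟨y, hy⟩ := jacobiAm_surjective h0 h1 (φ + Real.pi / 2)
  simp only at hx hy
  apply mem_range_of_exists_le_of_exists_ge hc
  · exact ⟨x, by rw [landenAm, hx]; linarith [Real.arcsin_le_pi_div_two (k * jacobiSn x k)]⟩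
  · exact ⟨y, by rw [landenAm, hy]; linarith [Real.neg_pi_div_two_le_arcsin (k * jacobiSn y k)]⟩

/-- At modulus 1 the amplitude stays in (-π/2, π/2), where arcsin undoes sin. The phase then covers
only (-π, π), which makes the sphere exceptional throughout. -/
lemma landenAm_one (u : ℝ) : landenAm u 1 = 2 * Real.arctan (Real.sinh u) := by
  rw [landenAm, one_mul, jacobiSn, jacobiAm_one, Real.arcsin_sin]
  · ring
  · exact (Real.neg_pi_div_two_lt_arctan _).le
  · exact (Real.arctan_lt_pi_div_two _).le

lemma exists_landenAm_one {φ : ℝ} (h : φ ∈ Set.Ioo (-Real.pi) Real.pi) :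
    ∃ u, landenAm u 1 = φ := by
  refine ⟨Real.arsinh (Real.tan (φ / 2)), ?_⟩
  rw [landenAm_one, Real.sinh_arsinh, Real.arctan_tan] <;> linarith [h.1, h.2]

/-! ### Helicoidal surfaces in terms of the generating curve -/

/-- The Killing field of the helicoidal motions of pitch `l`. -/
def killing (l : ℝ) (q : E3) : E3 := ![-q 1, q 0, l]

@[simp] lemma killing_apply_zero (l : ℝ) (q : E3) : killing l q 0 = -q 1 := rfl
@[simp] lemma killing_apply_one (l : ℝ) (q : E3) : killing l q 1 = q 0 := rfl
@[simp] lemma killing_apply_two (l : ℝ) (q : E3) : killing l q 2 = l := rfl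

@[simp] lemma helicoidalMotion_apply_zero (l t : ℝ) (q : E3) :
    helicoidalMotion l t q 0 = Real.cos t * q 0 - Real.sin t * q 1 := rfl
@[simp] lemma helicoidalMotion_apply_one (l t : ℝ) (q : E3) :
    helicoidalMotion l t q 1 = Real.sin t * q 0 + Real.cos t * q 1 := rfl
@[simp] lemma helicoidalMotion_apply_two (l t : ℝ) (q : E3) :
    helicoidalMotion l t q 2 = q 2 + l * t := rfl

lemma dot_eq (a b : E3) : a ⬝ᵥ b = a 0 * b 0 + a 1 * b 1 + a 2 * b 2 := by
  simp [dotProduct, Fin.sum_univ_three]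

lemma cross_apply_zero (a b : E3) : crossProduct a b 0 = a 1 * b 2 - a 2 * b 1 := by
  simp [cross_apply]
lemma cross_apply_one (a b : E3) : crossProduct a b 1 = a 2 * b 0 - a 0 * b 2 := by
  simp [cross_apply]
lemma cross_apply_two (a b : E3) : crossProduct a b 2 = a 0 * b 1 - a 1 * b 0 := by
  simp [cross_apply]

lemma E3.ext {a b : E3} (h0 : a 0 = b 0) (h1 : a 1 = b 1) (h2 : a 2 = b 2) : a = b := by
  funext i
  fin_cases i
  · exact h0
  · exact h1
  · exact h2

lemma hasDerivAt_E3 {c : ℝ → E3} {c' : E3} {u : ℝ} :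
    HasDerivAt c c' u ↔ HasDerivAt (fun s => c s 0) (c' 0) u ∧
      HasDerivAt (fun s => c s 1) (c' 1) u ∧ HasDerivAt (fun s => c s 2) (c' 2) u := by
  rw [hasDerivAt_pi]
  simp [Fin.forall_fin_succ]

lemma contDiffOn_E3 {c : ℝ → E3} {I : Set ℝ} :
    ContDiffOn ℝ ∞ c I ↔ ContDiffOn ℝ ∞ (fun s => c s 0) I ∧
      ContDiffOn ℝ ∞ (fun s => c s 1) I ∧ ContDiffOn ℝ ∞ (fun s => c s 2) I := by
  rw [contDiffOn_pi]
  simp [Fin.forall_fin_succ]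

lemma helicoidalMotion_dot (v : ℝ) (a b : E3) :
    helicoidalMotion 0 v a ⬝ᵥ helicoidalMotion 0 v b = a ⬝ᵥ b := by
  simp only [dot_eq, helicoidalMotion_apply_zero, helicoidalMotion_apply_one,
    helicoidalMotion_apply_two]
  linear_combination (a 0 * b 0 + a 1 * b 1) * Real.sin_sq_add_cos_sq v

lemma helicoidalMotion_cross (v : ℝ) (a b : E3) :
    crossProduct (helicoidalMotion 0 v a) (helicoidalMotion 0 v b) =
      helicoidalMotion 0 v (crossProduct a b) := by
  apply E3.ext <;>
  simp only [cross_apply_zero, cross_apply_one, cross_apply_two, helicoidalMotion_apply_zero,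
    helicoidalMotion_apply_one, helicoidalMotion_apply_two]
  · ring
  · ring
  · linear_combination (a 0 * b 1 - a 1 * b 0) * Real.sin_sq_add_cos_sq v

lemma helicoidalMotion_smul (k v : ℝ) (a : E3) :
    helicoidalMotion 0 v (k • a) = k • helicoidalMotion 0 v a := by
  apply E3.ext <;> simp <;> ring

lemma helicoidalMotion_zero (l : ℝ) (a : E3) : helicoidalMotion l 0 a = a := by
  apply E3.ext <;> simp

lemma axisDist_helicoidalMotion (l v : ℝ) (a : E3) :
    axisDist (helicoidalMotion l v a) = axisDist a := by
  rw [axisDist, axisDist]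
  congr 1
  simp only [helicoidalMotion_apply_zero, helicoidalMotion_apply_one]
  linear_combination (a 0 ^ 2 + a 1 ^ 2) * Real.sin_sq_add_cos_sq v

lemma axisDist_smul (k : ℝ) (a : E3) : axisDist (k • a) = |k| * axisDist a := by
  rw [axisDist, axisDist, ← Real.sqrt_sq_eq_abs, ← Real.sqrt_mul (sq_nonneg k)]
  congr 1
  simp only [Pi.smul_apply, smul_eq_mul]
  ring

lemma hasDerivAt_helicoidalMotion_comp {c : ℝ → E3} {c' : E3} {u : ℝ} (l v : ℝ)
    (h : HasDerivAt c c' u) :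
    HasDerivAt (fun s => helicoidalMotion l v (c s)) (helicoidalMotion 0 v c') u := by
  obtain ⟨h0, h1, h2⟩ := hasDerivAt_E3.1 h
  refine hasDerivAt_E3.2 ⟨?_, ?_, ?_⟩
  · exact (h0.const_mul _).sub (h1.const_mul _)
  · exact (h0.const_mul _).add (h1.const_mul _)
  · refine (h2.add_const _).congr_deriv ?_
    simp

lemma hasDerivAt_helicoidalMotion (l : ℝ) (q : E3) (v : ℝ) :
    HasDerivAt (fun t => helicoidalMotion l t q) (helicoidalMotion 0 v (killing l q)) v := by
  refine hasDerivAt_E3.2 ⟨?_, ?_, ?_⟩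
  · refine (((Real.hasDerivAt_cos v).mul_const (q 0)).sub
      ((Real.hasDerivAt_sin v).mul_const (q 1))).congr_deriv ?_
    simp; ring
  · refine (((Real.hasDerivAt_sin v).mul_const (q 0)).add
      ((Real.hasDerivAt_cos v).mul_const (q 1))).congr_deriv ?_
    simp; ring
  · refine (((hasDerivAt_id' v).const_mul l).const_add (q 2)).congr_deriv ?_
    simp

lemma hasDerivAt_killing {c : ℝ → E3} {c' : E3} {u : ℝ} (l : ℝ) (h : HasDerivAt c c' u) :
    HasDerivAt (fun s => killing l (c s)) (killing 0 c') u := by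
  obtain ⟨h0, h1, h2⟩ := hasDerivAt_E3.1 h
  exact hasDerivAt_E3.2 ⟨h1.neg, h0, hasDerivAt_const u l⟩

lemma hasDerivAt_dot {a b : ℝ → E3} {a' b' : E3} {u : ℝ} (ha : HasDerivAt a a' u)
    (hb : HasDerivAt b b' u) :
    HasDerivAt (fun s => a s ⬝ᵥ b s) (a' ⬝ᵥ b u + a u ⬝ᵥ b') u := by
  obtain ⟨h0, h1, h2⟩ := hasDerivAt_E3.1 ha
  obtain ⟨g0, g1, g2⟩ := hasDerivAt_E3.1 hb
  simp only [dot_eq]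
  refine (((h0.mul g0).add (h1.mul g1)).add (h2.mul g2)).congr_deriv ?_
  ring

/-- The Gauss map of a helicoidal surface along its generating curve. -/
noncomputable def unitNormal (l : ℝ) (c : ℝ → E3) (u : ℝ) : E3 :=
  (1 / √(crossProduct (deriv c u) (killing l (c u)) ⬝ᵥ
    crossProduct (deriv c u) (killing l (c u)))) •
    crossProduct (deriv c u) (killing l (c u))

lemma partialV_helicoidalSurface (l : ℝ) (c : ℝ → E3) (u v : ℝ) :
    partialV (helicoidalSurface l c) u v = helicoidalMotion 0 v (killing l (c u)) :=
  (hasDerivAt_helicoidalMotion l (c u) v).deriv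

lemma partialU_helicoidalSurface (l : ℝ) {c : ℝ → E3} {u : ℝ} (v : ℝ)
    (h : DifferentiableAt ℝ c u) :
    partialU (helicoidalSurface l c) u v = helicoidalMotion 0 v (deriv c u) :=
  (hasDerivAt_helicoidalMotion_comp l v h.hasDerivAt).deriv

lemma partial_cross (l : ℝ) {c : ℝ → E3} {u : ℝ} (v : ℝ)
    (h : DifferentiableAt ℝ c u) :
    crossProduct (partialU (helicoidalSurface l c) u v) (partialV (helicoidalSurface l c) u v) =
      helicoidalMotion 0 v (crossProduct (deriv c u) (killing l (c u))) := by
  rw [partialV_helicoidalSurface, partialU_helicoidalSurface l v h, helicoidalMotion_cross]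

lemma gaussMap_helicoidalSurface (l : ℝ) {c : ℝ → E3} {u : ℝ} (v : ℝ)
    (h : DifferentiableAt ℝ c u) :
    gaussMap (helicoidalSurface l c) u v = helicoidalMotion 0 v (unitNormal l c u) := by
  rw [gaussMap, unitNormal, partial_cross l v h, helicoidalMotion_smul, helicoidalMotion_dot]

lemma dot_self_pos {a : E3} (h : a ≠ 0) : 0 < a ⬝ᵥ a := by
  rw [dot_eq]
  by_contra hn
  apply h
  apply E3.ext <;> simp <;> nlinarith [sq_nonneg (a 0), sq_nonneg (a 1), sq_nonneg (a 2)]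

/-- A generating curve of an immersed helicoidal surface, in terms of the curve alone. -/
structure IsGenerating (l : ℝ) (I : Set ℝ) (c : ℝ → E3) : Prop where
  isOpen : IsOpen I
  ordConnected : I.OrdConnected
  smooth : ContDiffOn ℝ ∞ c I
  cross_ne : ∀ u ∈ I, crossProduct (deriv c u) (killing l (c u)) ≠ 0

lemma differentiableAt_of_contDiffOn {c : ℝ → E3} {I : Set ℝ} (hI : IsOpen I)
    (hc : ContDiffOn ℝ ∞ c I) {u : ℝ} (hu : u ∈ I) : DifferentiableAt ℝ c u :=
  (hc.differentiableOn (by simp)).differentiableAt (hI.mem_nhds hu)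

lemma isHelicoidalImmersion_iff {l : ℝ} {I : Set ℝ} {c : ℝ → E3} :
    IsHelicoidalImmersion l I c ↔ IsGenerating l I c := by
  constructor
  · intro h
    refine ⟨h.isOpen, h.ordConnected, h.smooth, fun u hu => ?_⟩
    have h1 := h.immersion u hu 0
    rwa [partial_cross l 0 (differentiableAt_of_contDiffOn h.isOpen h.smooth hu),
      helicoidalMotion_zero] at h1
  · intro h
    refine ⟨h.isOpen, h.ordConnected, h.smooth, fun u hu v h0 => ?_⟩
    rw [partial_cross l v (differentiableAt_of_contDiffOn h.isOpen h.smooth hu)] at h0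
    have h1 := dot_self_pos (h.cross_ne u hu)
    rw [← helicoidalMotion_dot v, h0] at h1
    simp at h1

namespace IsGenerating

variable {l : ℝ} {I : Set ℝ} {c : ℝ → E3}

lemma contDiffOn_deriv (h : IsGenerating l I c) : ContDiffOn ℝ ∞ (deriv c) I :=
  ((contDiffOn_infty_iff_deriv_of_isOpen h.isOpen).1 h.smooth).2

lemma hasDerivAt (h : IsGenerating l I c) {u : ℝ} (hu : u ∈ I) :
    HasDerivAt c (deriv c u) u :=
  (differentiableAt_of_contDiffOn h.isOpen h.smooth hu).hasDerivAt

lemma hasDerivAt_deriv (h : IsGenerating l I c) {u : ℝ} (hu : u ∈ I) :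
    HasDerivAt (deriv c) (deriv (deriv c) u) u :=
  (differentiableAt_of_contDiffOn h.isOpen h.contDiffOn_deriv hu).hasDerivAt

lemma contDiffOn_unitNormal (h : IsGenerating l I c) : ContDiffOn ℝ ∞ (unitNormal l c) I := by
  obtain ⟨c0, c1, c2⟩ := contDiffOn_E3.1 h.smooth
  obtain ⟨d0, d1, d2⟩ := contDiffOn_E3.1 h.contDiffOn_deriv
  have hN : ContDiffOn ℝ ∞ (fun u => crossProduct (deriv c u) (killing l (c u))) I := by
    rw [contDiffOn_E3]
    simp only [cross_apply_zero, cross_apply_one, cross_apply_two, killing_apply_zero,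
      killing_apply_one, killing_apply_two]
    exact ⟨by fun_prop, by fun_prop, by fun_prop⟩
  obtain ⟨n0, n1, n2⟩ := contDiffOn_E3.1 hN
  have hd : ContDiffOn ℝ ∞ (fun u => crossProduct (deriv c u) (killing l (c u)) ⬝ᵥ
      crossProduct (deriv c u) (killing l (c u))) I := by
    simp only [dot_eq]
    fun_prop
  have hs : ContDiffOn ℝ ∞ (fun u => 1 / √(crossProduct (deriv c u) (killing l (c u)) ⬝ᵥ
      crossProduct (deriv c u) (killing l (c u)))) I := by
    refine contDiffOn_const.div (hd.sqrt fun u hu => ?_) fun u hu => ?_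
    · exact (dot_self_pos (h.cross_ne u hu)).ne'
    · exact (Real.sqrt_pos.2 (dot_self_pos (h.cross_ne u hu))).ne'
  exact hs.smul hN

lemma hasDerivAt_unitNormal (h : IsGenerating l I c) {u : ℝ} (hu : u ∈ I) :
    HasDerivAt (unitNormal l c) (deriv (unitNormal l c) u) u :=
  (differentiableAt_of_contDiffOn h.isOpen h.contDiffOn_unitNormal hu).hasDerivAt

lemma exists_cross_eq (h : IsGenerating l I c) {u : ℝ} (hu : u ∈ I) :
    ∃ W : ℝ, 0 < W ∧ crossProduct (deriv c u) (killing l (c u)) = W • unitNormal l c u ∧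
      unitNormal l c u ⬝ᵥ unitNormal l c u = 1 := by
  have hp := dot_self_pos (h.cross_ne u hu)
  have hs := Real.sqrt_pos.2 hp
  refine ⟨_, hs, ?_, ?_⟩
  · rw [unitNormal, smul_smul, mul_one_div_cancel hs.ne', one_smul]
  · rw [unitNormal, smul_dotProduct, dotProduct_smul, smul_eq_mul, smul_eq_mul]
    have := Real.sq_sqrt hp.le
    field_simp
    exact this.symm

lemma dot_unitNormal (l : ℝ) (c : ℝ → E3) (u : ℝ) : deriv c u ⬝ᵥ unitNormal l c u = 0 := by
  rw [unitNormal, dotProduct_smul, dot_self_cross, smul_zero]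

lemma killing_dot_unitNormal (l : ℝ) (c : ℝ → E3) (u : ℝ) :
    killing l (c u) ⬝ᵥ unitNormal l c u = 0 := by
  rw [unitNormal, dotProduct_smul, dot_cross_self, smul_zero]

/-- Differentiating c' · m = 0 trades the second derivative of the curve for the derivative of the
normal, so only first derivatives of the frame enter the curvatures. -/
lemma deriv_deriv_dot (h : IsGenerating l I c) {u : ℝ} (hu : u ∈ I) :
    deriv (deriv c) u ⬝ᵥ unitNormal l c u = -(deriv c u ⬝ᵥ deriv (unitNormal l c) u) := by
  have h1 := hasDerivAt_dot (h.hasDerivAt_deriv hu) (h.hasDerivAt_unitNormal hu)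
  simp only [dot_unitNormal] at h1
  have := h1.unique (hasDerivAt_const u 0)
  linarith

/-- The symmetry of the second fundamental form, obtained by differentiating k · m = 0; the linear
part of the Killing field is skew. -/
lemma killing_dot_deriv (h : IsGenerating l I c) {u : ℝ} (hu : u ∈ I) :
    killing l (c u) ⬝ᵥ deriv (unitNormal l c) u = deriv c u ⬝ᵥ killing 0 (unitNormal l c u) := by
  have h1 := hasDerivAt_dot (hasDerivAt_killing l (h.hasDerivAt hu)) (h.hasDerivAt_unitNormal hu)
  simp only [killing_dot_unitNormal] at h1
  have := h1.unique (hasDerivAt_const u 0)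
  have h2 : killing 0 (deriv c u) ⬝ᵥ unitNormal l c u =
      -(deriv c u ⬝ᵥ killing 0 (unitNormal l c u)) := by
    simp only [dot_eq, killing_apply_zero, killing_apply_one, killing_apply_two]; ring
  linarith

lemma unitNormal_dot_deriv (h : IsGenerating l I c) {u : ℝ} (hu : u ∈ I) :
    unitNormal l c u ⬝ᵥ deriv (unitNormal l c) u = 0 := by
  have h1 := hasDerivAt_dot (h.hasDerivAt_unitNormal hu) (h.hasDerivAt_unitNormal hu)
  have h2 : HasDerivAt (fun s => unitNormal l c s ⬝ᵥ unitNormal l c s) 0 u := by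
    refine (hasDerivAt_const u (1 : ℝ)).congr_of_eventuallyEq ?_
    filter_upwards [h.isOpen.mem_nhds hu] with s hs
    exact (h.exists_cross_eq hs).choose_spec.2.2
  have := h1.unique h2
  rw [dotProduct_comm] at this
  linarith

section

variable (h : IsGenerating l I c) {u : ℝ} (hu : u ∈ I) (v : ℝ)
include h hu

lemma fffE_eq : fffE (helicoidalSurface l c) u v = deriv c u ⬝ᵥ deriv c u := by
  rw [fffE, partialU_helicoidalSurface l v (h.hasDerivAt hu).differentiableAt,
    helicoidalMotion_dot]

lemma fffF_eq : fffF (helicoidalSurface l c) u v = deriv c u ⬝ᵥ killing l (c u) := by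
  rw [fffF, partialU_helicoidalSurface l v (h.hasDerivAt hu).differentiableAt,
    partialV_helicoidalSurface, helicoidalMotion_dot]

lemma sffL_eq : sffL (helicoidalSurface l c) u v =
    -(deriv c u ⬝ᵥ deriv (unitNormal l c) u) := by
  have h1 : partialU (partialU (helicoidalSurface l c)) u v =
      helicoidalMotion 0 v (deriv (deriv c) u) := by
    refine HasDerivAt.deriv ?_
    refine (hasDerivAt_helicoidalMotion_comp 0 v (h.hasDerivAt_deriv hu)).congr_of_eventuallyEq ?_
    filter_upwards [h.isOpen.mem_nhds hu] with s hs
    exact partialU_helicoidalSurface l v (h.hasDerivAt hs).differentiableAt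
  rw [sffL, h1, gaussMap_helicoidalSurface l v (h.hasDerivAt hu).differentiableAt,
    helicoidalMotion_dot, h.deriv_deriv_dot hu]

lemma sffM_eq : sffM (helicoidalSurface l c) u v =
    -(deriv c u ⬝ᵥ killing 0 (unitNormal l c u)) := by
  have h1 : partialU (partialV (helicoidalSurface l c)) u v =
      helicoidalMotion 0 v (killing 0 (deriv c u)) := by
    refine HasDerivAt.deriv ?_
    simp only [partialV_helicoidalSurface]
    exact hasDerivAt_helicoidalMotion_comp 0 v (hasDerivAt_killing l (h.hasDerivAt hu))
  rw [sffM, h1, gaussMap_helicoidalSurface l v (h.hasDerivAt hu).differentiableAt,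
    helicoidalMotion_dot]
  simp only [dot_eq, killing_apply_zero, killing_apply_one, killing_apply_two]; ring

lemma sffN_eq : sffN (helicoidalSurface l c) u v =
    -(killing l (c u) ⬝ᵥ killing 0 (unitNormal l c u)) := by
  have h1 : partialV (partialV (helicoidalSurface l c)) u v =
      helicoidalMotion 0 v (killing 0 (killing l (c u))) := by
    refine HasDerivAt.deriv ?_
    simp only [partialV_helicoidalSurface]
    exact hasDerivAt_helicoidalMotion 0 (killing l (c u)) v
  rw [sffN, h1, gaussMap_helicoidalSurface l v (h.hasDerivAt hu).differentiableAt,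
    helicoidalMotion_dot]
  simp only [dot_eq, killing_apply_zero, killing_apply_one, killing_apply_two]; ring

end

lemma fffG_eq (l : ℝ) (c : ℝ → E3) (u v : ℝ) :
    fffG (helicoidalSurface l c) u v = killing l (c u) ⬝ᵥ killing l (c u) := by
  rw [fffG, partialV_helicoidalSurface, helicoidalMotion_dot]

end IsGenerating

/-! ### Scaling -/

lemma partialU_smul (k : ℝ) (x : ℝ → ℝ → E3) :
    partialU (fun u v => k • x u v) = fun u v => k • partialU x u v := by
  funext u v
  exact deriv_fun_const_smul_field k (fun s => x s v)

lemma partialV_smul (k : ℝ) (x : ℝ → ℝ → E3) :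
    partialV (fun u v => k • x u v) = fun u v => k • partialV x u v := by
  funext u v
  exact deriv_fun_const_smul_field k (fun s => x u s)

/-- Each partial derivative contributes a factor k, and k² > 0: even a negative scaling keeps the
normal. Hence scaling divides the mean curvature by k with its sign, and any H ≠ 0 can be brought to
-1/2. -/
lemma gaussMap_smul {k : ℝ} (hk : k ≠ 0) (x : ℝ → ℝ → E3) (u v : ℝ) :
    gaussMap (fun u v => k • x u v) u v = gaussMap x u v := by
  simp only [gaussMap, partialU_smul, partialV_smul, map_smul, LinearMap.smul_apply,
    smul_dotProduct, dotProduct_smul, smul_smul, smul_eq_mul]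
  congr 1
  have h4 : ∀ t : ℝ, k * k * (k * k * t) = (k ^ 2) ^ 2 * t := fun t => by ring
  rw [h4, Real.sqrt_mul (sq_nonneg _), Real.sqrt_sq (sq_nonneg k)]
  field_simp

lemma meanCurvature_smul {k : ℝ} (hk : k ≠ 0) (x : ℝ → ℝ → E3) (u v : ℝ) :
    meanCurvature (fun u v => k • x u v) u v = meanCurvature x u v / k := by
  simp only [meanCurvature, fffE, fffF, fffG, sffL, sffM, sffN, gaussMap_smul hk, partialU_smul,
    partialV_smul, smul_dotProduct, dotProduct_smul, smul_eq_mul]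
  rw [div_div, ← mul_div_mul_left _ (_ * k) (pow_ne_zero 3 hk)]
  congr 1 <;> ring

lemma helicoidalSurface_smul (k l : ℝ) (c : ℝ → E3) :
    helicoidalSurface (k * l) (fun u => k • c u) = fun u v => k • helicoidalSurface l c u v := by
  funext u v
  simp only [helicoidalSurface]
  apply E3.ext <;> simp <;> ring

lemma IsHelicoidalImmersion.smul {l k : ℝ} {I : Set ℝ} {c : ℝ → E3} (hk : k ≠ 0)
    (h : IsHelicoidalImmersion l I c) : IsHelicoidalImmersion (k * l) I (fun u => k • c u) := by
  refine ⟨h.isOpen, h.ordConnected, h.smooth.const_smul k, fun u hu v => ?_⟩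
  rw [helicoidalSurface_smul]
  simp only [partialU_smul, partialV_smul, map_smul, LinearMap.smul_apply]
  exact smul_ne_zero hk (smul_ne_zero hk (h.immersion u hu v))

lemma IsCmcHelicoid.smul {H l k : ℝ} {I : Set ℝ} {c : ℝ → E3} (hk : k ≠ 0)
    (h : IsCmcHelicoid H l I c) : IsCmcHelicoid (H / k) (k * l) I (fun u => k • c u) := by
  refine ⟨h.toIsHelicoidalImmersion.smul hk, div_ne_zero h.ne_zero hk, fun u hu v => ?_⟩
  rw [helicoidalSurface_smul, meanCurvature_smul hk, h.meanCurvature_eq u hu v]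

/-! ### The structure equations of a helicoidal surface of mean curvature `-1/2` -/

lemma decomposition {k m : E3} (hm : m ⬝ᵥ m = 1) (hk : k ⬝ᵥ m = 0) {a : E3}
    (ha : m ⬝ᵥ a = 0) :
    (k ⬝ᵥ k) • a = (a ⬝ᵥ crossProduct k m) • crossProduct k m + (k ⬝ᵥ a) • k := by
  -- Expansion of a in the frame k × m, k, m, as a polynomial identity valid for arbitrary vectors.
  have key : ∀ i : Fin 3, (k ⬝ᵥ k * (m ⬝ᵥ m) - (k ⬝ᵥ m) ^ 2) * a i =
      (a ⬝ᵥ crossProduct k m) * crossProduct k m i +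
        (k ⬝ᵥ a * (m ⬝ᵥ m) - m ⬝ᵥ a * (k ⬝ᵥ m)) * k i +
        (m ⬝ᵥ a * (k ⬝ᵥ k) - k ⬝ᵥ a * (k ⬝ᵥ m)) * m i := by
    intro i
    fin_cases i <;> simp [cross_apply, dotProduct, Fin.sum_univ_three] <;> ring
  funext i
  have := key i
  rw [hm, hk, ha] at this
  simp only [Pi.smul_apply, Pi.add_apply, smul_eq_mul]
  linear_combination this

lemma velocity_eq {a k m : E3} {W : ℝ} (hW : crossProduct a k = W • m) :
    (k ⬝ᵥ k) • a = W • crossProduct k m + (a ⬝ᵥ k) • k := by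
  have h : W • crossProduct k m = crossProduct k (crossProduct a k) := by rw [hW, map_smul]
  rw [h]
  funext i
  fin_cases i <;> simp [cross_apply, dotProduct, Fin.sum_univ_three] <;> ring

section

variable {a k m α : E3} {W q l r τ : ℝ} (hm : m ⬝ᵥ m = 1) (hk : k ⬝ᵥ m = 0)
  (hk0 : 0 < k ⬝ᵥ k) (hk2 : k 2 = l)
  (hq : k ⬝ᵥ killing 0 m = q) (hr : r * (k ⬝ᵥ k) = W) (hτ : τ * (k ⬝ᵥ k) = a ⬝ᵥ k)
  (hW : crossProduct a k = W • m) (hmα : m ⬝ᵥ α = 0)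
  (hkα : k ⬝ᵥ α = a ⬝ᵥ killing 0 m) (hr0 : r ≠ 0)
include hm hk hk0 hk2 hr hτ hW

omit hm hk hk2 in
lemma velocity_frame : a = r • crossProduct k m + τ • k := by
  have h := velocity_eq hW
  rw [← hr, ← hτ] at h
  have h2 : (k ⬝ᵥ k) • a = (k ⬝ᵥ k) • (r • crossProduct k m + τ • k) := by
    rw [h, smul_add, smul_smul, smul_smul, mul_comm r, mul_comm τ]
  exact smul_right_injective E3 hk0.ne' h2

omit hk0 hr hτ hW in
lemma killing_normal_frame (hq : k ⬝ᵥ killing 0 m = q) :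
    (k ⬝ᵥ k) • killing 0 m = l • crossProduct k m + q • k := by
  rw [decomposition hm hk (a := killing 0 m), hq]
  · congr 2
    simp only [dot_eq, cross_apply_zero, cross_apply_one, cross_apply_two, killing_apply_zero,
      killing_apply_one, killing_apply_two] at hm hk ⊢
    rw [← hk2]
    linear_combination k 2 * hm - m 2 * hk
  · simp only [dot_eq, killing_apply_zero, killing_apply_one, killing_apply_two]
    ring

include hq hmα hkα hr0

/-- The Weingarten equation for 2H = -1. The component of α along m vanishes and the one along k is
known by symmetry; the curvature hypothesis is linear in the remaining component along k × m, with
coefficient a multiple of r|k|² ≠ 0. -/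
lemma normal_frame
    (hH : k ⬝ᵥ k * -(a ⬝ᵥ α) - 2 * (a ⬝ᵥ k) * -(a ⬝ᵥ killing 0 m) +
      a ⬝ᵥ a * -(k ⬝ᵥ killing 0 m) = -(a ⬝ᵥ a * (k ⬝ᵥ k) - (a ⬝ᵥ k) ^ 2)) :
    α = r • ((1 - q / (k ⬝ᵥ k)) • crossProduct k m + (l / (k ⬝ᵥ k)) • k) + τ • killing 0 m := by
  have hv := velocity_frame hk0 hr hτ hW
  have hβ := killing_normal_frame hm hk hk2 hq
  have hα := decomposition hm hk hmα
  have hTT : crossProduct k m ⬝ᵥ crossProduct k m = k ⬝ᵥ k := by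
    rw [cross_dot_cross, hm, hk, dotProduct_comm m k, hk]; ring
  have hTk : k ⬝ᵥ crossProduct k m = 0 := dot_self_cross k m
  have hTβ : crossProduct k m ⬝ᵥ killing 0 m = l := by
    have := congrArg (fun w => crossProduct k m ⬝ᵥ w) hβ
    simp only [dotProduct_smul, dotProduct_add, hTT, dotProduct_comm _ k, hTk, smul_eq_mul] at this
    have h2 : (k ⬝ᵥ k) * (crossProduct k m ⬝ᵥ killing 0 m - l) = 0 := by linear_combination this
    rcases mul_eq_zero.1 h2 with h | h
    · exact absurd h hk0.ne'
    · linarith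
  have haβ : a ⬝ᵥ killing 0 m = r * l + τ * q := by
    conv_lhs => rw [hv]
    rw [add_dotProduct, smul_dotProduct, smul_dotProduct, hTβ, hq, smul_eq_mul, smul_eq_mul]
  have haa : a ⬝ᵥ a = (r ^ 2 + τ ^ 2) * (k ⬝ᵥ k) := by
    conv_lhs => rw [hv]
    simp only [add_dotProduct, dotProduct_add, smul_dotProduct, dotProduct_smul, hTT, hTk,
      dotProduct_comm _ k, smul_eq_mul]
    ring
  have haα : a ⬝ᵥ α = r * (α ⬝ᵥ crossProduct k m) + τ * (r * l + τ * q) := by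
    conv_lhs => rw [hv]
    rw [add_dotProduct, smul_dotProduct, smul_dotProduct, hkα, haβ, dotProduct_comm _ α,
      smul_eq_mul, smul_eq_mul]
  have hαT : α ⬝ᵥ crossProduct k m = τ * l - r * q + r * (k ⬝ᵥ k) := by
    rw [haα, haβ, hq, haa, ← hτ] at hH
    have h2 : (k ⬝ᵥ k * r) * (α ⬝ᵥ crossProduct k m - (τ * l - r * q + r * (k ⬝ᵥ k))) = 0 := by
      linear_combination -hH
    rcases mul_eq_zero.1 h2 with h | h
    · exact absurd h (mul_ne_zero hk0.ne' hr0)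
    · linarith
  rw [hkα, haβ, hαT] at hα
  refine smul_right_injective E3 hk0.ne' ?_
  simp only
  rw [hα]
  funext i
  have hβi := congrFun hβ i
  simp only [Pi.smul_apply, Pi.add_apply, smul_eq_mul] at hβi ⊢
  have := hk0.ne'
  field_simp
  linear_combination -τ * hβi

end

/-- The horizontal part of a vector, as a complex number. -/
def horizontal (q : E3) : ℂ := ⟨q 0, q 1⟩

@[simp] lemma horizontal_re (q : E3) : (horizontal q).re = q 0 := rfl
@[simp] lemma horizontal_im (q : E3) : (horizontal q).im = q 1 := rfl

lemma hasDerivAt_complex {f : ℝ → ℂ} {f' : ℂ} {u : ℝ} (hre : HasDerivAt (fun s => (f s).re) f'.re u)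
    (him : HasDerivAt (fun s => (f s).im) f'.im u) : HasDerivAt f f' u := by
  have := (hre.ofReal_comp).add ((him.ofReal_comp).mul_const Complex.I)
  simp only [Complex.re_add_im] at this
  refine this.congr_of_eventuallyEq (Filter.Eventually.of_forall fun s => ?_)
  simp [Complex.re_add_im]

lemma hasDerivAt_horizontal {c : ℝ → E3} {c' : E3} {u : ℝ} (h : HasDerivAt c c' u) :
    HasDerivAt (fun s => horizontal (c s)) (horizontal c') u :=
  hasDerivAt_complex (hasDerivAt_E3.1 h).1 (hasDerivAt_E3.1 h).2.1

/-- The structure equations of a helicoidal surface of pitch `l` and mean curvature `-1/2`, with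
horizontal parts `ξ`, `ν` of the generating curve and the normal, and vertical parts `z`, `n`. The
first integral `R` and the phase `θ` determine the frame up to helicoidal motions. -/
structure HelicoidData (R l : ℝ) (I : Set ℝ) (ξ ν : ℝ → ℂ) (z n θ r τ κ : ℝ → ℝ) : Prop where
  κ_pos : ∀ u ∈ I, 0 < κ u
  κ_sq : ∀ u ∈ I, κ u ^ 2 = Complex.normSq (ξ u) + l ^ 2
  normSq_eq : ∀ u ∈ I, Complex.normSq (ξ u) = 1 + R ^ 2 + 2 * R * Real.cos (θ u)
  inner_eq : ∀ u ∈ I, ν u * starRingEnd ℂ (ξ u) = ⟨1 + R * Real.cos (θ u), -(l * n u)⟩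
  n_eq : ∀ u ∈ I, κ u * n u = -(R * Real.sin (θ u))
  unit : ∀ u ∈ I, Complex.normSq (ν u) + n u ^ 2 = 1
  r_ne : ∀ u ∈ I, r u ≠ 0
  dξ : ∀ u ∈ I, HasDerivAt ξ
    (r u * (n u * ξ u + Complex.I * l * ν u) + Complex.I * τ u * ξ u) u
  dν : ∀ u ∈ I, HasDerivAt ν
    (r u * ((1 - ((1 + R * Real.cos (θ u) : ℝ) : ℂ) / (κ u : ℂ) ^ 2) *
      (n u * ξ u + Complex.I * l * ν u) + l / (κ u : ℂ) ^ 2 * (Complex.I * ξ u)) +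
      Complex.I * τ u * ν u) u
  dz : ∀ u ∈ I, HasDerivAt z (-(r u * (1 + R * Real.cos (θ u))) + l * τ u) u
  dθ : ∀ u ∈ I, HasDerivAt θ (κ u * r u) u
  smooth_τ : ContDiffOn ℝ ∞ τ I
  smooth_θ : ContDiffOn ℝ ∞ θ I

/-- The reflection z ↦ -z. Reversing the phase forces r to change sign, which is why the structure
asks only for r ≠ 0. -/
lemma HelicoidData.flip {R l : ℝ} {I : Set ℝ} {ξ ν : ℝ → ℂ} {z n θ r τ κ : ℝ → ℝ}
    (h : HelicoidData R l I ξ ν z n θ r τ κ) :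
    HelicoidData R (-l) I ξ ν (fun u => -z u) (fun u => -n u) (fun u => -θ u) (fun u => -r u)
      τ κ where
  κ_pos := h.κ_pos
  κ_sq u hu := by rw [h.κ_sq u hu]; ring
  normSq_eq u hu := by rw [h.normSq_eq u hu, Real.cos_neg]
  inner_eq u hu := by rw [h.inner_eq u hu, Real.cos_neg, neg_mul_neg]
  n_eq u hu := by rw [Real.sin_neg]; linear_combination -h.n_eq u hu
  unit u hu := by rw [neg_sq, h.unit u hu]
  r_ne u hu := neg_ne_zero.2 (h.r_ne u hu)
  dξ u hu := (h.dξ u hu).congr_deriv (by push_cast; ring)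
  dν u hu := (h.dν u hu).congr_deriv (by rw [Real.cos_neg]; push_cast; ring)
  dz u hu := (h.dz u hu).neg.congr_deriv (by rw [Real.cos_neg]; ring)
  dθ u hu := (h.dθ u hu).neg.congr_deriv (by ring)
  smooth_τ := h.smooth_τ
  smooth_θ := h.smooth_θ.neg

lemma HelicoidData.κ_sq_eq {R l : ℝ} {I : Set ℝ} {ξ ν : ℝ → ℂ} {z n θ r τ κ : ℝ → ℝ}
    (h : HelicoidData R l I ξ ν z n θ r τ κ) {u : ℝ} (hu : u ∈ I) :
    κ u ^ 2 = 1 + R ^ 2 + 2 * R * Real.cos (θ u) + l ^ 2 := by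
  rw [h.κ_sq u hu, h.normSq_eq u hu]

/-! ### Mean curvature, speeds and invariants along the generating curve -/

namespace IsGenerating

variable {l : ℝ} {I : Set ℝ} {c : ℝ → E3}

lemma killing_dot_self_pos (h : IsGenerating l I c) {u : ℝ} (hu : u ∈ I) :
    0 < killing l (c u) ⬝ᵥ killing l (c u) := by
  apply dot_self_pos
  intro h0
  apply h.cross_ne u hu
  rw [h0, map_zero]

lemma meanCurvature_eq_iff (h : IsGenerating l I c) {u : ℝ} (hu : u ∈ I) (v H : ℝ) :
    meanCurvature (helicoidalSurface l c) u v = H ↔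
      killing l (c u) ⬝ᵥ killing l (c u) * -(deriv c u ⬝ᵥ deriv (unitNormal l c) u) -
      2 * (deriv c u ⬝ᵥ killing l (c u)) * -(deriv c u ⬝ᵥ killing 0 (unitNormal l c u)) +
      deriv c u ⬝ᵥ deriv c u * -(killing l (c u) ⬝ᵥ killing 0 (unitNormal l c u)) =
      2 * H * (deriv c u ⬝ᵥ deriv c u * (killing l (c u) ⬝ᵥ killing l (c u)) -
        (deriv c u ⬝ᵥ killing l (c u)) ^ 2) := by
  have hp := dot_self_pos (h.cross_ne u hu)
  rw [cross_dot_cross, dotProduct_comm (killing l (c u)) (deriv c u), ← pow_two] at hp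
  rw [meanCurvature, h.fffE_eq hu, h.fffF_eq hu, fffG_eq, h.sffL_eq hu, h.sffM_eq hu,
    h.sffN_eq hu, div_eq_iff (by positivity)]
  constructor <;> intro h1 <;> rw [h1] <;> ring

end IsGenerating

/-- The velocity of a generating curve normal to the trajectories, divided by their speed. -/
noncomputable def normalSpeed (l : ℝ) (c : ℝ → E3) (u : ℝ) : ℝ :=
  √(crossProduct (deriv c u) (killing l (c u)) ⬝ᵥ crossProduct (deriv c u) (killing l (c u))) /
    (killing l (c u) ⬝ᵥ killing l (c u))

/-- The velocity of a generating curve along the trajectories, divided by their speed. -/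
noncomputable def tangentSpeed (l : ℝ) (c : ℝ → E3) (u : ℝ) : ℝ :=
  deriv c u ⬝ᵥ killing l (c u) / (killing l (c u) ⬝ᵥ killing l (c u))

section

variable {l : ℝ} {I : Set ℝ} {c : ℝ → E3}

lemma IsGenerating.normalSpeed_pos (h : IsGenerating l I c) {u : ℝ} (hu : u ∈ I) :
    0 < normalSpeed l c u :=
  div_pos (Real.sqrt_pos.2 (dot_self_pos (h.cross_ne u hu))) (h.killing_dot_self_pos hu)

lemma IsGenerating.cross_eq_smul (h : IsGenerating l I c) {u : ℝ} (hu : u ∈ I) :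
    crossProduct (deriv c u) (killing l (c u)) =
      (normalSpeed l c u * (killing l (c u) ⬝ᵥ killing l (c u))) • unitNormal l c u := by
  have hs := Real.sqrt_pos.2 (dot_self_pos (h.cross_ne u hu))
  rw [normalSpeed, div_mul_cancel₀ _ (h.killing_dot_self_pos hu).ne', unitNormal, smul_smul,
    mul_one_div_cancel hs.ne', one_smul]

lemma IsGenerating.unitNormal_dot_self (h : IsGenerating l I c) {u : ℝ} (hu : u ∈ I) :
    unitNormal l c u ⬝ᵥ unitNormal l c u = 1 := (h.exists_cross_eq hu).choose_spec.2.2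

lemma IsGenerating.deriv_eq (h : IsGenerating l I c) {u : ℝ} (hu : u ∈ I) :
    deriv c u = normalSpeed l c u • crossProduct (killing l (c u)) (unitNormal l c u) +
      tangentSpeed l c u • killing l (c u) :=
  velocity_frame (h.killing_dot_self_pos hu) rfl
    (div_mul_cancel₀ _ (h.killing_dot_self_pos hu).ne') (h.cross_eq_smul hu)

lemma IsCmcHelicoid.isGenerating {H : ℝ} (h : IsCmcHelicoid H l I c) : IsGenerating l I c :=
  isHelicoidalImmersion_iff.1 h.toIsHelicoidalImmersion

lemma IsCmcHelicoid.deriv_unitNormal (h : IsCmcHelicoid (-1 / 2) l I c) {u : ℝ} (hu : u ∈ I) :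
    deriv (unitNormal l c) u = normalSpeed l c u •
      ((1 - killing l (c u) ⬝ᵥ killing 0 (unitNormal l c u) /
        (killing l (c u) ⬝ᵥ killing l (c u))) •
        crossProduct (killing l (c u)) (unitNormal l c u) +
      (l / (killing l (c u) ⬝ᵥ killing l (c u))) • killing l (c u)) +
      tangentSpeed l c u • killing 0 (unitNormal l c u) := by
  have hg := h.isGenerating
  refine normal_frame (hg.unitNormal_dot_self hu) (IsGenerating.killing_dot_unitNormal l c u)
    (hg.killing_dot_self_pos hu) rfl rfl rfl
    (div_mul_cancel₀ _ (hg.killing_dot_self_pos hu).ne') (hg.cross_eq_smul hu)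
    (hg.unitNormal_dot_deriv hu) (hg.killing_dot_deriv hu) (hg.normalSpeed_pos hu).ne' ?_
  rw [(hg.meanCurvature_eq_iff hu 0 (-1 / 2)).1 (h.meanCurvature_eq u hu 0)]
  ring

lemma IsGenerating.contDiffOn_killing_dot_self (h : IsGenerating l I c) :
    ContDiffOn ℝ ∞ (fun u => killing l (c u) ⬝ᵥ killing l (c u)) I := by
  obtain ⟨c0, c1, c2⟩ := contDiffOn_E3.1 h.smooth
  simp only [dot_eq, killing_apply_zero, killing_apply_one, killing_apply_two]
  fun_prop

lemma IsGenerating.contDiffOn_tangentSpeed (h : IsGenerating l I c) :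
    ContDiffOn ℝ ∞ (tangentSpeed l c) I := by
  obtain ⟨c0, c1, c2⟩ := contDiffOn_E3.1 h.smooth
  obtain ⟨d0, d1, d2⟩ := contDiffOn_E3.1 h.contDiffOn_deriv
  refine ContDiffOn.div ?_ h.contDiffOn_killing_dot_self
    fun u hu => (h.killing_dot_self_pos hu).ne'
  simp only [dot_eq, killing_apply_zero, killing_apply_one, killing_apply_two]
  fun_prop

lemma IsGenerating.contDiffOn_normalSpeed (h : IsGenerating l I c) :
    ContDiffOn ℝ ∞ (normalSpeed l c) I := by
  obtain ⟨c0, c1, c2⟩ := contDiffOn_E3.1 h.smooth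
  obtain ⟨d0, d1, d2⟩ := contDiffOn_E3.1 h.contDiffOn_deriv
  refine ContDiffOn.div (ContDiffOn.sqrt ?_ fun u hu => (dot_self_pos (h.cross_ne u hu)).ne')
    h.contDiffOn_killing_dot_self fun u hu => (h.killing_dot_self_pos hu).ne'
  simp only [dot_eq, cross_apply_zero, cross_apply_one, cross_apply_two, killing_apply_zero,
    killing_apply_one, killing_apply_two]
  fun_prop

/-- The support function of the horizontal part. -/
noncomputable def axisSupport (l : ℝ) (c : ℝ → E3) (u : ℝ) : ℝ :=
  c u 0 * unitNormal l c u 0 + c u 1 * unitNormal l c u 1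

lemma killing_dot_killing_unitNormal (l : ℝ) (c : ℝ → E3) (u : ℝ) :
    killing l (c u) ⬝ᵥ killing 0 (unitNormal l c u) = axisSupport l c u := by
  simp only [dot_eq, killing_apply_zero, killing_apply_one, killing_apply_two, axisSupport]
  ring

/-- The length of the Killing field along the generating curve. -/
noncomputable def killingNorm (l : ℝ) (c : ℝ → E3) (u : ℝ) : ℝ :=
  √(killing l (c u) ⬝ᵥ killing l (c u))

lemma IsGenerating.killingNorm_pos (h : IsGenerating l I c) {u : ℝ} (hu : u ∈ I) :
    0 < killingNorm l c u := Real.sqrt_pos.2 (h.killing_dot_self_pos hu)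

lemma killingNorm_sq (l : ℝ) (c : ℝ → E3) (u : ℝ) :
    killingNorm l c u ^ 2 = killing l (c u) ⬝ᵥ killing l (c u) := by
  rw [killingNorm, Real.sq_sqrt]
  rw [dot_eq]
  nlinarith [sq_nonneg (killing l (c u) 0), sq_nonneg (killing l (c u) 1),
    sq_nonneg (killing l (c u) 2)]

lemma killingNorm_sq_eq (l : ℝ) (c : ℝ → E3) (u : ℝ) :
    killingNorm l c u ^ 2 = c u 0 ^ 2 + c u 1 ^ 2 + l ^ 2 := by
  rw [killingNorm_sq, dot_eq]
  simp only [killing_apply_zero, killing_apply_one, killing_apply_two]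
  ring

lemma killing_dot_unitNormal_eq (l : ℝ) (c : ℝ → E3) (u : ℝ) :
    c u 0 * unitNormal l c u 1 - c u 1 * unitNormal l c u 0 = -(l * unitNormal l c u 2) := by
  have := IsGenerating.killing_dot_unitNormal l c u
  rw [dot_eq] at this
  simp only [killing_apply_zero, killing_apply_one, killing_apply_two] at this
  linear_combination this

lemma IsGenerating.unitNormal_sq (h : IsGenerating l I c) {u : ℝ} (hu : u ∈ I) :
    unitNormal l c u 0 ^ 2 + unitNormal l c u 1 ^ 2 + unitNormal l c u 2 ^ 2 = 1 := by
  have := h.unitNormal_dot_self hu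
  rw [dot_eq] at this
  linear_combination this

/-- Lagrange's identity |ξ|²|ν|² = q² + (ln)², where the second term is the determinant given by k ·
m = 0, combined with |ν|² = 1 - n² and κ² = |ξ|² + l². -/
lemma IsGenerating.axisDist_sq_eq (h : IsGenerating l I c) {u : ℝ} (hu : u ∈ I) :
    c u 0 ^ 2 + c u 1 ^ 2 =
      (killingNorm l c u * unitNormal l c u 2) ^ 2 + axisSupport l c u ^ 2 := by
  have h1 := h.unitNormal_sq hu
  have h2 := killing_dot_unitNormal_eq l c u
  rw [mul_pow, killingNorm_sq_eq, axisSupport]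
  generalize unitNormal l c u = m at *
  linear_combination (-c u 0 ^ 2 - c u 1 ^ 2) * h1 +
    (c u 0 * m 1 - c u 1 * m 0 - l * m 2) * h2

section

variable (h : IsGenerating l I c) {u : ℝ} (hu : u ∈ I)
include h hu

lemma IsGenerating.deriv_components :
    (deriv c u 0 = normalSpeed l c u * (unitNormal l c u 2 * c u 0 - l * unitNormal l c u 1) -
      tangentSpeed l c u * c u 1) ∧
    (deriv c u 1 = normalSpeed l c u * (unitNormal l c u 2 * c u 1 + l * unitNormal l c u 0) +
      tangentSpeed l c u * c u 0) ∧
    (deriv c u 2 = -(normalSpeed l c u * axisSupport l c u) + l * tangentSpeed l c u) := by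
  rw [h.deriv_eq hu]
  simp only [Pi.add_apply, Pi.smul_apply, smul_eq_mul, cross_apply_zero, cross_apply_one,
    cross_apply_two, killing_apply_zero, killing_apply_one, killing_apply_two, axisSupport]
  refine ⟨?_, ?_, ?_⟩ <;> ring

lemma IsGenerating.hasDerivAt_killingNorm : HasDerivAt (killingNorm l c)
    (normalSpeed l c u * killingNorm l c u * unitNormal l c u 2) u := by
  obtain ⟨h0, h1, h2⟩ := hasDerivAt_E3.1 (h.hasDerivAt hu)
  obtain ⟨e0, e1, e2⟩ := h.deriv_components hu
  have hp := h.killing_dot_self_pos hu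
  have hk := hasDerivAt_killing l (h.hasDerivAt hu)
  have := (hasDerivAt_dot hk hk).sqrt hp.ne'
  refine this.congr_deriv ?_
  change _ / (2 * killingNorm l c u) = _
  have hκ := h.killingNorm_pos hu
  rw [div_eq_iff (by positivity)]
  simp only [dot_eq, killing_apply_zero, killing_apply_one, killing_apply_two]
  rw [e0, e1]
  have h2 := killing_dot_unitNormal_eq l c u
  have h3 := killingNorm_sq_eq l c u
  linear_combination 2 * normalSpeed l c u * (-unitNormal l c u 2 * h3 - l * h2)

end

/-! ### Structure equations under constant mean curvature, and the first integral -/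

section

variable (h : IsCmcHelicoid (-1 / 2) l I c) {u : ℝ} (hu : u ∈ I)
include h hu

lemma IsCmcHelicoid.deriv_unitNormal_components :
    (deriv (unitNormal l c) u 0 = normalSpeed l c u *
      ((1 - axisSupport l c u / killingNorm l c u ^ 2) *
        (unitNormal l c u 2 * c u 0 - l * unitNormal l c u 1) -
        l / killingNorm l c u ^ 2 * c u 1) - tangentSpeed l c u * unitNormal l c u 1) ∧
    (deriv (unitNormal l c) u 1 = normalSpeed l c u *
      ((1 - axisSupport l c u / killingNorm l c u ^ 2) *
        (unitNormal l c u 2 * c u 1 + l * unitNormal l c u 0) +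
        l / killingNorm l c u ^ 2 * c u 0) + tangentSpeed l c u * unitNormal l c u 0) ∧
    (deriv (unitNormal l c) u 2 = normalSpeed l c u *
      ((1 - axisSupport l c u / killingNorm l c u ^ 2) * -axisSupport l c u +
        l ^ 2 / killingNorm l c u ^ 2)) := by
  rw [h.deriv_unitNormal hu, killing_dot_killing_unitNormal, killingNorm_sq]
  simp only [Pi.add_apply, Pi.smul_apply, smul_eq_mul, cross_apply_zero, cross_apply_one,
    cross_apply_two, killing_apply_zero, killing_apply_one, killing_apply_two]
  refine ⟨?_, ?_, ?_⟩
  · ring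
  · ring
  · rw [axisSupport]; ring

lemma IsCmcHelicoid.hasDerivAt_axisSupport : HasDerivAt (axisSupport l c)
    (normalSpeed l c u * killingNorm l c u ^ 2 * unitNormal l c u 2) u := by
  have hg := h.isGenerating
  obtain ⟨c0, c1, c2⟩ := hasDerivAt_E3.1 (hg.hasDerivAt hu)
  obtain ⟨m0, m1, m2⟩ := hasDerivAt_E3.1 (hg.hasDerivAt_unitNormal hu)
  obtain ⟨e0, e1, e2⟩ := hg.deriv_components hu
  obtain ⟨f0, f1, f2⟩ := h.deriv_unitNormal_components hu
  have := (c0.mul m0).add (c1.mul m1)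
  refine this.congr_deriv ?_
  rw [e0, e1, f0, f1]
  have h2 := killing_dot_unitNormal_eq l c u
  have h3 := killingNorm_sq_eq l c u
  have hκ := hg.killingNorm_pos hu
  have hq : axisSupport l c u = c u 0 * unitNormal l c u 0 + c u 1 * unitNormal l c u 1 := rfl
  generalize unitNormal l c u = m at *
  generalize axisSupport l c u = q at *
  generalize killingNorm l c u = κ at *
  generalize normalSpeed l c u = r at *
  generalize tangentSpeed l c u = τ at *
  generalize c u = x at *
  have hl : l * (x 0 * m 1 - x 1 * m 0) = - l ^ 2 * m 2 := by rw [h2]; ring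
  have hw : x 0 ^ 2 + x 1 ^ 2 = κ ^ 2 - l ^ 2 := by rw [h3]; ring
  have key : r * (m 2 * (x 0 * m 0 + x 1 * m 1) +
      ((1 - q / κ ^ 2) * (m 2 * (x 0 ^ 2 + x 1 ^ 2) - l * (x 0 * m 1 - x 1 * m 0)))) =
      r * κ ^ 2 * m 2 := by
    rw [hl, hw, ← hq]
    field_simp
    ring
  linear_combination key

/-- Together with `IsCmcHelicoid.hasDerivAt_axisSupport` this is a rotation about (1, 0) with
angular speed κr, the source of the first integral R. -/
lemma IsCmcHelicoid.hasDerivAt_killingNorm_mul :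
    HasDerivAt (fun u => killingNorm l c u * unitNormal l c u 2)
      (normalSpeed l c u * killingNorm l c u * (1 - axisSupport l c u)) u := by
  have hg := h.isGenerating
  obtain ⟨m0, m1, m2⟩ := hasDerivAt_E3.1 (hg.hasDerivAt_unitNormal hu)
  obtain ⟨f0, f1, f2⟩ := h.deriv_unitNormal_components hu
  refine ((hg.hasDerivAt_killingNorm hu).mul m2).congr_deriv ?_
  rw [f2]
  have hκ := hg.killingNorm_pos hu
  have h3 := killingNorm_sq_eq l c u
  have h4 := hg.axisDist_sq_eq hu
  field_simp
  linear_combination normalSpeed l c u * (h3 + h4) * (-1)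

end

lemma IsCmcHelicoid.helicoidData (h : IsCmcHelicoid (-1 / 2) l I c) {R : ℝ} {θ : ℝ → ℝ}
    (hq : ∀ u ∈ I, axisSupport l c u = 1 + R * Real.cos (θ u))
    (hn : ∀ u ∈ I, killingNorm l c u * unitNormal l c u 2 = -(R * Real.sin (θ u)))
    (hθ : ∀ u ∈ I, HasDerivAt θ (killingNorm l c u * normalSpeed l c u) u)
    (hs : ContDiffOn ℝ ∞ θ I) :
    HelicoidData R l I (fun u => horizontal (c u)) (fun u => horizontal (unitNormal l c u))
      (fun u => c u 2) (fun u => unitNormal l c u 2) θ (normalSpeed l c) (tangentSpeed l c)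
      (killingNorm l c) where
  κ_pos u hu := h.isGenerating.killingNorm_pos hu
  κ_sq u hu := by
    rw [killingNorm_sq_eq, Complex.normSq_apply, horizontal_re, horizontal_im]; ring
  normSq_eq u hu := by
    have h1 := h.isGenerating.axisDist_sq_eq hu
    rw [hq u hu, hn u hu] at h1
    rw [Complex.normSq_apply, horizontal_re, horizontal_im]
    linear_combination h1 + R ^ 2 * Real.sin_sq_add_cos_sq (θ u)
  inner_eq u hu := by
    rw [← hq u hu, ← killing_dot_unitNormal_eq, axisSupport]
    apply Complex.ext <;> simp <;> ring
  n_eq := hn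
  unit u hu := by
    have := h.isGenerating.unitNormal_sq hu
    rw [Complex.normSq_apply, horizontal_re, horizontal_im]
    linear_combination this
  r_ne u hu := (h.isGenerating.normalSpeed_pos hu).ne'
  dξ u hu := by
    refine (hasDerivAt_horizontal (h.isGenerating.hasDerivAt hu)).congr_deriv ?_
    obtain ⟨e0, e1, e2⟩ := h.isGenerating.deriv_components hu
    apply Complex.ext
    · simp [e0]; ring
    · simp [e1]
  dν u hu := by
    refine (hasDerivAt_horizontal (h.isGenerating.hasDerivAt_unitNormal hu)).congr_deriv ?_
    obtain ⟨e0, e1, e2⟩ := h.deriv_unitNormal_components hu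
    rw [← hq u hu]
    have h1 : (1 - ((axisSupport l c u : ℝ) : ℂ) / (killingNorm l c u : ℂ) ^ 2) =
      ((1 - axisSupport l c u / killingNorm l c u ^ 2 : ℝ) : ℂ) := by push_cast; ring
    have h2 : (l : ℂ) / (killingNorm l c u : ℂ) ^ 2 = ((l / killingNorm l c u ^ 2 : ℝ) : ℂ) := by
      push_cast; ring
    rw [h1, h2]
    generalize 1 - axisSupport l c u / killingNorm l c u ^ 2 = A at *
    generalize l / killingNorm l c u ^ 2 = B at *
    apply Complex.ext
    · rw [horizontal_re, e0]; simp; ring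
    · rw [horizontal_im, e1]; simp
  dz u hu := by
    refine (hasDerivAt_E3.1 (h.isGenerating.hasDerivAt hu)).2.2.congr_deriv ?_
    rw [(h.isGenerating.deriv_components hu).2.2, hq u hu]
  dθ := hθ
  smooth_τ := h.isGenerating.contDiffOn_tangentSpeed
  smooth_θ := hs

lemma IsCmcHelicoid.exists_helicoidData (h : IsCmcHelicoid (-1 / 2) l I c) {u₀ : ℝ}
    (hu₀ : u₀ ∈ I) : ∃ (R : ℝ) (θ : ℝ → ℝ), 0 ≤ R ∧ θ u₀ ∈ Set.Ioc (-Real.pi) Real.pi ∧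
    HelicoidData R l I (fun u => horizontal (c u)) (fun u => horizontal (unitNormal l c u))
      (fun u => c u 2) (fun u => unitNormal l c u 2) θ (normalSpeed l c) (tangentSpeed l c)
      (killingNorm l c) := by
  have hg := h.isGenerating
  have hs : ContDiffOn ℝ ∞ (fun u => killingNorm l c u * normalSpeed l c u) I :=
    (hg.contDiffOn_killing_dot_self.sqrt fun u hu => (hg.killing_dot_self_pos hu).ne').mul
      hg.contDiffOn_normalSpeed
  obtain ⟨P, hP, hP0, hP'⟩ := exists_antideriv h.isOpen h.ordConnected hs hu₀
  -- The two scalar equations say w' = iκr w, so with P' = κr the product w exp(-iP) is constant.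
  -- Then R = |w(u₀)| and θ = P + arg w(u₀); as P(u₀) = 0, the initial phase lies in (-π, π].
  set w : ℝ → ℂ := fun u => ((axisSupport l c u - 1 : ℝ) : ℂ) -
    ((killingNorm l c u * unitNormal l c u 2 : ℝ) : ℂ) * Complex.I with hw
  have hre : ∀ u, (w u).re = axisSupport l c u - 1 := fun u => by simp [hw]
  have him : ∀ u, (w u).im = -(killingNorm l c u * unitNormal l c u 2) := fun u => by simp [hw]
  have hder : ∀ u ∈ I, HasDerivAt (fun u => w u * Complex.exp (-(P u * Complex.I))) 0 u := by
    intro u hu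
    have h1 := (((h.hasDerivAt_axisSupport hu).sub_const 1).ofReal_comp).sub
      ((h.hasDerivAt_killingNorm_mul hu).ofReal_comp.mul_const Complex.I)
    have h2 := ((((hP' u hu).ofReal_comp).mul_const Complex.I).neg).cexp
    refine (h1.mul h2).congr_deriv ?_
    simp only [Pi.neg_apply, Pi.sub_apply]
    push_cast
    linear_combination (-(normalSpeed l c u : ℂ) * killingNorm l c u ^ 2 * unitNormal l c u 2 *
      Complex.exp (-(P u * Complex.I))) * Complex.I_sq * (-1)
  have hconst : ∀ u ∈ I, w u = w u₀ * Complex.exp (P u * Complex.I) := by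
    intro u hu
    have h1 := eq_of_hasDerivAt_eq h.ordConnected hder hu hu₀
    simp only [hP0, Complex.ofReal_zero, zero_mul, neg_zero, Complex.exp_zero, mul_one] at h1
    rw [← h1, mul_assoc, ← Complex.exp_add]
    simp
  have hpolar : ∀ u ∈ I, w u = ‖w u₀‖ * Complex.exp (((P u + (w u₀).arg : ℝ) : ℂ) * Complex.I) := by
    intro u hu
    rw [hconst u hu]
    conv_lhs => rw [← Complex.norm_mul_exp_arg_mul_I (w u₀)]
    rw [mul_assoc, ← Complex.exp_add]
    push_cast
    ring_nf
  refine ⟨‖w u₀‖, fun u => P u + (w u₀).arg, norm_nonneg _, ?_, ?_⟩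
  · simp only [hP0, zero_add]
    exact Complex.arg_mem_Ioc _
  · refine h.helicoidData (fun u hu => ?_) (fun u hu => ?_) (fun u hu => ?_) ?_
    · have := congrArg Complex.re (hpolar u hu)
      rw [Complex.re_ofReal_mul, Complex.exp_ofReal_mul_I_re, hre] at this
      linarith
    · have := congrArg Complex.im (hpolar u hu)
      rw [Complex.im_ofReal_mul, Complex.exp_ofReal_mul_I_im, him] at this
      linarith
    · exact (hP' u hu).add_const _
    · exact hP.add contDiffOn_const

end

/-! ### The explicit helicoids of mean curvature `-1/2` -/

/-- The derivative of `helG`. -/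
noncomputable def helGDeriv (μ b u : ℝ) : ℝ :=
  if μ * b = 1 then 0 else helC μ b / b / (1 - μ ^ 2 * b ^ 2 * jacobiSn u μ ^ 2)

/-- The generating curve of the explicit helicoid of mean curvature `-1/2`. -/
noncomputable def helCurve (μ b u : ℝ) : E3 :=
  helicoidalMotion 0 (helG μ b u) (helN0 μ b u + helX0 μ b u)

/-- The Gauss map of the explicit helicoid along its generating curve. -/
noncomputable def helNormal (μ b u : ℝ) : E3 :=
  helicoidalMotion 0 (helG μ b u) (helN0 μ b u)

lemma cmcHelicoid_eq (μ b H u v : ℝ) : cmcHelicoid μ b H u v =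
    (-1 / (2 * H)) • helicoidalSurface (helC μ b) (helCurve μ b) u (v / b) := rfl

lemma helN0_one (μ b u : ℝ) : helN0 μ b u 1 = 0 := by
  unfold helN0; split_ifs <;> rfl

lemma helN0_two (μ b u : ℝ) : helN0 μ b u 2 = -(μ * b * jacobiSn u μ) := by
  unfold helN0
  split_ifs with h
  · simp [h]
  · rfl

lemma helX0_two (μ b u : ℝ) :
    helX0 μ b u 2 = (b - 1 / b) * u - b * ellipticE (jacobiAm u μ) μ := by
  unfold helX0; split_ifs <;> rfl

lemma mem_helicoidParams {μ b : ℝ} :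
    (μ, b) ∈ helicoidParams ↔ 0 ≤ μ ∧ 1 ≤ b ∧ μ * b ≤ 1 := Iff.rfl

lemma le_one_of_mem {μ b : ℝ} (h : (μ, b) ∈ helicoidParams) : μ ≤ 1 := by
  obtain ⟨h0, h1, h2⟩ := mem_helicoidParams.1 h
  nlinarith

lemma helC_sq {μ b : ℝ} (h : (μ, b) ∈ helicoidParams) :
    helC μ b ^ 2 = (1 - μ ^ 2 * b ^ 2) * (b ^ 2 - 1) := by
  obtain ⟨h0, h1, h2⟩ := mem_helicoidParams.1 h
  rw [helC, Real.sq_sqrt]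
  have h3 : 0 ≤ μ * b := by positivity
  apply mul_nonneg <;> nlinarith

lemma helC_eq_zero {μ b : ℝ} (h : μ * b = 1) : helC μ b = 0 := by
  rw [helC, ← mul_pow, h]; simp

/-! ### Algebraic relations and derivatives of the profile vectors -/

section

variable {μ b : ℝ} (h : (μ, b) ∈ helicoidParams) (u : ℝ)
include h

lemma helRho_sq_pos (hμb : μ * b ≠ 1) : 0 < 1 - μ ^ 2 * b ^ 2 * jacobiSn u μ ^ 2 := by
  obtain ⟨h0, h1, h2⟩ := mem_helicoidParams.1 h
  rw [← mul_pow]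
  exact one_sub_sq_mul_sin_sq_pos (by positivity) (lt_of_le_of_ne h2 hμb) _

lemma helN0_zero_sq : helN0 μ b u 0 ^ 2 = 1 - μ ^ 2 * b ^ 2 * jacobiSn u μ ^ 2 := by
  by_cases hμb : μ * b = 1
  · rw [← mul_pow, helN0, if_pos hμb, hμb]
    have := jacobiSn_sq_add_jacobiCn_sq u μ
    simp; linarith
  · rw [helN0, if_neg hμb]
    exact Real.sq_sqrt (helRho_sq_pos h u hμb).le

lemma helN0_zero_mul_helX0_zero :
    helN0 μ b u 0 * helX0 μ b u 0 = μ * b ^ 2 * jacobiCn u μ * jacobiDn u μ := by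
  by_cases hμb : μ * b = 1
  · rw [helN0, helX0, if_pos hμb, if_pos hμb]
    simp only [Matrix.cons_val_zero]
    linear_combination (-b * jacobiCn u μ * jacobiDn u μ) * hμb
  · rw [helN0, helX0, if_neg hμb, if_neg hμb]
    have := Real.sqrt_pos.2 (helRho_sq_pos h u hμb)
    simp only [Matrix.cons_val_zero]
    field_simp

lemma helN0_zero_mul_helX0_one :
    helN0 μ b u 0 * helX0 μ b u 1 = -(helC μ b * (μ * b * jacobiSn u μ)) := by
  by_cases hμb : μ * b = 1
  · rw [helN0, helX0, if_pos hμb, if_pos hμb, helC_eq_zero hμb]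
    simp
  · rw [helN0, helX0, if_neg hμb, if_neg hμb]
    have := Real.sqrt_pos.2 (helRho_sq_pos h u hμb)
    simp only [Matrix.cons_val_zero, Matrix.cons_val_one]
    field_simp

lemma helX0_sq : helX0 μ b u 0 ^ 2 + helX0 μ b u 1 ^ 2 =
    μ ^ 2 * b ^ 4 - μ ^ 2 * b ^ 2 * jacobiSn u μ ^ 2 := by
  obtain ⟨h0, h1, h2⟩ := mem_helicoidParams.1 h
  have hd := jacobiDn_sq h0 (le_one_of_mem h) u
  by_cases hμb : μ * b = 1
  · rw [helX0, if_pos hμb]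
    simp only [Matrix.cons_val_zero, Matrix.cons_val_one]
    rw [mul_pow, hd]
    linear_combination (-b ^ 2 * (μ * b + 1)) * hμb
  · have hρ := helRho_sq_pos h u hμb
    have e0 := helN0_zero_mul_helX0_zero h u
    have e1 := helN0_zero_mul_helX0_one h u
    have e2 := helN0_zero_sq h u
    have e3 := helC_sq h
    have e4 := jacobiSn_sq_add_jacobiCn_sq u μ
    rw [← e2] at hρ
    -- After multiplication by ρ² only the products of ρ with the components occur, and these
    -- contain no quotient.
    apply mul_left_cancel₀ hρ.ne'
    generalize helX0 μ b u 0 = a at *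
    generalize helX0 μ b u 1 = β at *
    generalize helN0 μ b u 0 = ρ at *
    generalize jacobiSn u μ = s at *
    generalize jacobiCn u μ = c at *
    generalize jacobiDn u μ = d at *
    generalize helC μ b = C at *
    have f0 : (ρ * a) ^ 2 = μ ^ 2 * b ^ 4 * c ^ 2 * d ^ 2 := by rw [e0]; ring
    have f1 : (ρ * β) ^ 2 = C ^ 2 * (μ ^ 2 * b ^ 2 * s ^ 2) := by rw [e1]; ring
    have f4 : c ^ 2 = 1 - s ^ 2 := by linarith
    rw [hd, f4] at f0
    rw [e3] at f1
    rw [e2]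
    have f5 : ρ ^ 2 * (a ^ 2 + β ^ 2) = (1 - μ ^ 2 * b ^ 2 * s ^ 2) * (a ^ 2 + β ^ 2) := by rw [e2]
    linear_combination f0 + f1 - f5

lemma helGDeriv_mul : helGDeriv μ b u * helN0 μ b u 0 ^ 2 = helC μ b / b := by
  by_cases hμb : μ * b = 1
  · rw [helGDeriv, if_pos hμb, helC_eq_zero hμb]; simp
  · rw [helN0_zero_sq h u, helGDeriv, if_neg hμb, div_mul_cancel₀ _ (helRho_sq_pos h u hμb).ne']

/-- The purpose of g: this is the second component, in the frame turned by g, of c' = (1/b) k × m,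
the equation that makes the curve orthogonal to the trajectories. -/
lemma helGDeriv_mul_helN0 : helGDeriv μ b u * helN0 μ b u 0 * b =
    helC μ b * helN0 μ b u 0 - helX0 μ b u 1 * (μ * b * jacobiSn u μ) := by
  obtain ⟨h0, h1, h2⟩ := mem_helicoidParams.1 h
  by_cases hμb : μ * b = 1
  · rw [helGDeriv, if_pos hμb, helC_eq_zero hμb, helX0, if_pos hμb]; simp
  · have hρ := helRho_sq_pos h u hμb
    have e1 := helN0_zero_mul_helX0_one h u
    have e2 := helN0_zero_sq h u
    have e3 := helGDeriv_mul h u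
    have hb : b ≠ 0 := by positivity
    rw [eq_div_iff hb] at e3
    rw [← e2] at hρ
    have hρ0 : helN0 μ b u 0 ≠ 0 := fun h0 => by simp [h0] at hρ
    apply mul_left_cancel₀ hρ0
    linear_combination e3 - helC μ b * e2 + μ * b * jacobiSn u μ * e1

lemma hasDerivAt_helG : HasDerivAt (helG μ b) (helGDeriv μ b u) u := by
  obtain ⟨h0, h1, h2⟩ := mem_helicoidParams.1 h
  by_cases hμb : μ * b = 1
  -- For μb = 1 the factor c₁ = 0 removes the integral, whatever value its singular integrand would
  -- give it.
  · have : helG μ b = fun _ => 0 := by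
      funext u; rw [helG, helC_eq_zero hμb]; simp
    rw [this, helGDeriv, if_pos hμb]
    exact hasDerivAt_const u 0
  · have hlt : μ * b < 1 := lt_of_le_of_ne h2 hμb
    have := (hasDerivAt_ellipticPi_jacobiAm (k := μ) (n := μ ^ 2 * b ^ 2) h0 (by nlinarith)
      (by rw [← mul_pow]; exact pow_lt_one₀ (by positivity) hlt two_ne_zero) u).const_mul
        (helC μ b / b)
    refine this.congr_deriv ?_
    rw [helGDeriv, if_neg hμb]
    ring

lemma hasDerivAt_helN0_zero : HasDerivAt (fun u => helN0 μ b u 0)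
    (-(μ * jacobiSn u μ * helX0 μ b u 0)) u := by
  obtain ⟨h0, h1, h2⟩ := mem_helicoidParams.1 h
  have hμ := le_one_of_mem h
  by_cases hμb : μ * b = 1
  · have : (fun u => helN0 μ b u 0) = fun u => jacobiCn u μ := by
      funext u; rw [helN0, if_pos hμb]; rfl
    rw [this]
    refine (hasDerivAt_jacobiCn h0 hμ u).congr_deriv ?_
    rw [helX0, if_pos hμb]
    simp only [Matrix.cons_val_zero]
    linear_combination (jacobiSn u μ * jacobiDn u μ) * hμb
  · have : (fun u => helN0 μ b u 0) = fun u => √(1 - μ ^ 2 * b ^ 2 * jacobiSn u μ ^ 2) := by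
      funext u; rw [helN0, if_neg hμb]; rfl
    rw [this]
    have hρ := helRho_sq_pos h u hμb
    have := ((((hasDerivAt_jacobiSn h0 hμ u).fun_pow 2).const_mul (μ ^ 2 * b ^ 2)).const_sub
      1).sqrt hρ.ne'
    refine this.congr_deriv ?_
    rw [helX0, if_neg hμb]
    simp only [Matrix.cons_val_zero]
    have := Real.sqrt_pos.2 hρ
    field_simp
    norm_num
    ring

lemma hasDerivAt_helX0_one : HasDerivAt (fun u => helX0 μ b u 1)
    (-(helGDeriv μ b u * helX0 μ b u 0)) u := by
  obtain ⟨h0, h1, h2⟩ := mem_helicoidParams.1 h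
  have hμ := le_one_of_mem h
  by_cases hμb : μ * b = 1
  · have : (fun u => helX0 μ b u 1) = fun _ => 0 := by
      funext u; rw [helX0, if_pos hμb]; rfl
    rw [this, helGDeriv, if_pos hμb]
    simpa using hasDerivAt_const u (0 : ℝ)
  · have : (fun u => helX0 μ b u 1) =
        fun u => -(μ * b * (helC μ b * jacobiSn u μ)) / helN0 μ b u 0 := by
      funext u; rw [helX0, helN0, if_neg hμb, if_neg hμb]; rfl
    rw [this]
    have hρ := helRho_sq_pos h u hμb
    have e2 := helN0_zero_sq h u
    rw [← e2] at hρ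
    have hρ0 : helN0 μ b u 0 ≠ 0 := fun h0 => by simp [h0] at hρ
    refine ((((hasDerivAt_jacobiSn h0 hμ u).const_mul (helC μ b)).const_mul (μ * b)).neg.div
      (hasDerivAt_helN0_zero h u) hρ0).congr_deriv ?_
    have e0 := helN0_zero_mul_helX0_zero h u
    have e3 := helGDeriv_mul h u
    have hb : b ≠ 0 := by positivity
    rw [eq_div_iff hb] at e3
    simp only [Pi.neg_apply]
    have e5 : helX0 μ b u 0 = μ * b ^ 2 * jacobiCn u μ * jacobiDn u μ / helN0 μ b u 0 := by
      rw [eq_div_iff hρ0]; linarith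
    have e6 : helGDeriv μ b u = helC μ b / b / helN0 μ b u 0 ^ 2 := by
      rw [eq_div_iff hρ.ne', eq_div_iff hb, e3]
    rw [e5, e6]
    field_simp
    linear_combination (-μ * helC μ b * jacobiCn u μ * jacobiDn u μ) * e2

lemma hasDerivAt_helX0_zero : HasDerivAt (fun u => helX0 μ b u 0)
    (helGDeriv μ b u * helX0 μ b u 1 - μ * helN0 μ b u 0 * jacobiSn u μ) u := by
  obtain ⟨h0, h1, h2⟩ := mem_helicoidParams.1 h
  have hμ := le_one_of_mem h
  by_cases hμb : μ * b = 1
  · have : (fun u => helX0 μ b u 0) = fun u => b * jacobiDn u μ := by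
      funext u; rw [helX0, if_pos hμb]; rfl
    rw [this]
    refine ((hasDerivAt_jacobiDn h0 hμ u).const_mul b).congr_deriv ?_
    rw [helGDeriv, if_pos hμb, helN0, if_pos hμb]
    simp only [Matrix.cons_val_zero]
    linear_combination (-μ * jacobiSn u μ * jacobiCn u μ) * hμb
  · have : (fun u => helX0 μ b u 0) =
        fun u => μ * b * (b * jacobiCn u μ * jacobiDn u μ) / helN0 μ b u 0 := by
      funext u; rw [helX0, helN0, if_neg hμb, if_neg hμb]; rfl
    rw [this]
    have hρ := helRho_sq_pos h u hμb
    have e2 := helN0_zero_sq h u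
    rw [← e2] at hρ
    have hρ0 : helN0 μ b u 0 ≠ 0 := fun h0 => by simp [h0] at hρ
    have hcd := (((hasDerivAt_jacobiCn h0 hμ u).const_mul b).mul
      (hasDerivAt_jacobiDn h0 hμ u)).const_mul (μ * b)
    refine (hcd.div (hasDerivAt_helN0_zero h u) hρ0).congr_deriv ?_
    have e0 := helN0_zero_mul_helX0_zero h u
    have e1 := helN0_zero_mul_helX0_one h u
    have e3 := helGDeriv_mul h u
    have hb : b ≠ 0 := by positivity
    rw [eq_div_iff hb] at e3
    have e5 : helX0 μ b u 0 = μ * b ^ 2 * jacobiCn u μ * jacobiDn u μ / helN0 μ b u 0 := by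
      rw [eq_div_iff hρ0]; linarith
    have e6 : helGDeriv μ b u = helC μ b / b / helN0 μ b u 0 ^ 2 := by
      rw [eq_div_iff hρ.ne', eq_div_iff hb, e3]
    have e7 : helX0 μ b u 1 = -(helC μ b * (μ * b * jacobiSn u μ)) / helN0 μ b u 0 := by
      rw [eq_div_iff hρ0]; linarith
    have e8 := helC_sq h
    have e9 := jacobiDn_sq h0 hμ u
    have e10 := jacobiSn_sq_add_jacobiCn_sq u μ
    rw [e5, e6, e7]
    simp only [Pi.mul_apply]
    generalize helN0 μ b u 0 = ρ at *
    generalize jacobiSn u μ = s at *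
    generalize jacobiCn u μ = c at *
    generalize jacobiDn u μ = d at *
    generalize helC μ b = C at *
    have f4 : c ^ 2 = 1 - s ^ 2 := by linarith
    have g4 : ρ ^ 4 = (1 - μ ^ 2 * b ^ 2 * s ^ 2) ^ 2 := by rw [← e2]; ring
    field_simp
    ring_nf
    simp only [e9, f4, e8, e2, g4]
    ring

end

section

variable {μ b : ℝ} (h : (μ, b) ∈ helicoidParams)
include h

lemma contDiff_helN0_zero : ContDiff ℝ ∞ (fun u => helN0 μ b u 0) := by
  obtain ⟨h0, h1, h2⟩ := mem_helicoidParams.1 h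
  have hμ := le_one_of_mem h
  have hs := contDiff_jacobiSn h0 hμ
  by_cases hμb : μ * b = 1
  · simp only [helN0, if_pos hμb]
    exact contDiff_jacobiCn h0 hμ
  · simp only [helN0, if_neg hμb]
    refine ContDiff.sqrt ?_ fun x => (helRho_sq_pos h x hμb).ne'
    fun_prop

lemma helN0_zero_ne (hμb : μ * b ≠ 1) (u : ℝ) : helN0 μ b u 0 ≠ 0 := by
  have hρ := helRho_sq_pos h u hμb
  rw [← helN0_zero_sq h u] at hρ
  exact fun h0 => by simp [h0] at hρ

lemma contDiff_helX0_zero : ContDiff ℝ ∞ (fun u => helX0 μ b u 0) := by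
  obtain ⟨h0, h1, h2⟩ := mem_helicoidParams.1 h
  have hμ := le_one_of_mem h
  have hc := contDiff_jacobiCn h0 hμ
  have hd := contDiff_jacobiDn h0 hμ
  by_cases hμb : μ * b = 1
  · simp only [helX0, if_pos hμb, Matrix.cons_val_zero]
    fun_prop
  · have : (fun u => helX0 μ b u 0) =
        fun u => μ * b * (b * jacobiCn u μ * jacobiDn u μ) / helN0 μ b u 0 := by
      funext u; rw [helX0, helN0, if_neg hμb, if_neg hμb]; rfl
    rw [this]
    exact ContDiff.div (by fun_prop) (contDiff_helN0_zero h) (helN0_zero_ne h hμb)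

lemma contDiff_helX0_one : ContDiff ℝ ∞ (fun u => helX0 μ b u 1) := by
  obtain ⟨h0, h1, h2⟩ := mem_helicoidParams.1 h
  have hμ := le_one_of_mem h
  have hs := contDiff_jacobiSn h0 hμ
  by_cases hμb : μ * b = 1
  · simp only [helX0, if_pos hμb, Matrix.cons_val_one, Matrix.cons_val_zero]
    fun_prop
  · have : (fun u => helX0 μ b u 1) =
        fun u => -(μ * b * (helC μ b * jacobiSn u μ)) / helN0 μ b u 0 := by
      funext u; rw [helX0, helN0, if_neg hμb, if_neg hμb]; rfl
    rw [this]
    exact ContDiff.div (by fun_prop) (contDiff_helN0_zero h) (helN0_zero_ne h hμb)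

lemma contDiff_helG : ContDiff ℝ ∞ (helG μ b) := by
  obtain ⟨h0, h1, h2⟩ := mem_helicoidParams.1 h
  have hs := contDiff_jacobiSn h0 (le_one_of_mem h)
  refine contDiff_of_hasDerivAt (hasDerivAt_helG h) ?_
  by_cases hμb : μ * b = 1
  · have : helGDeriv μ b = fun _ => 0 := by funext u; rw [helGDeriv, if_pos hμb]
    rw [this]
    exact contDiff_const
  · have : helGDeriv μ b = fun u => helC μ b / b / (1 - μ ^ 2 * b ^ 2 * jacobiSn u μ ^ 2) := by
      funext u; rw [helGDeriv, if_neg hμb]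
    rw [this]
    exact ContDiff.div contDiff_const (by fun_prop) fun u => (helRho_sq_pos h u hμb).ne'

lemma contDiff_helCurve : ContDiff ℝ ∞ (helCurve μ b) := by
  obtain ⟨h0, h1, h2⟩ := mem_helicoidParams.1 h
  have hs := contDiff_jacobiSn h0 (le_one_of_mem h)
  have hE := contDiff_ellipticE_jacobiAm h0 (le_one_of_mem h)
  have hg := contDiff_helG h
  have hρ := contDiff_helN0_zero h
  have h0 := contDiff_helX0_zero h
  have h1 := contDiff_helX0_one h
  rw [← contDiffOn_univ, contDiffOn_E3]
  simp only [contDiffOn_univ, helCurve, helicoidalMotion_apply_zero, helicoidalMotion_apply_one,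
    helicoidalMotion_apply_two, Pi.add_apply, helN0_one, helN0_two, helX0_two]
  refine ⟨?_, ?_, ?_⟩
  · exact (hg.cos.mul (hρ.add h0)).sub (hg.sin.mul (contDiff_const.add h1))
  · exact (hg.sin.mul (hρ.add h0)).add (hg.cos.mul (contDiff_const.add h1))
  · fun_prop

lemma helNormal_dot_self (u : ℝ) : helNormal μ b u ⬝ᵥ helNormal μ b u = 1 := by
  rw [helNormal, helicoidalMotion_dot, dot_eq, helN0_one, helN0_two]
  linear_combination helN0_zero_sq h u

end

lemma killing_helicoidalMotion (l v : ℝ) (q : E3) :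
    killing l (helicoidalMotion 0 v q) = helicoidalMotion 0 v (killing l q) := by
  apply E3.ext <;> simp <;> ring

lemma hasDerivAt_helicoidalMotion_zero_comp {c : ℝ → E3} {c' : E3} {f : ℝ → ℝ} {f' u : ℝ}
    (hc : HasDerivAt c c' u) (hf : HasDerivAt f f' u) :
    HasDerivAt (fun s => helicoidalMotion 0 (f s) (c s))
      (helicoidalMotion 0 (f u) (c' + f' • killing 0 (c u))) u := by
  obtain ⟨h0, h1, h2⟩ := hasDerivAt_E3.1 hc
  refine hasDerivAt_E3.2 ⟨?_, ?_, ?_⟩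
  · refine ((hf.cos.mul h0).sub (hf.sin.mul h1)).congr_deriv ?_
    simp; ring
  · refine ((hf.sin.mul h0).add (hf.cos.mul h1)).congr_deriv ?_
    simp; ring
  · simpa using h2

/-! ### The explicit curve solves the structure equations -/

section

variable {μ b : ℝ} (h : (μ, b) ∈ helicoidParams) (u : ℝ)
include h

lemma killing_dot_helNormal : killing (helC μ b) (helCurve μ b u) ⬝ᵥ helNormal μ b u = 0 := by
  rw [helNormal, helCurve, killing_helicoidalMotion, helicoidalMotion_dot, dot_eq]
  simp only [killing_apply_zero, killing_apply_one, killing_apply_two, Pi.add_apply, helN0_one,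
    helN0_two]
  linear_combination -helN0_zero_mul_helX0_one h u

lemma hasDerivAt_helNormal : HasDerivAt (helNormal μ b) (helicoidalMotion 0 (helG μ b u)
    ![-(μ * jacobiSn u μ * helX0 μ b u 0), helGDeriv μ b u * helN0 μ b u 0,
      -(μ * b * (jacobiCn u μ * jacobiDn u μ))]) u := by
  obtain ⟨h0, h1, h2⟩ := mem_helicoidParams.1 h
  have hN : HasDerivAt (helN0 μ b)
      ![-(μ * jacobiSn u μ * helX0 μ b u 0), 0, -(μ * b * (jacobiCn u μ * jacobiDn u μ))] u := by
    refine hasDerivAt_E3.2 ⟨hasDerivAt_helN0_zero h u, ?_, ?_⟩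
    · simp only [helN0_one]
      exact hasDerivAt_const u 0
    · simp only [helN0_two]
      exact ((hasDerivAt_jacobiSn h0 (le_one_of_mem h) u).const_mul (μ * b)).neg
  refine (hasDerivAt_helicoidalMotion_zero_comp hN (hasDerivAt_helG h u)).congr_deriv ?_
  congr 1
  apply E3.ext <;> simp [helN0_one]

/-- This gives r = 1/b and τ = 0: the parameter lines u and v of the explicit surface are
orthogonal. -/
lemma hasDerivAt_helCurve : HasDerivAt (helCurve μ b) ((1 / b) •
    crossProduct (killing (helC μ b) (helCurve μ b u)) (helNormal μ b u)) u := by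
  obtain ⟨h0, h1, h2⟩ := mem_helicoidParams.1 h
  have hb : b ≠ 0 := by positivity
  have hN : HasDerivAt (fun u => helN0 μ b u + helX0 μ b u)
      ![-(μ * jacobiSn u μ * helX0 μ b u 0) +
          (helGDeriv μ b u * helX0 μ b u 1 - μ * helN0 μ b u 0 * jacobiSn u μ),
        -(helGDeriv μ b u * helX0 μ b u 0),
        -(μ * b * (jacobiCn u μ * jacobiDn u μ)) + (b - 1 / b - b * jacobiDn u μ ^ 2)] u := by
    refine hasDerivAt_E3.2 ⟨?_, ?_, ?_⟩
    · exact (hasDerivAt_helN0_zero h u).add (hasDerivAt_helX0_zero h u)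
    · simp only [Pi.add_apply, helN0_one, zero_add]
      exact hasDerivAt_helX0_one h u
    · simp only [Pi.add_apply, helN0_two, helX0_two]
      refine (((hasDerivAt_jacobiSn h0 (le_one_of_mem h) u).const_mul (μ * b)).neg.add
        (((hasDerivAt_id' u).const_mul (b - 1 / b)).sub
        ((hasDerivAt_ellipticE_jacobiAm h0 (le_one_of_mem h) u).const_mul b))).congr_deriv ?_
      simp
  refine (hasDerivAt_helicoidalMotion_zero_comp hN (hasDerivAt_helG h u)).congr_deriv ?_
  rw [helNormal, helCurve, killing_helicoidalMotion, helicoidalMotion_cross,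
    ← helicoidalMotion_smul]
  congr 1
  have e1 := helGDeriv_mul_helN0 h u
  have e2 := helN0_zero_sq h u
  have e3 := jacobiDn_sq h0 (le_one_of_mem h) u
  have e4 := helN0_zero_mul_helX0_zero h u
  apply E3.ext
  · simp [cross_apply_zero, helN0_one, helN0_two]
    field_simp
    ring
  · simp [cross_apply_one, helN0_one, helN0_two]
    field_simp
    linear_combination e1
  · simp [cross_apply_two, helN0_one]
    field_simp
    linear_combination e2 + e4 - b ^ 2 * e3

/-- A perfect square: ρ², |x̌₀|² and c₁² add up to b²(dn² + μ²cn²), and the mixed term is 2μb² cn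
dn. The root is b times the derivative of `landenAm`, which matches θ' = κr with r = 1/b. -/
lemma killing_dot_self_helCurve :
    killing (helC μ b) (helCurve μ b u) ⬝ᵥ killing (helC μ b) (helCurve μ b u) =
      (b * (jacobiDn u μ + μ * jacobiCn u μ)) ^ 2 := by
  obtain ⟨h0, h1, h2⟩ := mem_helicoidParams.1 h
  rw [helCurve, killing_helicoidalMotion, helicoidalMotion_dot, dot_eq]
  simp only [killing_apply_zero, killing_apply_one, killing_apply_two, Pi.add_apply, helN0_one]
  linear_combination helN0_zero_sq h u + 2 * helN0_zero_mul_helX0_zero h u + helX0_sq h u +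
    helC_sq h - b ^ 2 * jacobiDn_sq h0 (le_one_of_mem h) u -
    μ ^ 2 * b ^ 2 * jacobiSn_sq_add_jacobiCn_sq u μ

lemma cross_deriv_helCurve :
    crossProduct (deriv (helCurve μ b) u) (killing (helC μ b) (helCurve μ b u)) =
      (1 / b * (b * (jacobiDn u μ + μ * jacobiCn u μ)) ^ 2) • helNormal μ b u := by
  have e := killing_dot_helNormal h u
  rw [(hasDerivAt_helCurve h u).deriv, ← killing_dot_self_helCurve h u]
  generalize killing (helC μ b) (helCurve μ b u) = k at *
  generalize helNormal μ b u = m at *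
  rw [dot_eq] at e
  apply E3.ext <;> simp [cross_apply, dot_eq]
  · linear_combination (1 / b * k 0) * -e
  · linear_combination (1 / b * k 1) * -e
  · linear_combination (1 / b * k 2) * -e

lemma helCurve_weight_pos : 0 < 1 / b * (b * (jacobiDn u μ + μ * jacobiCn u μ)) ^ 2 := by
  obtain ⟨h0, h1, h2⟩ := mem_helicoidParams.1 h
  have := jacobiDn_add_pos h0 (le_one_of_mem h) u
  positivity

omit u in
lemma helCurve_isGenerating : IsGenerating (helC μ b) Set.univ (helCurve μ b) where
  isOpen := isOpen_univ
  ordConnected := Set.ordConnected_univ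
  smooth := (contDiff_helCurve h).contDiffOn
  cross_ne u _ := by
    rw [cross_deriv_helCurve h u]
    refine smul_ne_zero (helCurve_weight_pos h u).ne' fun h0 => ?_
    have := helNormal_dot_self h u
    simp [h0] at this

lemma sqrt_helCurve_cross :
    √(crossProduct (deriv (helCurve μ b) u) (killing (helC μ b) (helCurve μ b u)) ⬝ᵥ
      crossProduct (deriv (helCurve μ b) u) (killing (helC μ b) (helCurve μ b u))) =
    1 / b * (b * (jacobiDn u μ + μ * jacobiCn u μ)) ^ 2 := by
  rw [cross_deriv_helCurve h u, smul_dotProduct, dotProduct_smul, helNormal_dot_self h u,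
    smul_eq_mul, smul_eq_mul, mul_one, Real.sqrt_mul_self (helCurve_weight_pos h u).le]

lemma unitNormal_helCurve : unitNormal (helC μ b) (helCurve μ b) u = helNormal μ b u := by
  rw [unitNormal, sqrt_helCurve_cross h u, cross_deriv_helCurve h u, smul_smul,
    one_div_mul_cancel (helCurve_weight_pos h u).ne', one_smul]

lemma normalSpeed_helCurve : normalSpeed (helC μ b) (helCurve μ b) u = 1 / b := by
  obtain ⟨h0, h1, h2⟩ := mem_helicoidParams.1 h
  have := jacobiDn_add_pos h0 (le_one_of_mem h) u
  rw [normalSpeed, sqrt_helCurve_cross h u, killing_dot_self_helCurve h u]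
  field_simp

lemma tangentSpeed_helCurve : tangentSpeed (helC μ b) (helCurve μ b) u = 0 := by
  rw [tangentSpeed, (hasDerivAt_helCurve h u).deriv, smul_dotProduct, dotProduct_comm,
    dot_self_cross, smul_zero, zero_div]

/-- This identifies the first integral R = μb² and the phase of the explicit curve. -/
lemma axisSupport_helCurve : axisSupport (helC μ b) (helCurve μ b) u =
    1 + μ * b ^ 2 * Real.cos (landenAm u μ) := by
  obtain ⟨h0, h1, h2⟩ := mem_helicoidParams.1 h
  rw [axisSupport, unitNormal_helCurve h, cos_landenAm h0 (le_one_of_mem h), helNormal, helCurve]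
  simp only [helicoidalMotion_apply_zero, helicoidalMotion_apply_one, Pi.add_apply, helN0_one]
  linear_combination helN0_zero_mul_helX0_zero h u + helN0_zero_sq h u +
    (helN0 μ b u 0 * (helN0 μ b u 0 + helX0 μ b u 0)) * Real.sin_sq_add_cos_sq (helG μ b u)

lemma killingNorm_helCurve : killingNorm (helC μ b) (helCurve μ b) u =
    b * (jacobiDn u μ + μ * jacobiCn u μ) := by
  obtain ⟨h0, h1, h2⟩ := mem_helicoidParams.1 h
  have := jacobiDn_add_pos h0 (le_one_of_mem h) u
  rw [killingNorm, killing_dot_self_helCurve h, Real.sqrt_sq (by positivity)]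

omit u in
lemma isCmcHelicoid_helCurve : IsCmcHelicoid (-1 / 2) (helC μ b) Set.univ (helCurve μ b) where
  toIsHelicoidalImmersion := isHelicoidalImmersion_iff.2 (helCurve_isGenerating h)
  ne_zero := by norm_num
  meanCurvature_eq u hu v := by
    obtain ⟨h0, h1, h2⟩ := mem_helicoidParams.1 h
    rw [(helCurve_isGenerating h).meanCurvature_eq_iff hu]
    have hnor : unitNormal (helC μ b) (helCurve μ b) = helNormal μ b :=
      funext fun u => unitNormal_helCurve h u
    have hF : deriv (helCurve μ b) u ⬝ᵥ killing (helC μ b) (helCurve μ b u) = 0 := by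
      rw [(hasDerivAt_helCurve h u).deriv, smul_dotProduct, dotProduct_comm, dot_self_cross,
        smul_zero]
    have hG := killing_dot_self_helCurve h u
    have hE : deriv (helCurve μ b) u ⬝ᵥ deriv (helCurve μ b) u = (1 / b) ^ 2 *
        (killing (helC μ b) (helCurve μ b u) ⬝ᵥ killing (helC μ b) (helCurve μ b u)) := by
      rw [(hasDerivAt_helCurve h u).deriv, smul_dotProduct, dotProduct_smul, cross_dot_cross,
        helNormal_dot_self h u, killing_dot_helNormal h u, smul_eq_mul, smul_eq_mul]
      ring
    -- With F = 0 and E = G/b², the claim 2H = -1 reads GL + EN = -EG. Since N = -q, this amounts to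
    -- L = -(G - q)/b².
    have hL : deriv (helCurve μ b) u ⬝ᵥ deriv (helNormal μ b) u = (1 / b) ^ 2 *
        (killing (helC μ b) (helCurve μ b u) ⬝ᵥ killing (helC μ b) (helCurve μ b u) -
          axisSupport (helC μ b) (helCurve μ b) u) := by
      rw [(hasDerivAt_helNormal h u).deriv, (hasDerivAt_helCurve h u).deriv,
        killing_dot_self_helCurve h, axisSupport_helCurve h, helNormal, helCurve,
        killing_helicoidalMotion, helicoidalMotion_cross, smul_dotProduct, helicoidalMotion_dot,
        dot_eq]
      simp only [cross_apply_zero, cross_apply_one, cross_apply_two, killing_apply_zero,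
        killing_apply_one, killing_apply_two, Pi.add_apply, helN0_one, helN0_two,
        Matrix.cons_val_zero, Matrix.cons_val_one, Matrix.cons_val, smul_eq_mul]
      rw [cos_landenAm h0 (le_one_of_mem h)]
      have e1 := helGDeriv_mul_helN0 h u
      have e2 := helN0_zero_sq h u
      have e3 := jacobiDn_sq h0 (le_one_of_mem h) u
      have e4 := helN0_zero_mul_helX0_zero h u
      have e5 := helN0_zero_mul_helX0_one h u
      have e6 := helX0_sq h u
      have e7 := helC_sq h
      have e8 := jacobiSn_sq_add_jacobiCn_sq u μ
      have hb : b ≠ 0 := by positivity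
      generalize helN0 μ b u 0 = ρ at *
      generalize helX0 μ b u 0 = a at *
      generalize helX0 μ b u 1 = β at *
      generalize jacobiSn u μ = s at *
      generalize jacobiCn u μ = c at *
      generalize jacobiDn u μ = d at *
      generalize helC μ b = C at *
      generalize helGDeriv μ b u = G at *
      have e9 : (μ * b ^ 2 * c * d) ^ 2 = (1 - (μ * b * s) ^ 2) * (μ ^ 2 * b ^ 4 - (μ * b * s) ^ 2)
          - C ^ 2 * (μ * b * s) ^ 2 := by
        linear_combination -(ρ * a + μ * b ^ 2 * c * d) * e4 + ρ ^ 2 * e6 +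
          (μ ^ 2 * b ^ 4 - (μ * b * s) ^ 2) * e2 - (ρ * β - C * (μ * b * s)) * e5
      field_simp
      linear_combination (C * ρ - β * (μ * b * s)) * e1 + (μ * b * s) ^ 2 * e6 +
        (μ * b * s) ^ 2 * e4 + C ^ 2 * e2 - 2 * C * (μ * b * s) * e5 + (μ * b ^ 2 * c * d) * e2 +
        (μ * b ^ 2 * c * d) * e4 + e9 - b ^ 2 * e3 - b ^ 2 * μ ^ 2 * e8 + e7
    rw [killing_dot_killing_unitNormal, hnor, hF, hE, hL]
    ring

omit u in
lemma helicoidData_helCurve : HelicoidData (μ * b ^ 2) (helC μ b) Set.univ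
    (fun u => horizontal (helCurve μ b u)) (fun u => horizontal (helNormal μ b u))
    (fun u => helCurve μ b u 2) (fun u => helNormal μ b u 2) (fun u => landenAm u μ)
    (fun _ => 1 / b) (fun _ => 0) (fun u => b * (jacobiDn u μ + μ * jacobiCn u μ)) := by
  obtain ⟨h0, h1, h2⟩ := mem_helicoidParams.1 h
  have := (isCmcHelicoid_helCurve h).helicoidData (R := μ * b ^ 2) (θ := fun u => landenAm u μ)
    (fun u _ => axisSupport_helCurve h u) (fun u _ => ?_) (fun u _ => ?_)
    (contDiff_landenAm h0 (le_one_of_mem h)).contDiffOn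
  · rwa [funext (unitNormal_helCurve h), funext (normalSpeed_helCurve h),
      funext (tangentSpeed_helCurve h), funext (killingNorm_helCurve h)] at this
  · rw [killingNorm_helCurve h, unitNormal_helCurve h, sin_landenAm h0 (le_one_of_mem h),
      helNormal, helicoidalMotion_apply_two, helN0_two]
    ring
  · rw [killingNorm_helCurve h, normalSpeed_helCurve h]
    have hb : b ≠ 0 := by positivity
    refine (hasDerivAt_landenAm h0 (le_one_of_mem h) u).congr_deriv ?_
    field_simp

end

/-! ### Classification of the helicoidal surfaces of mean curvature `-1/2` -/

/-- Inserting μ = R/b² into c₁² = l² gives, for B = b², the quadratic B² - (R² + 1 + l²)B + R² = 0.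
Its left side is -l² at B = 1 and -R²l² at B = R², so the larger root is at least 1 and at least R²;
these are the conditions b ≥ 1 and μb ≤ 1. -/
lemma exists_helicoidParams {R : ℝ} (hR : 0 ≤ R) (l : ℝ) :
    ∃ μ b : ℝ, (μ, b) ∈ helicoidParams ∧ μ * b ^ 2 = R ∧ helC μ b = |l| := by
  set S := R ^ 2 + 1 + l ^ 2 with hS
  have hD1 : (2 - S) ^ 2 ≤ S ^ 2 - 4 * R ^ 2 := by rw [hS]; nlinarith [sq_nonneg l]
  have hD2 : (2 * R ^ 2 - S) ^ 2 ≤ S ^ 2 - 4 * R ^ 2 := by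
    rw [hS]; nlinarith [mul_nonneg (sq_nonneg R) (sq_nonneg l)]
  have hsq := Real.sq_sqrt ((sq_nonneg _).trans hD1)
  have h1 := (le_abs_self _).trans (Real.abs_le_sqrt hD1)
  have h2 := (le_abs_self _).trans (Real.abs_le_sqrt hD2)
  set B := (S + √(S ^ 2 - 4 * R ^ 2)) / 2 with hB
  have hB1 : 1 ≤ B := by linarith
  have hB2 : R ^ 2 ≤ B := by linarith
  have hroot : B ^ 2 - S * B + R ^ 2 = 0 := by rw [hB]; linear_combination hsq / 4
  have hb1 : 1 ≤ √B := Real.one_le_sqrt.2 hB1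
  have hbB : √B ^ 2 = B := Real.sq_sqrt (by linarith)
  have hb0 : 0 < √B := by linarith
  have hB0 : 0 < B := by linarith
  refine ⟨R / B, √B, mem_helicoidParams.2 ⟨by positivity, hb1, ?_⟩, ?_, ?_⟩
  · rw [div_mul_eq_mul_div, div_le_one hB0]
    have : R ≤ √B := Real.le_sqrt_of_sq_le hB2
    nlinarith
  · rw [hbB, div_mul_cancel₀ _ hB0.ne']
  · rw [helC, hbB, ← Real.sqrt_sq_eq_abs]
    congr 1
    field_simp
    rw [hS] at hroot
    linear_combination hroot

/-- Only μ = 1 needs an argument. Then b = 1, R = 1, l = 0 and κ² = 2 + 2 cos θ, so κ > 0 forbids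
cos θ = -1. By connectedness θ cannot leave (-π, π), given that it starts in [-π, π]. -/
lemma exists_phase_eq {μ b : ℝ} (h : (μ, b) ∈ helicoidParams) {I : Set ℝ} (hc : I.OrdConnected)
    {ξ ν : ℝ → ℂ} {z n θ r τ κ : ℝ → ℝ}
    (hd : HelicoidData (μ * b ^ 2) (helC μ b) I ξ ν z n θ r τ κ) {u₀ : ℝ} (hu₀ : u₀ ∈ I)
    (hθ : |θ u₀| ≤ Real.pi) {u : ℝ} (hu : u ∈ I) : ∃ x, landenAm x μ = θ u := by
  obtain ⟨h0, h1, h2⟩ := mem_helicoidParams.1 h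
  rcases (le_one_of_mem h).lt_or_eq with hμ | rfl
  · exact landenAm_surjective h0 hμ _
  · apply exists_landenAm_one
    have hb : b = 1 := by linarith
    subst hb
    have hcos : ∀ u ∈ I, Real.cos (θ u) ≠ -1 := by
      intro u hu h3
      have h4 := hd.κ_sq_eq hu
      have h5 := hd.κ_pos u hu
      rw [helC_eq_zero (by norm_num), h3] at h4
      have : κ u ^ 2 = 0 := by rw [h4]; ring
      nlinarith
    have hord : (θ '' I).OrdConnected :=
      (hc.isPreconnected.image θ hd.smooth_θ.continuousOn).ordConnected
    constructor
    · by_contra! hle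
      obtain ⟨w, hw, hw'⟩ := hord.out (Set.mem_image_of_mem θ hu) (Set.mem_image_of_mem θ hu₀)
        (show -Real.pi ∈ _ from ⟨hle, (abs_le.1 hθ).1⟩)
      exact hcos w hw (by rw [hw', Real.cos_neg, Real.cos_pi])
    · by_contra! hle
      obtain ⟨w, hw, hw'⟩ := hord.out (Set.mem_image_of_mem θ hu₀) (Set.mem_image_of_mem θ hu)
        (show Real.pi ∈ _ from ⟨(abs_le.1 hθ).2, hle⟩)
      exact hcos w hw (by rw [hw', Real.cos_pi])

/-- The function s is the phase θ followed by the inverse of `landenAm`. Both κ are positive with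
the same square, a function of the phase, so they agree; comparing the derivatives of the phases
then gives s' = br. -/
lemma exists_reparametrization {μ b : ℝ} (h : (μ, b) ∈ helicoidParams) {I : Set ℝ}
    (hI : IsOpen I) (hc : I.OrdConnected) {ξ ν : ℝ → ℂ} {z n θ r τ κ : ℝ → ℝ}
    (hd : HelicoidData (μ * b ^ 2) (helC μ b) I ξ ν z n θ r τ κ) {u₀ : ℝ} (hu₀ : u₀ ∈ I)
    (hθ : |θ u₀| ≤ Real.pi) : ∃ s : ℝ → ℝ, ContDiffOn ℝ ∞ s I ∧
      (∀ u ∈ I, landenAm (s u) μ = θ u) ∧ (∀ u ∈ I, HasDerivAt s (b * r u) u) ∧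
      ∀ u ∈ I, κ u = b * (jacobiDn (s u) μ + μ * jacobiCn (s u) μ) := by
  obtain ⟨h0, h1, h2⟩ := mem_helicoidParams.1 h
  have hμ := le_one_of_mem h
  have hleft : ∀ x, Function.invFun (fun u => landenAm u μ) (landenAm x μ) = x :=
    Function.leftInverse_invFun (landenAm_strictMono h0 hμ).injective
  have hs : ∀ u ∈ I, landenAm (Function.invFun (fun u => landenAm u μ) (θ u)) μ = θ u := by
    intro u hu
    obtain ⟨x, hx⟩ := exists_phase_eq h hc hd hu₀ hθ hu
    rw [← hx, hleft]
  have hsmooth : ContDiffOn ℝ ∞ (fun u => Function.invFun (fun u => landenAm u μ) (θ u)) I := by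
    intro u hu
    have h3 := contDiffAt_leftInverse (contDiff_landenAm h0 hμ)
      (fun x => by
        rw [(hasDerivAt_landenAm h0 hμ x).deriv]
        exact jacobiDn_add_pos h0 hμ x) hleft (Function.invFun (fun u => landenAm u μ) (θ u))
    simp only [hs u hu] at h3
    exact h3.comp_contDiffWithinAt u (hd.smooth_θ u hu)
  have hκ : ∀ u ∈ I, κ u = b * (jacobiDn (Function.invFun (fun u => landenAm u μ) (θ u)) μ +
      μ * jacobiCn (Function.invFun (fun u => landenAm u μ) (θ u)) μ) := by
    intro u hu
    have e1 := hd.κ_sq_eq hu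
    have hY := helicoidData_helCurve h
    have e2 := hY.κ_sq_eq (Set.mem_univ (Function.invFun (fun u => landenAm u μ) (θ u)))
    simp only [hs u hu] at e2
    rw [← e1] at e2
    exact ((sq_eq_sq₀ (hY.κ_pos _ (Set.mem_univ _)).le (hd.κ_pos u hu).le).1 e2).symm
  refine ⟨_, hsmooth, hs, fun u hu => ?_, hκ⟩
  have h3 := ((hsmooth.differentiableOn (by simp)).differentiableAt (hI.mem_nhds hu)).hasDerivAt
  have h4 := (hasDerivAt_landenAm h0 hμ _).comp u h3
  have h5 : HasDerivAt θ _ u := h4.congr_of_eventuallyEq (by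
    filter_upwards [hI.mem_nhds hu] with w hw
    exact (hs w hw).symm)
  have h6 := h5.unique (hd.dθ u hu)
  refine h3.congr_deriv ?_
  have h7 := jacobiDn_add_pos h0 hμ (Function.invFun (fun u => landenAm u μ) (θ u))
  rw [hκ u hu] at h6
  apply mul_left_cancel₀ h7.ne'
  rw [h6]
  ring

/-- If both vanished, the normal would be vertical and κ² = l². But k · m = 0 then reads ln = 0 with
n = ±1, forcing κ = 0. Without this the rotation between two solutions would be undetermined. -/
lemma HelicoidData.pos {R l : ℝ} {I : Set ℝ} {ξ ν : ℝ → ℂ} {z n θ r τ κ : ℝ → ℝ}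
    (h : HelicoidData R l I ξ ν z n θ r τ κ) {u : ℝ} (hu : u ∈ I) : ξ u ≠ 0 ∨ ν u ≠ 0 := by
  by_contra! h0
  have h1 := h.unit u hu
  have h2 := congrArg Complex.im (h.inner_eq u hu)
  have h3 := h.κ_sq u hu
  have h4 := h.κ_pos u hu
  rw [h0.1] at h3
  rw [h0.1] at h2
  rw [h0.2] at h1
  simp at h1 h2 h3
  rcases h2 with h2 | h2
  · rw [h2] at h3; nlinarith
  · rcases h1 with h1 | h1 <;> linarith

/-- Pairs of complex numbers with the same Gram matrix differ by a rotation. -/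
lemma exists_rotation {ξ ν ξ' ν' : ℂ} (h0 : ξ' ≠ 0 ∨ ν' ≠ 0)
    (h1 : Complex.normSq ξ = Complex.normSq ξ') (h2 : Complex.normSq ν = Complex.normSq ν')
    (h3 : ν * starRingEnd ℂ ξ = ν' * starRingEnd ℂ ξ') :
    ξ' * starRingEnd ℂ ξ' + ν' * starRingEnd ℂ ν' ≠ 0 ∧
    ξ = (ξ * starRingEnd ℂ ξ' + ν * starRingEnd ℂ ν') /
      (ξ' * starRingEnd ℂ ξ' + ν' * starRingEnd ℂ ν') * ξ' ∧
    ν = (ξ * starRingEnd ℂ ξ' + ν * starRingEnd ℂ ν') /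
      (ξ' * starRingEnd ℂ ξ' + ν' * starRingEnd ℂ ν') * ν' ∧
    ‖(ξ * starRingEnd ℂ ξ' + ν * starRingEnd ℂ ν') /
      (ξ' * starRingEnd ℂ ξ' + ν' * starRingEnd ℂ ν')‖ = 1 := by
  have hne : ξ' * starRingEnd ℂ ξ' + ν' * starRingEnd ℂ ν' ≠ 0 := by
    rw [Complex.mul_conj, Complex.mul_conj, ← Complex.ofReal_add, Complex.ofReal_ne_zero]
    rcases h0 with h | h
    · have := Complex.normSq_pos.2 h
      have := Complex.normSq_nonneg ν'
      linarith
    · have := Complex.normSq_pos.2 h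
      have := Complex.normSq_nonneg ξ'
      linarith
  have k1 : ξ * starRingEnd ℂ ξ = ξ' * starRingEnd ℂ ξ' := by
    rw [Complex.mul_conj, Complex.mul_conj, h1]
  have k2 : ν * starRingEnd ℂ ν = ν' * starRingEnd ℂ ν' := by
    rw [Complex.mul_conj, Complex.mul_conj, h2]
  have k3 : starRingEnd ℂ ν * ξ = starRingEnd ℂ ν' * ξ' := by
    have := congrArg (starRingEnd ℂ) h3
    simpa using this
  have hξ : ξ = (ξ * starRingEnd ℂ ξ' + ν * starRingEnd ℂ ν') /
      (ξ' * starRingEnd ℂ ξ' + ν' * starRingEnd ℂ ν') * ξ' := by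
    rw [div_mul_eq_mul_div, eq_div_iff hne]
    linear_combination ν * k3 - ξ * k2
  have hν : ν = (ξ * starRingEnd ℂ ξ' + ν * starRingEnd ℂ ν') /
      (ξ' * starRingEnd ℂ ξ' + ν' * starRingEnd ℂ ν') * ν' := by
    rw [div_mul_eq_mul_div, eq_div_iff hne]
    linear_combination ξ * h3 - ν * k1
  refine ⟨hne, hξ, hν, ?_⟩
  set e := (ξ * starRingEnd ℂ ξ' + ν * starRingEnd ℂ ν') /
      (ξ' * starRingEnd ℂ ξ' + ν' * starRingEnd ℂ ν')
  have hsq : ∀ w : ℂ, ‖w‖ ^ 2 = Complex.normSq w := fun w => (Complex.normSq_eq_norm_sq w).symm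
  rcases h0 with h | h
  · have h4 := congrArg norm hξ
    rw [norm_mul] at h4
    have h5 : ‖ξ‖ = ‖ξ'‖ := by
      rw [← sq_eq_sq₀ (norm_nonneg _) (norm_nonneg _), hsq, hsq, h1]
    rw [h5] at h4
    exact mul_right_cancel₀ (norm_ne_zero_iff.2 h) (by rw [one_mul]; exact h4.symm)
  · have h4 := congrArg norm hν
    rw [norm_mul] at h4
    have h5 : ‖ν‖ = ‖ν'‖ := by
      rw [← sq_eq_sq₀ (norm_nonneg _) (norm_nonneg _), hsq, hsq, h2]
    rw [h5] at h4
    exact mul_right_cancel₀ (norm_ne_zero_iff.2 h) (by rw [one_mul]; exact h4.symm)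

/-- Equal phases mean equal Gram matrices, so a unit number e carries the model pair to the given
one. Both pairs satisfy the same linear equations up to the term iτ, whence e' = iτe and e = exp(iψ)
with ψ' = τ. The heights differ in derivative by lτ, which integrates to lψ plus a constant. -/
lemma HelicoidData.congruent {μ b : ℝ} (h : (μ, b) ∈ helicoidParams) {I : Set ℝ}
    (hI : IsOpen I) (hc : I.OrdConnected) {ξ ν : ℝ → ℂ} {z n θ r τ κ : ℝ → ℝ}
    (hd : HelicoidData (μ * b ^ 2) (helC μ b) I ξ ν z n θ r τ κ) {u₀ : ℝ} (hu₀ : u₀ ∈ I)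
    (hθ : |θ u₀| ≤ Real.pi) : ∃ (s ψ : ℝ → ℝ) (t : ℝ), ContDiffOn ℝ ∞ s I ∧ ContDiffOn ℝ ∞ ψ I ∧
      (∀ u ∈ I, deriv s u ≠ 0) ∧ ∀ u ∈ I,
        ξ u = Complex.exp (ψ u * Complex.I) * horizontal (helCurve μ b (s u)) ∧
        ν u = Complex.exp (ψ u * Complex.I) * horizontal (helNormal μ b (s u)) ∧
        z u = helCurve μ b (s u) 2 + helC μ b * ψ u + t ∧ n u = helNormal μ b (s u) 2 := by
  obtain ⟨s, hs, hsθ, hsd, hκ⟩ := exists_reparametrization h hI hc hd hu₀ hθ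
  obtain ⟨h0, h1, h2⟩ := mem_helicoidParams.1 h
  have hb : b ≠ 0 := by positivity
  have hY := helicoidData_helCurve h
  set x : ℝ → ℂ := fun u => horizontal (helCurve μ b u) with hx
  set y : ℝ → ℂ := fun u => horizontal (helNormal μ b u) with hy
  have hn : ∀ u ∈ I, n u = helNormal μ b (s u) 2 := by
    intro u hu
    have e1 := hd.n_eq u hu
    have e2 := hY.n_eq (s u) (Set.mem_univ _)
    simp only [hsθ u hu] at e2
    rw [← e1, ← hκ u hu] at e2
    exact (mul_left_cancel₀ (hd.κ_pos u hu).ne' e2).symm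
  have hrot := fun u (hu : u ∈ I) => exists_rotation (ξ := ξ u) (ν := ν u)
    (hY.pos (Set.mem_univ (s u)))
    (by
      have := hY.normSq_eq (s u) (Set.mem_univ _)
      rw [hd.normSq_eq u hu, this, hsθ u hu])
    (by
      have e1 := hY.unit (s u) (Set.mem_univ _)
      have e2 := hd.unit u hu
      rw [hn u hu] at e2
      linarith)
    (by
      have e1 := hY.inner_eq (s u) (Set.mem_univ _)
      rw [hsθ u hu, ← hn u hu] at e1
      rw [e1, hd.inner_eq u hu])
  -- Either of the two vectors may vanish somewhere, but the common denominator never does, so this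
  -- formula is differentiable on all of I.
  set e : ℝ → ℂ := fun u => (ξ u * starRingEnd ℂ (x (s u)) + ν u * starRingEnd ℂ (y (s u))) /
      (x (s u) * starRingEnd ℂ (x (s u)) + y (s u) * starRingEnd ℂ (y (s u))) with he
  have heξ : ∀ u ∈ I, ξ u = e u * x (s u) := fun u hu => (hrot u hu).2.1
  have heν : ∀ u ∈ I, ν u = e u * y (s u) := fun u hu => (hrot u hu).2.2.1
  have he1 : ∀ u ∈ I, ‖e u‖ = 1 := fun u hu => (hrot u hu).2.2.2
  have hxd : ∀ u ∈ I, HasDerivAt (fun u => x (s u)) (r u *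
      (n u * x (s u) + Complex.I * helC μ b * y (s u))) u := by
    intro u hu
    have := (hY.dξ (s u) (Set.mem_univ _)).scomp u (hsd u hu)
    refine this.congr_deriv ?_
    rw [hn u hu, Complex.real_smul]
    have hb' : (b : ℂ) ≠ 0 := Complex.ofReal_ne_zero.2 hb
    push_cast
    field_simp
    ring
  have hyd : ∀ u ∈ I, HasDerivAt (fun u => y (s u)) (r u *
      ((1 - ((1 + μ * b ^ 2 * Real.cos (θ u) : ℝ) : ℂ) / (κ u : ℂ) ^ 2) *
      (n u * x (s u) + Complex.I * helC μ b * y (s u)) + helC μ b / (κ u : ℂ) ^ 2 *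
        (Complex.I * x (s u)))) u := by
    intro u hu
    have := (hY.dν (s u) (Set.mem_univ _)).scomp u (hsd u hu)
    refine this.congr_deriv ?_
    simp only [hn u hu, Complex.real_smul, hsθ u hu, ← hκ u hu]
    have hb' : (b : ℂ) ≠ 0 := Complex.ofReal_ne_zero.2 hb
    have hκ' : (κ u : ℂ) ≠ 0 := Complex.ofReal_ne_zero.2 (hd.κ_pos u hu).ne'
    push_cast
    field_simp
    ring
  have hed : ∀ u ∈ I, HasDerivAt e (Complex.I * τ u * e u) u := by
    intro u hu
    have hdx := (hxd u hu).differentiableAt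
    have hdy := (hyd u hu).differentiableAt
    have hde : DifferentiableAt ℝ e u := by
      refine DifferentiableAt.div ?_ ?_ (hrot u hu).1
      · exact ((hd.dξ u hu).differentiableAt.mul hdx.star).add
          ((hd.dν u hu).differentiableAt.mul hdy.star)
      · exact (hdx.mul hdx.star).add (hdy.mul hdy.star)
    have hev : ∀ᶠ w in nhds u, w ∈ I := hI.mem_nhds hu
    have p1 : HasDerivAt ξ _ u := (hde.hasDerivAt.mul (hxd u hu)).congr_of_eventuallyEq
      (hev.mono fun w hw => heξ w hw)
    have p2 : HasDerivAt ν _ u := (hde.hasDerivAt.mul (hyd u hu)).congr_of_eventuallyEq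
      (hev.mono fun w hw => heν w hw)
    have q1 := p1.unique (hd.dξ u hu)
    have q2 := p2.unique (hd.dν u hu)
    rw [heξ u hu, heν u hu] at q1 q2
    have r1 : (deriv e u - Complex.I * τ u * e u) * x (s u) = 0 := by linear_combination q1
    have r2 : (deriv e u - Complex.I * τ u * e u) * y (s u) = 0 := by linear_combination q2
    refine hde.hasDerivAt.congr_deriv (sub_eq_zero.1 ?_)
    rcases hY.pos (Set.mem_univ (s u)) with h3 | h3
    · exact (mul_eq_zero.1 r1).resolve_right h3
    · exact (mul_eq_zero.1 r2).resolve_right h3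
  obtain ⟨P, hP, hP0, hP'⟩ := exists_antideriv hI hc hd.smooth_τ hu₀
  have hder : ∀ u ∈ I, HasDerivAt (fun u => e u * Complex.exp (-(P u * Complex.I))) 0 u := by
    intro u hu
    have h2 := ((((hP' u hu).ofReal_comp).mul_const Complex.I).neg).cexp
    refine ((hed u hu).mul h2).congr_deriv ?_
    simp only [Pi.neg_apply]
    ring
  have hpolar : ∀ u ∈ I, e u = Complex.exp (((P u + (e u₀).arg : ℝ) : ℂ) * Complex.I) := by
    intro u hu
    have h3 := eq_of_hasDerivAt_eq hc hder hu hu₀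
    simp only [hP0, Complex.ofReal_zero, zero_mul, neg_zero, Complex.exp_zero, mul_one] at h3
    have h4 := Complex.norm_mul_exp_arg_mul_I (e u₀)
    rw [he1 u₀ hu₀, Complex.ofReal_one, one_mul, ← h3] at h4
    push_cast
    rw [h3] at h4
    rw [add_mul, Complex.exp_add, h4, ← h3, mul_comm, mul_assoc, ← Complex.exp_add]
    simp
  have hz : ∀ u ∈ I, HasDerivAt
      (fun u => z u - helCurve μ b (s u) 2 - helC μ b * (P u + (e u₀).arg)) 0 u := by
    intro u hu
    have h3 := ((hd.dz u hu).sub ((hY.dz (s u) (Set.mem_univ _)).comp u (hsd u hu))).sub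
      (((hP' u hu).add_const (e u₀).arg).const_mul (helC μ b))
    refine h3.congr_deriv ?_
    rw [hsθ u hu]
    field_simp
    ring
  refine ⟨s, fun u => P u + (e u₀).arg, z u₀ - helCurve μ b (s u₀) 2 -
    helC μ b * (P u₀ + (e u₀).arg), hs, hP.add contDiffOn_const, fun u hu => ?_,
    fun u hu => ⟨?_, ?_, ?_, hn u hu⟩⟩
  · rw [(hsd u hu).deriv]
    exact mul_ne_zero hb (hd.r_ne u hu)
  · rw [← hpolar u hu]; exact heξ u hu
  · rw [← hpolar u hu]; exact heν u hu
  · have := eq_of_hasDerivAt_eq hc hz hu hu₀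
    simp only at this ⊢
    linarith

/-! ### Surfaces of non-zero constant mean curvature -/

/-- The map `(x, y, z) ↦ (x, y, ε z + t)`. -/
def axialMap (ε t : ℝ) (q : E3) : E3 := ![q 0, q 1, ε * q 2 + t]

@[simp] lemma axialMap_apply_zero (ε t : ℝ) (q : E3) : axialMap ε t q 0 = q 0 := rfl
@[simp] lemma axialMap_apply_one (ε t : ℝ) (q : E3) : axialMap ε t q 1 = q 1 := rfl
@[simp] lemma axialMap_apply_two (ε t : ℝ) (q : E3) : axialMap ε t q 2 = ε * q 2 + t := rfl

lemma horizontal_eq_exp_mul {p q : E3} {ψ : ℝ}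
    (h : horizontal p = Complex.exp (ψ * Complex.I) * horizontal q) :
    p 0 = Real.cos ψ * q 0 - Real.sin ψ * q 1 ∧ p 1 = Real.sin ψ * q 0 + Real.cos ψ * q 1 := by
  have h0 := congrArg Complex.re h
  have h1 := congrArg Complex.im h
  rw [Complex.mul_re, Complex.exp_ofReal_mul_I_re, Complex.exp_ofReal_mul_I_im] at h0
  rw [Complex.mul_im, Complex.exp_ofReal_mul_I_re, Complex.exp_ofReal_mul_I_im] at h1
  simp only [horizontal_re, horizontal_im] at h0 h1
  exact ⟨h0, by rw [h1]; ring⟩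

lemma helicoidalMotion_eq_axialMap {p q : E3} {ψ ε l t : ℝ} (hε : ε = 1 ∨ ε = -1)
    (h : horizontal p = Complex.exp (ψ * Complex.I) * horizontal q)
    (h2 : ε * p 2 = q 2 + l * ψ + t) (v : ℝ) :
    helicoidalMotion (ε * l) v p = axialMap ε (ε * t) (helicoidalMotion l (v + ψ) q) := by
  obtain ⟨h0, h1⟩ := horizontal_eq_exp_mul h
  have hε2 : ε * ε = 1 := by rcases hε with rfl | rfl <;> norm_num
  apply E3.ext
  · simp only [helicoidalMotion_apply_zero, axialMap_apply_zero, h0, h1, Real.cos_add,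
      Real.sin_add]
    ring
  · simp only [helicoidalMotion_apply_one, axialMap_apply_one, h0, h1, Real.cos_add,
      Real.sin_add]
    ring
  · simp only [helicoidalMotion_apply_two, axialMap_apply_two]
    linear_combination ε * h2 - p 2 * hε2

lemma IsCmcHelicoid.exists_congruent {l : ℝ} {I : Set ℝ} {c : ℝ → E3}
    (h : IsCmcHelicoid (-1 / 2) l I c) : ∃ μ b : ℝ, (μ, b) ∈ helicoidParams ∧
    ∃ (ε t : ℝ) (s ψ : ℝ → ℝ), (ε = 1 ∨ ε = -1) ∧ ContDiffOn ℝ ∞ s I ∧ ContDiffOn ℝ ∞ ψ I ∧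
      (∀ u ∈ I, deriv s u ≠ 0) ∧ ∀ u ∈ I, ∀ v : ℝ,
        helicoidalMotion l v (c u) =
          axialMap ε t (helicoidalMotion (helC μ b) (v + ψ u) (helCurve μ b (s u))) ∧
        helicoidalMotion 0 v (unitNormal l c u) =
          axialMap ε 0 (helicoidalMotion 0 (v + ψ u) (helNormal μ b (s u))) := by
  rcases I.eq_empty_or_nonempty with rfl | ⟨u₀, hu₀⟩
  -- Over an empty interval any admissible parameters serve.
  · exact ⟨1, 1, mem_helicoidParams.2 (by norm_num), 1, 0, id, id, Or.inl rfl, by simp⟩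
  obtain ⟨R, θ, hR, hθ, hd⟩ := h.exists_helicoidData hu₀
  obtain ⟨μ, b, hp, rfl, hl⟩ := exists_helicoidParams hR l
  have hθ' : |θ u₀| ≤ Real.pi := abs_le.2 ⟨hθ.1.le, hθ.2⟩
  -- The model pitch c₁ is nonnegative; a negative pitch is handled through the reflected data, with
  -- ε = -1.
  rcases le_total 0 l with hl0 | hl0
  · rw [abs_of_nonneg hl0] at hl
    subst hl
    obtain ⟨s, ψ, t, hs, hψ, hs', hm⟩ := hd.congruent hp h.isOpen h.ordConnected hu₀ hθ'
    refine ⟨μ, b, hp, 1, 1 * t, s, ψ, Or.inl rfl, hs, hψ, hs', fun u hu v => ?_⟩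
    obtain ⟨m1, m2, m3, m4⟩ := hm u hu
    constructor
    · have := helicoidalMotion_eq_axialMap (Or.inl rfl) m1 (l := helC μ b) (t := t)
        (by rw [one_mul, m3]) v
      rwa [one_mul] at this
    · have := helicoidalMotion_eq_axialMap (Or.inl rfl) m2 (l := 0) (t := 0)
        (by rw [one_mul, m4]; ring) v
      rwa [mul_zero] at this
  · rw [abs_of_nonpos hl0] at hl
    have hd' := hd.flip
    rw [← hl] at hd'
    obtain ⟨s, ψ, t, hs, hψ, hs', hm⟩ := hd'.congruent hp h.isOpen h.ordConnected hu₀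
      (by rwa [abs_neg])
    refine ⟨μ, b, hp, -1, -1 * t, s, ψ, Or.inr rfl, hs, hψ, hs', fun u hu v => ?_⟩
    obtain ⟨m1, m2, m3, m4⟩ := hm u hu
    constructor
    · have := helicoidalMotion_eq_axialMap (Or.inr rfl) m1 (l := helC μ b) (t := t)
        (by rw [← m3]; ring) v
      rwa [hl, show -1 * -l = l by ring, ← hl] at this
    · have := helicoidalMotion_eq_axialMap (Or.inr rfl) m2 (l := 0) (t := 0)
        (by rw [← m4]; ring) v
      rwa [mul_zero] at this

lemma gaussMap_comp_div {b : ℝ} (hb : 0 < b) (x : ℝ → ℝ → E3) (u v : ℝ) :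
    gaussMap (fun u v => x u (v / b)) u v = gaussMap x u (v / b) := by
  have h1 : partialU (fun u v => x u (v / b)) u v = partialU x u (v / b) := rfl
  have h2 : partialV (fun u v => x u (v / b)) u v = (1 / b) • partialV x u (v / b) := by
    have := deriv_comp_mul_left b⁻¹ (x u) v
    simp only [inv_mul_eq_div] at this
    rw [partialV, this, one_div]
    rfl
  simp only [gaussMap, h1, h2, map_smul, smul_dotProduct, dotProduct_smul, smul_smul, smul_eq_mul]
  congr 1
  rw [← mul_assoc, Real.sqrt_mul (by positivity), Real.sqrt_mul_self (by positivity)]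
  field_simp

/-! ### Distances from the axis on the explicit surfaces and their companions -/

section

variable {μ b : ℝ} (h : (μ, b) ∈ helicoidParams) {H : ℝ} (hH : H ≠ 0) (u v : ℝ)
include h hH

lemma gaussMap_cmcHelicoid :
    gaussMap (cmcHelicoid μ b H) u v = helicoidalMotion 0 (v / b) (helNormal μ b u) := by
  obtain ⟨h0, h1, h2⟩ := mem_helicoidParams.1 h
  have hk : -1 / (2 * H) ≠ 0 := div_ne_zero (by norm_num) (by simpa using hH)
  have : cmcHelicoid μ b H = fun u v => (-1 / (2 * H)) •
    (fun u v => helicoidalSurface (helC μ b) (helCurve μ b) u (v / b)) u v := rfl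
  rw [this, gaussMap_smul hk, gaussMap_comp_div (by positivity),
    gaussMap_helicoidalSurface _ _ (hasDerivAt_helCurve h u).differentiableAt,
    unitNormal_helCurve h]

lemma cgcCompanion_cmcHelicoid : cgcCompanion H (cmcHelicoid μ b H) u v = (-1 / (2 * H)) •
    (helicoidalMotion (helC μ b) (v / b) (helCurve μ b u) -
      helicoidalMotion 0 (v / b) (helNormal μ b u)) := by
  rw [cgcCompanion, gaussMap_cmcHelicoid h hH, smul_sub, neg_div, neg_smul (1 / (2 * H))
    (helicoidalMotion 0 _ _), sub_neg_eq_add, ← neg_div]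
  rfl

omit hH in
lemma axisDist_cmcHelicoid : axisDist (cmcHelicoid μ b H u v) =
    √(1 + (μ * b ^ 2) ^ 2 + 2 * (μ * b ^ 2) * Real.cos (landenAm u μ)) / |2 * H| := by
  rw [cmcHelicoid_eq, axisDist_smul, helicoidalSurface, axisDist_helicoidalMotion, abs_div,
    abs_neg, abs_one, one_div_mul_eq_div, axisDist,
    ← (helicoidData_helCurve h).normSq_eq u (Set.mem_univ u), Complex.normSq_apply]
  simp only [horizontal_re, horizontal_im, pow_two]

/-- In the normalized scale the companion is the surface minus its normal; this removes n₀ and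
leaves x̌₀, moved by rotations and an axial translation. -/
lemma axisDist_cgcCompanion : axisDist (cgcCompanion H (cmcHelicoid μ b H) u v) =
    √(μ ^ 2 * b ^ 4 - μ ^ 2 * b ^ 2 * jacobiSn u μ ^ 2) / |2 * H| := by
  have h1 : axisDist (helicoidalMotion (helC μ b) (v / b) (helCurve μ b u) -
      helicoidalMotion 0 (v / b) (helNormal μ b u)) = axisDist (helX0 μ b u) := by
    have h2 : axisDist (helX0 μ b u) =
        axisDist (helicoidalMotion 0 (v / b) (helicoidalMotion 0 (helG μ b u) (helX0 μ b u))) := by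
      rw [axisDist_helicoidalMotion, axisDist_helicoidalMotion]
    rw [h2, axisDist, axisDist]
    congr 1
    simp only [Pi.sub_apply, helicoidalMotion_apply_zero, helicoidalMotion_apply_one, helCurve,
      helNormal, Pi.add_apply]
    ring
  rw [cgcCompanion_cmcHelicoid h hH, axisDist_smul, h1, abs_div, abs_neg, abs_one,
    one_div_mul_eq_div, axisDist, helX0_sq h u]

lemma le_axisDist_cmcHelicoid : |1 - μ * b ^ 2| / |2 * H| ≤ axisDist (cmcHelicoid μ b H u v) := by
  obtain ⟨h0, h1, h2⟩ := mem_helicoidParams.1 h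
  rw [axisDist_cmcHelicoid h]
  gcongr
  apply Real.abs_le_sqrt
  have h3 : 0 ≤ μ * b ^ 2 := by positivity
  nlinarith [Real.neg_one_le_cos (landenAm u μ)]

lemma axisDist_cmcHelicoid_le : axisDist (cmcHelicoid μ b H u v) ≤ (1 + μ * b ^ 2) / |2 * H| := by
  obtain ⟨h0, h1, h2⟩ := mem_helicoidParams.1 h
  rw [axisDist_cmcHelicoid h]
  have h3 : 0 ≤ μ * b ^ 2 := by positivity
  gcongr
  apply Real.sqrt_le_iff.2 ⟨by positivity, ?_⟩
  nlinarith [Real.cos_le_one (landenAm u μ)]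

omit hH u v in
lemma sqrt_inner_eq : √(μ ^ 2 * b ^ 4 - μ ^ 2 * b ^ 2) = μ * b * √(b ^ 2 - 1) := by
  obtain ⟨h0, h1, h2⟩ := mem_helicoidParams.1 h
  rw [show μ ^ 2 * b ^ 4 - μ ^ 2 * b ^ 2 = (μ * b) ^ 2 * (b ^ 2 - 1) by ring,
    Real.sqrt_mul (sq_nonneg _), Real.sqrt_sq (by positivity)]

lemma le_axisDist_cgcCompanion : μ * b * √(b ^ 2 - 1) / |2 * H| ≤
    axisDist (cgcCompanion H (cmcHelicoid μ b H) u v) := by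
  obtain ⟨h0, h1, h2⟩ := mem_helicoidParams.1 h
  rw [axisDist_cgcCompanion h hH, ← sqrt_inner_eq h]
  refine div_le_div_of_nonneg_right (Real.sqrt_le_sqrt ?_) (abs_nonneg _)
  have : jacobiSn u μ ^ 2 ≤ 1 := Real.sin_sq_le_one _
  nlinarith [mul_nonneg (sq_nonneg μ) (sq_nonneg b)]

lemma axisDist_cgcCompanion_le :
    axisDist (cgcCompanion H (cmcHelicoid μ b H) u v) ≤ μ * b ^ 2 / |2 * H| := by
  obtain ⟨h0, h1, h2⟩ := mem_helicoidParams.1 h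
  rw [axisDist_cgcCompanion h hH]
  gcongr
  apply Real.sqrt_le_iff.2 ⟨by positivity, ?_⟩
  have : 0 ≤ μ ^ 2 * b ^ 2 * jacobiSn u μ ^ 2 := by positivity
  nlinarith

end

/-- The Gauss map survives the normalizing scaling and is carried along by the congruence, so one
change of parameters serves for the surface and its companion. -/
lemma IsCmcHelicoid.exists_parametrizedBy {H l : ℝ} {I : Set ℝ} {c : ℝ → E3}
    (h : IsCmcHelicoid H l I c) : ∃ μ b : ℝ, (μ, b) ∈ helicoidParams ∧
      ParametrizedBy I (helicoidalSurface l c) b (cmcHelicoid μ b H) ∧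
      ParametrizedBy I (cgcCompanion H (helicoidalSurface l c)) b
        (cgcCompanion H (cmcHelicoid μ b H)) := by
  have hH := h.ne_zero
  have hk : -2 * H ≠ 0 := mul_ne_zero (by norm_num) hH
  have h1 := h.smul hk
  rw [show H / (-2 * H) = -1 / 2 by field_simp] at h1
  obtain ⟨μ, b, hp, ε, t, s, ψ, hε, hs, hψ, hs', hm⟩ := h1.exists_congruent
  obtain ⟨h0, hb1, -⟩ := mem_helicoidParams.1 hp
  have hb : b ≠ 0 := by positivity
  have hsurf : ∀ u v, (-2 * H) • helicoidalSurface l c u v =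
      helicoidalMotion (-2 * H * l) v ((-2 * H) • c u) := fun u v =>
    (congrFun (congrFun (helicoidalSurface_smul (-2 * H) l c) u) v).symm
  have hdiv : ∀ u v, (b * v + b * ψ u) / b = v + ψ u := fun u v => by field_simp
  have hgauss : ∀ u ∈ I, ∀ v, gaussMap (helicoidalSurface l c) u v =
      axialMap ε 0 (helicoidalMotion 0 (v + ψ u) (helNormal μ b (s u))) := by
    intro u hu v
    rw [← (hm u hu v).2, ← gaussMap_helicoidalSurface _ _
      (h1.isGenerating.hasDerivAt hu).differentiableAt, helicoidalSurface_smul, gaussMap_smul hk]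
  have hcoord : ∀ u ∈ I, ∀ v, helicoidalSurface l c u v = (-1 / (2 * H)) •
      axialMap ε t (helicoidalMotion (helC μ b) (v + ψ u) (helCurve μ b (s u))) := by
    intro u hu v
    rw [← (hm u hu v).1, ← hsurf, smul_smul,
      show -1 / (2 * H) * (-2 * H) = 1 by field_simp, one_smul]
  refine ⟨μ, b, hp, ⟨ε, -1 / (2 * H) * t, s, fun u => b * ψ u, hε, hs, contDiffOn_const.mul hψ,
    hs', fun u hu v => ?_⟩, ⟨ε, -1 / (2 * H) * t, s, fun u => b * ψ u, hε, hs,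
    contDiffOn_const.mul hψ, hs', fun u hu v => ?_⟩⟩
  · rw [hcoord u hu v, cmcHelicoid_eq, hdiv, helicoidalSurface]
    apply E3.ext
    · rfl
    · rfl
    · simp; ring
  · rw [cgcCompanion, hgauss u hu v, hcoord u hu v, cgcCompanion_cmcHelicoid hp hH, hdiv]
    apply E3.ext
    · simp; ring
    · simp; ring
    · simp; ring

lemma ParametrizedBy.exists_axisDist_eq {I : Set ℝ} {x y : ℝ → ℝ → E3} {b : ℝ}
    (h : ParametrizedBy I x b y) {u : ℝ} (hu : u ∈ I) (v : ℝ) :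
    ∃ u' v', axisDist (x u v) = axisDist (y u' v') := by
  obtain ⟨ε, t, s, τ, -, -, -, -, h⟩ := h
  exact ⟨_, _, by rw [h u hu v]; rfl⟩

/-- Changing the sign of H is the point reflection in the origin, that is, z ↦ -z composed with the
half turn about the axis. The half turn is a shift of v by bπ, and the helicoidal motion it belongs
to is compensated by an axial translation. -/
lemma ParametrizedBy.cgcCompanion_neg {I : Set ℝ} {x : ℝ → ℝ → E3} {μ b H : ℝ}
    (hp : (μ, b) ∈ helicoidParams) (hH : H ≠ 0)
    (h : ParametrizedBy I x b (cgcCompanion (-H) (cmcHelicoid μ b (-H)))) :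
    ParametrizedBy I x b (cgcCompanion H (cmcHelicoid μ b H)) := by
  obtain ⟨h0, hb1, -⟩ := mem_helicoidParams.1 hp
  have hb : b ≠ 0 := by positivity
  obtain ⟨ε, t, s, τ, hε, hs, hτ, hs', h⟩ := h
  refine ⟨-ε, t + ε * (-1 / (2 * H)) * (helC μ b * Real.pi), s, fun u => τ u + b * Real.pi,
    ?_, hs, hτ.add contDiffOn_const, hs', fun u hu v => ?_⟩
  · rcases hε with rfl | rfl
    · exact Or.inr rfl
    · exact Or.inl (neg_neg 1)
  · rw [h u hu v, cgcCompanion_cmcHelicoid hp hH, cgcCompanion_cmcHelicoid hp (neg_ne_zero.2 hH)]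
    have : (b * v + (τ u + b * Real.pi)) / b = (b * v + τ u) / b + Real.pi := by
      field_simp; ring
    rw [this]
    apply E3.ext
    · simp [Real.cos_add_pi, Real.sin_add_pi]; ring
    · simp [Real.cos_add_pi, Real.sin_add_pi]; ring
    · simp; ring

/-! ### Parallel surfaces of surfaces of constant positive Gaussian curvature -/

/-- The Gram identity for tangent vectors `α`, `β` in terms of a tangent frame `a`, `k`. -/
lemma gram_eq {a k m α β : E3} {W : ℝ} (hW : crossProduct a k = W • m) (hα : m ⬝ᵥ α = 0) :
    (a ⬝ᵥ a * (k ⬝ᵥ k) - (a ⬝ᵥ k) ^ 2) * (α ⬝ᵥ β) = k ⬝ᵥ k * (a ⬝ᵥ α) * (a ⬝ᵥ β) -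
      a ⬝ᵥ k * (a ⬝ᵥ α * (k ⬝ᵥ β) + k ⬝ᵥ α * (a ⬝ᵥ β)) + a ⬝ᵥ a * (k ⬝ᵥ α) * (k ⬝ᵥ β) := by
  have h1 : crossProduct a k ⬝ᵥ α = 0 := by rw [hW, smul_dotProduct, hα, smul_zero]
  simp only [dot_eq, cross_apply_zero, cross_apply_one, cross_apply_two] at h1 ⊢
  linear_combination ((a 1 * k 2 - a 2 * k 1) * β 0 + (a 2 * k 0 - a 0 * k 2) * β 1 +
    (a 0 * k 1 - a 1 * k 0) * β 2) * h1

/-- Bonnet's computation, with x, y, w the coefficients of the third fundamental form III. By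
Cayley–Hamilton III = h II - K I, where h is twice the mean curvature, and r²K = 1. Hence the
parallel surface has first form r(rh - 2) II and second form (1 - rh) II + I/r. -/
lemma parallel_meanCurvature {E F G L M N x y w r D : ℝ} (hD0 : D ≠ 0)
    (hr : r ≠ 0) (hK : r ^ 2 * (L * N - M ^ 2) = D)
    (hx : D * x = G * L ^ 2 - 2 * F * L * M + E * M ^ 2)
    (hy : D * y = G * L * M - F * (L * N + M ^ 2) + E * M * N)
    (hw : D * w = G * M ^ 2 - 2 * F * M * N + E * N ^ 2) :
    (G - 2 * r * N + r ^ 2 * w) * (L - r * x) - 2 * (F - 2 * r * M + r ^ 2 * y) * (M - r * y) +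
      (E - 2 * r * L + r ^ 2 * x) * (N - r * w) =
    -(1 / r) * ((E - 2 * r * L + r ^ 2 * x) * (G - 2 * r * N + r ^ 2 * w) -
      (F - 2 * r * M + r ^ 2 * y) ^ 2) := by
  obtain ⟨h, hh⟩ : ∃ h, h * D = G * L - 2 * F * M + E * N := ⟨_, div_mul_cancel₀ _ hD0⟩
  have ex : r ^ 2 * x = r ^ 2 * h * L - E := by
    apply mul_left_cancel₀ hD0
    linear_combination r ^ 2 * hx - r ^ 2 * L * hh - E * hK
  have ey : r ^ 2 * y = r ^ 2 * h * M - F := by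
    apply mul_left_cancel₀ hD0
    linear_combination r ^ 2 * hy - r ^ 2 * M * hh - F * hK
  have ew : r ^ 2 * w = r ^ 2 * h * N - G := by
    apply mul_left_cancel₀ hD0
    linear_combination r ^ 2 * hw - r ^ 2 * N * hh - G * hK
  have fx : x = h * L - E / r ^ 2 := by field_simp; linear_combination ex
  have fy : y = h * M - F / r ^ 2 := by field_simp; linear_combination ey
  have fw : w = h * N - G / r ^ 2 := by field_simp; linear_combination ew
  rw [ex, ey, ew, fx, fy, fw]
  field_simp
  linear_combination (h * r - 2) * (-r * hh - h * r * hK)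

section

variable {l : ℝ} {I : Set ℝ} {c : ℝ → E3}

lemma unitNormal_dot_killing (l : ℝ) (c : ℝ → E3) (u : ℝ) :
    unitNormal l c u ⬝ᵥ killing 0 (unitNormal l c u) = 0 := by
  simp only [dot_eq, killing_apply_zero, killing_apply_one, killing_apply_two]
  ring

/-- Twice the mean curvature times the determinant of the first fundamental form. -/
noncomputable def meanNumerator (l : ℝ) (c : ℝ → E3) (u : ℝ) : ℝ :=
  killing l (c u) ⬝ᵥ killing l (c u) * -(deriv c u ⬝ᵥ deriv (unitNormal l c) u) -
    2 * (deriv c u ⬝ᵥ killing l (c u)) * -(deriv c u ⬝ᵥ killing 0 (unitNormal l c u)) +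
    deriv c u ⬝ᵥ deriv c u * -(killing l (c u) ⬝ᵥ killing 0 (unitNormal l c u))

lemma IsGenerating.continuousOn_meanNumerator (h : IsGenerating l I c) :
    ContinuousOn (meanNumerator l c) I := by
  obtain ⟨c0, c1, c2⟩ := contDiffOn_E3.1 h.smooth
  obtain ⟨d0, d1, d2⟩ := contDiffOn_E3.1 h.contDiffOn_deriv
  obtain ⟨m0, m1, m2⟩ := contDiffOn_E3.1 h.contDiffOn_unitNormal
  obtain ⟨n0, n1, n2⟩ := contDiffOn_E3.1
    ((contDiffOn_infty_iff_deriv_of_isOpen h.isOpen).1 h.contDiffOn_unitNormal).2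
  have : ContDiffOn ℝ ∞ (meanNumerator l c) I := by
    unfold meanNumerator
    simp only [dot_eq, killing_apply_zero, killing_apply_one, killing_apply_two]
    fun_prop
  exact this.continuousOn

lemma IsGenerating.det_pos (h : IsGenerating l I c) {u : ℝ} (hu : u ∈ I) :
    0 < deriv c u ⬝ᵥ deriv c u * (killing l (c u) ⬝ᵥ killing l (c u)) -
      (deriv c u ⬝ᵥ killing l (c u)) ^ 2 := by
  have hp := dot_self_pos (h.cross_ne u hu)
  rwa [cross_dot_cross, dotProduct_comm (killing l (c u)) (deriv c u), ← pow_two] at hp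

lemma IsCgcHelicoid.isGenerating {K : ℝ} (h : IsCgcHelicoid K l I c) : IsGenerating l I c :=
  isHelicoidalImmersion_iff.1 h.toIsHelicoidalImmersion

lemma IsCgcHelicoid.gauss_eq {K : ℝ} (h : IsCgcHelicoid K l I c) {u : ℝ} (hu : u ∈ I) :
    -(deriv c u ⬝ᵥ deriv (unitNormal l c) u) *
      -(killing l (c u) ⬝ᵥ killing 0 (unitNormal l c u)) -
      (-(deriv c u ⬝ᵥ killing 0 (unitNormal l c u))) ^ 2 =
    K * (deriv c u ⬝ᵥ deriv c u * (killing l (c u) ⬝ᵥ killing l (c u)) -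
      (deriv c u ⬝ᵥ killing l (c u)) ^ 2) := by
  have h1 := h.gaussCurvature_eq u hu 0
  have hg := h.isGenerating
  rwa [gaussCurvature, hg.fffE_eq hu, hg.fffF_eq hu, IsGenerating.fffG_eq, hg.sffL_eq hu,
    hg.sffM_eq hu, hg.sffN_eq hu, div_eq_iff (hg.det_pos hu).ne'] at h1

/-- Positive Gaussian curvature gives principal curvatures of one sign, so their sum is not zero. In
coordinates, a vanishing sum would make a positive term plus two nonnegative ones equal to 0. -/
lemma IsCgcHelicoid.meanNumerator_ne {K : ℝ} (h : IsCgcHelicoid K l I c) {u : ℝ} (hu : u ∈ I) :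
    meanNumerator l c u ≠ 0 := by
  intro h0
  rw [meanNumerator] at h0
  have h1 := h.gauss_eq hu
  have h2 := h.isGenerating.det_pos hu
  have hG := h.isGenerating.killing_dot_self_pos hu
  have hK := h.pos
  generalize -(deriv c u ⬝ᵥ deriv (unitNormal l c) u) = L at *
  generalize -(killing l (c u) ⬝ᵥ killing 0 (unitNormal l c u)) = N at *
  generalize -(deriv c u ⬝ᵥ killing 0 (unitNormal l c u)) = M at *
  generalize deriv c u ⬝ᵥ deriv c u = E at *
  generalize deriv c u ⬝ᵥ killing l (c u) = F at *
  generalize killing l (c u) ⬝ᵥ killing l (c u) = G at *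
  have h3 := mul_pos hK h2
  rw [← h1] at h3
  have h4 : G ^ 2 * (L * N - M ^ 2) + (E * G - F ^ 2) * N ^ 2 + (G * M - F * N) ^ 2 = 0 := by
    linear_combination N * G * h0
  nlinarith [mul_pos (pow_pos hG 2) h3, mul_nonneg h2.le (sq_nonneg N), sq_nonneg (G * M - F * N)]

/-- The mean curvature keeps its sign on the interval, so one choice of side serves for the whole
surface. -/
lemma IsCgcHelicoid.meanNumerator_mul_pos {K : ℝ} (h : IsCgcHelicoid K l I c) {u₀ u : ℝ}
    (hu₀ : u₀ ∈ I) (hu : u ∈ I) : 0 < meanNumerator l c u₀ * meanNumerator l c u := by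
  have hord := (h.ordConnected.isPreconnected.image _
    h.isGenerating.continuousOn_meanNumerator).ordConnected
  have hne : (0 : ℝ) ∉ meanNumerator l c '' I := by
    rintro ⟨w, hw, hw'⟩
    exact h.meanNumerator_ne hw hw'
  have m0 := Set.mem_image_of_mem (meanNumerator l c) hu₀
  have m1 := Set.mem_image_of_mem (meanNumerator l c) hu
  rcases lt_or_gt_of_ne (h.meanNumerator_ne hu₀) with h0 | h0 <;>
    rcases lt_or_gt_of_ne (h.meanNumerator_ne hu) with h1 | h1
  · exact mul_pos_of_neg_of_neg h0 h1
  · exact absurd (hord.out m0 m1 ⟨h0.le, h1.le⟩) hne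
  · exact absurd (hord.out m1 m0 ⟨h1.le, h0.le⟩) hne
  · exact mul_pos h0 h1

/-- The curve at signed distance `r` along the normal. -/
noncomputable def parallelCurve (l r : ℝ) (c : ℝ → E3) (u : ℝ) : E3 := c u + r • unitNormal l c u

lemma killing_parallelCurve (l r : ℝ) (c : ℝ → E3) (u : ℝ) :
    killing l (parallelCurve l r c u) = killing l (c u) + r • killing 0 (unitNormal l c u) := by
  apply E3.ext <;> simp [parallelCurve]
  ring

lemma IsGenerating.hasDerivAt_parallelCurve (h : IsGenerating l I c) (r : ℝ) {u : ℝ}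
    (hu : u ∈ I) : HasDerivAt (parallelCurve l r c)
      (deriv c u + r • deriv (unitNormal l c) u) u :=
  (h.hasDerivAt hu).add ((h.hasDerivAt_unitNormal hu).const_smul r)

lemma eq_smul_of_orthogonal {a k m w : E3} {W : ℝ} (hW : crossProduct a k = W • m)
    (hm : m ⬝ᵥ m = 1) (hW0 : W ≠ 0) (ha : a ⬝ᵥ w = 0) (hk : k ⬝ᵥ w = 0) :
    w = ((crossProduct a k ⬝ᵥ w) / W) • m := by
  have h1 : crossProduct (crossProduct a k) w = 0 := by
    apply E3.ext <;> simp [cross_apply]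
    all_goals simp only [dot_eq] at ha hk
    · linear_combination k 0 * ha - a 0 * hk
    · linear_combination k 1 * ha - a 1 * hk
    · linear_combination k 2 * ha - a 2 * hk
  have h2 : crossProduct m w = 0 := by
    rw [hW, map_smul, LinearMap.smul_apply] at h1
    exact (smul_eq_zero.1 h1).resolve_left hW0
  have e0 := congrFun h2 0
  have e1 := congrFun h2 1
  have e2 := congrFun h2 2
  rw [hW, smul_dotProduct, smul_eq_mul, mul_div_cancel_left₀ _ hW0]
  simp only [cross_apply_zero, cross_apply_one, cross_apply_two, Pi.zero_apply] at e0 e1 e2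
  rw [dot_eq] at hm
  apply E3.ext <;> simp only [Pi.smul_apply, smul_eq_mul, dot_eq]
  · linear_combination -w 0 * hm - m 1 * e2 + m 2 * e1
  · linear_combination -w 1 * hm + m 0 * e2 - m 2 * e0
  · linear_combination -w 2 * hm - m 0 * e1 + m 1 * e0

lemma IsCgcHelicoid.cross_parallelCurve {K : ℝ} (h : IsCgcHelicoid K l I c) {r : ℝ}
    (hr : r ^ 2 * K = 1) {u : ℝ} (hu : u ∈ I) (hneg : r * meanNumerator l c u < 0) :
    ∃ V : ℝ, 0 < V ∧ crossProduct (deriv (parallelCurve l r c) u)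
      (killing l (parallelCurve l r c u)) = V • unitNormal l c u := by
  have hg := h.isGenerating
  have hW := hg.cross_eq_smul hu
  have hW0 : 0 < normalSpeed l c u * (killing l (c u) ⬝ᵥ killing l (c u)) :=
    mul_pos (hg.normalSpeed_pos hu) (hg.killing_dot_self_pos hu)
  have hm := hg.unitNormal_dot_self hu
  have hD := hg.det_pos hu
  have hgauss := h.gauss_eq hu
  have hkα := hg.killing_dot_deriv hu
  have e1 := hg.unitNormal_dot_deriv hu
  have e2 := unitNormal_dot_killing l c u
  have e3 := IsGenerating.dot_unitNormal l c u
  have e4 := IsGenerating.killing_dot_unitNormal l c u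
  rw [(hg.hasDerivAt_parallelCurve r hu).deriv, killing_parallelCurve]
  rw [meanNumerator] at hneg
  generalize normalSpeed l c u * (killing l (c u) ⬝ᵥ killing l (c u)) = W at *
  generalize hβ' : killing 0 (unitNormal l c u) = β at *
  generalize unitNormal l c u = m at *
  generalize deriv (unitNormal l c) u = α at *
  generalize killing l (c u) = k at *
  generalize deriv c u = a at *
  have hWW : crossProduct a k ⬝ᵥ crossProduct a k = W ^ 2 := by
    rw [hW, smul_dotProduct, dotProduct_smul, hm, smul_eq_mul, smul_eq_mul]; ring
  have hD' : a ⬝ᵥ a * (k ⬝ᵥ k) - (a ⬝ᵥ k) ^ 2 = W ^ 2 := by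
    rw [← hWW, cross_dot_cross, dotProduct_comm k a]; ring
  set w := crossProduct (a + r • α) (k + r • β) with hw
  -- Three vectors orthogonal to m lie in a plane, so their triple product vanishes; hence w is
  -- orthogonal to a and k.
  have hperp : ∀ x y z : E3, m ⬝ᵥ x = 0 → m ⬝ᵥ y = 0 → m ⬝ᵥ z = 0 →
      x ⬝ᵥ crossProduct y z = 0 := by
    intro x y z hx hy hz
    have key : (m ⬝ᵥ m) * (x ⬝ᵥ crossProduct y z) = (m ⬝ᵥ x) * (m ⬝ᵥ crossProduct y z) +
        (m ⬝ᵥ y) * (m ⬝ᵥ crossProduct z x) + (m ⬝ᵥ z) * (m ⬝ᵥ crossProduct x y) := by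
      simp only [dot_eq, cross_apply_zero, cross_apply_one, cross_apply_two]; ring
    rwa [hm, hx, hy, hz, one_mul, zero_mul, zero_mul, zero_mul, add_zero, add_zero] at key
  rw [dotProduct_comm] at e3 e4
  have t1 : m ⬝ᵥ (a + r • α) = 0 := by rw [dotProduct_add, dotProduct_smul, e3, e1]; simp
  have t2 : m ⬝ᵥ (k + r • β) = 0 := by rw [dotProduct_add, dotProduct_smul, e4, e2]; simp
  have hwm := eq_smul_of_orthogonal hW hm hW0.ne' (hperp a _ _ e3 t1 t2) (hperp k _ _ e4 t1 t2)
  refine ⟨_, ?_, hwm⟩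
  apply div_pos _ hW0
  rw [cross_dot_cross]
  simp only [dotProduct_add, dotProduct_smul, smul_eq_mul]
  rw [hD'] at hgauss
  rw [dotProduct_comm k a, hkα]
  have hWpos : 0 < W ^ 2 := by positivity
  -- The area element of the parallel surface carries the factor 1 - 2rH + r²K = 2 - 2rH, which is
  -- positive when r and the mean curvature have opposite signs.
  have hexp : (a ⬝ᵥ a + r * (a ⬝ᵥ α)) * (k ⬝ᵥ k + r * (k ⬝ᵥ β)) -
      (a ⬝ᵥ k + r * (a ⬝ᵥ β)) * (a ⬝ᵥ k + r * (a ⬝ᵥ β)) =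
      2 * W ^ 2 - r * (k ⬝ᵥ k * -(a ⬝ᵥ α) - 2 * (a ⬝ᵥ k) * -(a ⬝ᵥ β) +
        a ⬝ᵥ a * -(k ⬝ᵥ β)) := by
    linear_combination hD' + r ^ 2 * hgauss + W ^ 2 * hr
  nlinarith

lemma unitNormal_eq_of_cross {l V : ℝ} {c : ℝ → E3} {u : ℝ} {m : E3} (hV : 0 < V)
    (hm : m ⬝ᵥ m = 1) (h : crossProduct (deriv c u) (killing l (c u)) = V • m) :
    unitNormal l c u = m := by
  rw [unitNormal, h, smul_dotProduct, dotProduct_smul, hm, smul_eq_mul, smul_eq_mul, mul_one,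
    Real.sqrt_mul_self hV.le, smul_smul, one_div_mul_cancel hV.ne', one_smul]

/-- Of the two parallel surfaces at distance 1/√K, the one with r opposite in sign to the mean
curvature is immersed and keeps the normal. Its mean curvature -1/(2r) makes the original surface
its companion. -/
lemma IsCgcHelicoid.exists_parallel {K : ℝ} (h : IsCgcHelicoid K l I c) {u₀ : ℝ} (hu₀ : u₀ ∈ I) :
    ∃ r : ℝ, (r = 1 / √K ∨ r = -(1 / √K)) ∧
      IsCmcHelicoid (-(1 / (2 * r))) l I (parallelCurve l r c) ∧
      ∀ u ∈ I, unitNormal l (parallelCurve l r c) u = unitNormal l c u := by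
  have hg := h.isGenerating
  have hs := Real.sqrt_pos.2 h.pos
  obtain ⟨r, hr, hneg⟩ : ∃ r : ℝ, (r = 1 / √K ∨ r = -(1 / √K)) ∧
      ∀ u ∈ I, r * meanNumerator l c u < 0 := by
    rcases lt_or_gt_of_ne (h.meanNumerator_ne hu₀) with h0 | h0
    · refine ⟨_, Or.inl rfl, fun u hu => mul_neg_of_pos_of_neg (by positivity) ?_⟩
      have := h.meanNumerator_mul_pos hu₀ hu
      by_contra! hn
      nlinarith
    · refine ⟨_, Or.inr rfl, fun u hu => mul_neg_of_neg_of_pos (by simpa using hs) ?_⟩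
      have := h.meanNumerator_mul_pos hu₀ hu
      by_contra! hn
      nlinarith
  have hr2 : r ^ 2 * K = 1 := by
    have := Real.sq_sqrt h.pos.le
    rcases hr with rfl | rfl <;> field_simp <;> exact this.symm
  have hr0 : r ≠ 0 := by rintro rfl; norm_num at hr2
  have hunit : ∀ u ∈ I, unitNormal l (parallelCurve l r c) u = unitNormal l c u := by
    intro u hu
    obtain ⟨V, hV, hc⟩ := h.cross_parallelCurve hr2 hu (hneg u hu)
    exact unitNormal_eq_of_cross hV (hg.unitNormal_dot_self hu) hc
  have hgen : IsGenerating l I (parallelCurve l r c) := by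
    refine ⟨h.isOpen, h.ordConnected, ?_, fun u hu h0 => ?_⟩
    · exact h.smooth.add (hg.contDiffOn_unitNormal.const_smul r)
    · obtain ⟨V, hV, hc⟩ := h.cross_parallelCurve hr2 hu (hneg u hu)
      have h1 := hg.unitNormal_dot_self hu
      rw [h0] at hc
      rcases smul_eq_zero.1 hc.symm with h2 | h2
      · exact hV.ne' h2
      · simp [h2] at h1
  refine ⟨r, hr, ⟨isHelicoidalImmersion_iff.2 hgen, ?_, fun u hu v => ?_⟩, hunit⟩
  · exact neg_ne_zero.2 (div_ne_zero one_ne_zero (mul_ne_zero two_ne_zero hr0))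
  · rw [hgen.meanCurvature_eq_iff hu]
    have hd : deriv (unitNormal l (parallelCurve l r c)) u = deriv (unitNormal l c) u :=
      Filter.EventuallyEq.deriv_eq (by
        filter_upwards [h.isOpen.mem_nhds hu] with s hs using hunit s hs)
    have hgauss := h.gauss_eq hu
    have hD := hg.det_pos hu
    have hkα := hg.killing_dot_deriv hu
    have hW := hg.cross_eq_smul hu
    have e1 := hg.unitNormal_dot_deriv hu
    have e2 := unitNormal_dot_killing l c u
    have x1 := gram_eq (β := deriv (unitNormal l c) u) hW e1
    have x2 := gram_eq (β := killing 0 (unitNormal l c u)) hW e1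
    have x3 := gram_eq (β := killing 0 (unitNormal l c u)) hW e2
    rw [hd, hunit u hu, (hg.hasDerivAt_parallelCurve r hu).deriv, killing_parallelCurve]
    simp only [add_dotProduct, dotProduct_add, smul_dotProduct, dotProduct_smul, smul_eq_mul]
    generalize killing 0 (unitNormal l c u) = β at *
    generalize deriv (unitNormal l c) u = α at *
    generalize killing l (c u) = k at *
    generalize deriv c u = a at *
    rw [hkα] at x1 x2
    simp only [dotProduct_comm α a, dotProduct_comm α k, dotProduct_comm β k, hkα]
    have key := parallel_meanCurvature (E := a ⬝ᵥ a) (F := a ⬝ᵥ k) (G := k ⬝ᵥ k)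
      (L := -(a ⬝ᵥ α)) (M := -(a ⬝ᵥ β)) (N := -(k ⬝ᵥ β)) (r := r) hD.ne' hr0
      (by rw [hgauss]; linear_combination (a ⬝ᵥ a * (k ⬝ᵥ k) - (a ⬝ᵥ k) ^ 2) * hr2)
      (by rw [x1]; ring) (by rw [x2]; ring) (by rw [x3]; ring)
    have hhalf : 2 * -(1 / (2 * r)) = -(1 / r) := by field_simp
    rw [hhalf]
    linear_combination key

end

/-- A curve inside the axis has vertical velocity, parallel to the Killing field there. This
excludes μ = 0, for which the companion degenerates to the axis. -/
lemma IsGenerating.exists_axisDist_pos {l : ℝ} {I : Set ℝ} {c : ℝ → E3}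
    (h : IsGenerating l I c) (hI : I.Nonempty) : ∃ u ∈ I, 0 < axisDist (c u) := by
  by_contra! hn
  have h0 : ∀ u ∈ I, c u 0 = 0 ∧ c u 1 = 0 := by
    intro u hu
    have h1 := hn u hu
    rw [axisDist, Real.sqrt_le_iff] at h1
    constructor <;> nlinarith [h1.2, sq_nonneg (c u 0), sq_nonneg (c u 1)]
  obtain ⟨u, hu⟩ := hI
  obtain ⟨d0, d1, -⟩ := hasDerivAt_E3.1 (h.hasDerivAt hu)
  have e0 := d0.unique ((hasDerivAt_const u (0 : ℝ)).congr_of_eventuallyEq (by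
    filter_upwards [h.isOpen.mem_nhds hu] with s hs using (h0 s hs).1))
  have e1 := d1.unique ((hasDerivAt_const u (0 : ℝ)).congr_of_eventuallyEq (by
    filter_upwards [h.isOpen.mem_nhds hu] with s hs using (h0 s hs).2))
  apply h.cross_ne u hu
  apply E3.ext <;> simp [cross_apply, e0, e1, (h0 u hu).1, (h0 u hu).2]

lemma IsCgcHelicoid.exists_parametrizedBy {K l : ℝ} {I : Set ℝ} {c : ℝ → E3}
    (h : IsCgcHelicoid K l I c) : ∃ μ b : ℝ, (μ, b) ∈ helicoidParams ∧ 0 < μ ∧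
      ParametrizedBy I (helicoidalSurface l c) b
        (cgcCompanion (√K / 2) (cmcHelicoid μ b (√K / 2))) := by
  rcases I.eq_empty_or_nonempty with rfl | hI
  · exact ⟨1, 1, mem_helicoidParams.2 (by norm_num), one_pos, 1, 0, id, id, Or.inl rfl, by simp⟩
  have hI' := hI
  obtain ⟨u₀, hu₀⟩ := hI
  have hg := h.isGenerating
  have hK := Real.sqrt_pos.2 h.pos
  have hH : √K / 2 ≠ 0 := by positivity
  obtain ⟨r, hr, hd, hunit⟩ := h.exists_parallel hu₀
  have hr0 : r ≠ 0 := by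
    rcases hr with rfl | rfl
    · positivity
    · exact neg_ne_zero.2 (by positivity)
  obtain ⟨μ, b, hp, -, h2⟩ := hd.exists_parametrizedBy
  have hcomp : ∀ u ∈ I, ∀ v, cgcCompanion (-(1 / (2 * r)))
      (helicoidalSurface l (parallelCurve l r c)) u v = helicoidalSurface l c u v := by
    intro u hu v
    rw [cgcCompanion, gaussMap_helicoidalSurface _ _
      (hd.isGenerating.hasDerivAt hu).differentiableAt, hunit u hu,
      show 1 / (2 * -(1 / (2 * r))) = -r by field_simp]
    apply E3.ext <;> simp [helicoidalSurface, parallelCurve] <;> ring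
  have h3 : ParametrizedBy I (helicoidalSurface l c) b
      (cgcCompanion (-(1 / (2 * r))) (cmcHelicoid μ b (-(1 / (2 * r))))) := by
    obtain ⟨ε, t, s, τ, hε, hs, hτ, hs', h4⟩ := h2
    exact ⟨ε, t, s, τ, hε, hs, hτ, hs', fun u hu v => by rw [← hcomp u hu v, h4 u hu v]⟩
  have h4 : ParametrizedBy I (helicoidalSurface l c) b
      (cgcCompanion (√K / 2) (cmcHelicoid μ b (√K / 2))) := by
    -- For r = 1/√K the mean curvature comes out as -√K/2, and the sign has to be switched.
    rcases hr with rfl | rfl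
    · rw [show -(1 / (2 * (1 / √K))) = -(√K / 2) by field_simp] at h3
      exact h3.cgcCompanion_neg hp hH
    · rwa [show -(1 / (2 * -(1 / √K))) = √K / 2 by field_simp] at h3
  refine ⟨μ, b, hp, lt_of_le_of_ne (mem_helicoidParams.1 hp).1 ?_, h4⟩
  rintro rfl
  obtain ⟨u, hu, hpos⟩ := hg.exists_axisDist_pos hI'
  obtain ⟨u', v', e⟩ := h4.exists_axisDist_eq hu 0
  have h5 := axisDist_cgcCompanion_le hp hH u' v'
  rw [← e, helicoidalSurface, axisDist_helicoidalMotion] at h5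
  simp at h5
  linarith

/-! ### The explicit helicoids and the sharpness of the bounds -/

lemma cmcHelicoid_zero (μ b H : ℝ) (u : ℝ) :
    cmcHelicoid μ b H u 0 = (-1 / (2 * H)) • helCurve μ b u := by
  rw [cmcHelicoid_eq, zero_div, helicoidalSurface, helicoidalMotion_zero]

lemma cmcHelicoid_eq_helicoidalSurface (μ b H : ℝ) (u v : ℝ) :
    cmcHelicoid μ b H u v =
      helicoidalSurface (-helC μ b / (2 * H)) (fun s => cmcHelicoid μ b H s 0) u (v / b) := by
  simp only [cmcHelicoid_zero]
  rw [show -helC μ b / (2 * H) = -1 / (2 * H) * helC μ b by ring, helicoidalSurface_smul,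
    cmcHelicoid_eq]

section

variable {μ b : ℝ} (h : (μ, b) ∈ helicoidParams) {H : ℝ} (hH : H ≠ 0)
include h hH

lemma isCmcHelicoid_cmcHelicoid : IsCmcHelicoid H (-helC μ b / (2 * H)) Set.univ
    (fun u => cmcHelicoid μ b H u 0) := by
  have hk : -1 / (2 * H) ≠ 0 := div_ne_zero (by norm_num) (by simpa using hH)
  have := (isCmcHelicoid_helCurve h).smul hk
  simp only [cmcHelicoid_zero]
  rwa [show -1 / 2 / (-1 / (2 * H)) = H by field_simp,
    show -1 / (2 * H) * helC μ b = -helC μ b / (2 * H) by ring] at this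

lemma isGreatest_cmcHelicoid :
    IsGreatest {r : ℝ | ∃ u v : ℝ, r = axisDist (cmcHelicoid μ b H u v)}
      ((1 + μ * b ^ 2) / |2 * H|) := by
  obtain ⟨h0, h1, h2⟩ := mem_helicoidParams.1 h
  refine ⟨⟨0, 0, ?_⟩, ?_⟩
  · rw [axisDist_cmcHelicoid h, landenAm_zero h0 (le_one_of_mem h), Real.cos_zero,
      show 1 + (μ * b ^ 2) ^ 2 + 2 * (μ * b ^ 2) * 1 = (1 + μ * b ^ 2) ^ 2 by ring,
      Real.sqrt_sq (by positivity)]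
  · rintro r ⟨u, v, rfl⟩
    exact axisDist_cmcHelicoid_le h hH u v

lemma isGreatest_cgcCompanion :
    IsGreatest {r : ℝ | ∃ u v : ℝ, r = axisDist (cgcCompanion H (cmcHelicoid μ b H) u v)}
      (μ * b ^ 2 / |2 * H|) := by
  obtain ⟨h0, h1, h2⟩ := mem_helicoidParams.1 h
  refine ⟨⟨0, 0, ?_⟩, ?_⟩
  · rw [axisDist_cgcCompanion h hH, jacobiSn, jacobiAm_zero h0 (le_one_of_mem h), Real.sin_zero,
      show μ ^ 2 * b ^ 4 - μ ^ 2 * b ^ 2 * 0 ^ 2 = (μ * b ^ 2) ^ 2 by ring,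
      Real.sqrt_sq (by positivity)]
  · rintro r ⟨u, v, rfl⟩
    exact axisDist_cgcCompanion_le h hH u v

omit hH in
-- The minimum belongs to the phase π, which is reached for every μ < 1.
lemma exists_cmcHelicoid_eq (hμ : μ ≠ 1) :
    ∃ u v : ℝ, axisDist (cmcHelicoid μ b H u v) = |1 - μ * b ^ 2| / |2 * H| := by
  obtain ⟨u, hu⟩ := landenAm_surjective (mem_helicoidParams.1 h).1
    (lt_of_le_of_ne (le_one_of_mem h) hμ) Real.pi
  refine ⟨u, 0, ?_⟩
  simp only at hu
  rw [axisDist_cmcHelicoid h, hu, Real.cos_pi,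
    show 1 + (μ * b ^ 2) ^ 2 + 2 * (μ * b ^ 2) * -1 = (1 - μ * b ^ 2) ^ 2 by ring,
    Real.sqrt_sq_eq_abs]

/-- The minimum belongs to sn² = 1, reached at the amplitude π/2. -/
lemma exists_cgcCompanion_eq (hμ : μ ≠ 1) :
    ∃ u v : ℝ, axisDist (cgcCompanion H (cmcHelicoid μ b H) u v) =
      μ * b * √(b ^ 2 - 1) / |2 * H| := by
  obtain ⟨u, hu⟩ := jacobiAm_surjective (mem_helicoidParams.1 h).1
    (lt_of_le_of_ne (le_one_of_mem h) hμ) (Real.pi / 2)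
  refine ⟨u, 0, ?_⟩
  simp only at hu
  rw [axisDist_cgcCompanion h hH, jacobiSn, hu, Real.sin_pi_div_two, one_pow, mul_one,
    sqrt_inner_eq h]

omit hH in
lemma eq_one_of_mem (hμ : μ = 1) : b = 1 := by
  obtain ⟨h0, h1, h2⟩ := mem_helicoidParams.1 h
  rw [hμ] at h2
  linarith

end

lemma tendsto_div_cosh (a : ℝ) : Filter.Tendsto (fun u => a / Real.cosh u) Filter.atTop (nhds 0) :=
  Filter.Tendsto.div_atTop tendsto_const_nhds
    (Filter.tendsto_atTop_mono' _ ((Filter.eventually_ge_atTop 0).mono fun u hu =>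
      (Real.self_le_sinh_iff.2 hu).trans (Real.sinh_lt_cosh u).le) Filter.tendsto_id)

section

variable {μ b : ℝ} (h : (μ, b) ∈ helicoidParams) {H : ℝ} (hH : H ≠ 0)
include h hH

lemma isGLB_cmcHelicoid :
    IsGLB {r : ℝ | ∃ u v : ℝ, r = axisDist (cmcHelicoid μ b H u v)}
      (|1 - μ * b ^ 2| / |2 * H|) := by
  have hlow : |1 - μ * b ^ 2| / |2 * H| ∈
      lowerBounds {r : ℝ | ∃ u v : ℝ, r = axisDist (cmcHelicoid μ b H u v)} := by
    rintro r ⟨u, v, rfl⟩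
    exact le_axisDist_cmcHelicoid h hH u v
  by_cases hμ : μ = 1
  · have hb := eq_one_of_mem h hμ
    subst hμ hb
    refine ⟨hlow, fun r hr => ?_⟩
    rw [one_pow, mul_one, sub_self, abs_zero, zero_div]
    -- On the sphere the distance is 2/(|2H| cosh u): it tends to 0 towards the missing points on
    -- the axis without attaining it.
    refine ge_of_tendsto' (tendsto_div_cosh (2 / |2 * H|)) fun u => ?_
    refine (hr ⟨u, 0, rfl⟩).trans_eq ?_
    have hc := jacobiSn_sq_add_jacobiCn_sq u 1
    have hpos := Real.cosh_pos u
    rw [axisDist_cmcHelicoid h, cos_landenAm zero_le_one le_rfl, jacobiDn_one,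
      show jacobiSn u 1 ^ 2 = 1 - jacobiCn u 1 ^ 2 by linarith, jacobiCn_one,
      show 1 + ((1 : ℝ) * 1 ^ 2) ^ 2 + 2 * (1 * 1 ^ 2) * (1 / Real.cosh u * (1 / Real.cosh u) -
        1 * (1 - (1 / Real.cosh u) ^ 2)) = (2 / Real.cosh u) ^ 2 by field_simp; ring,
      Real.sqrt_sq (by positivity)]
    ring
  · obtain ⟨u, v, e⟩ := exists_cmcHelicoid_eq h (H := H) hμ
    exact ⟨hlow, fun r hr => hr ⟨u, v, e.symm⟩⟩

lemma isGLB_cgcCompanion :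
    IsGLB {r : ℝ | ∃ u v : ℝ, r = axisDist (cgcCompanion H (cmcHelicoid μ b H) u v)}
      (μ * b * √(b ^ 2 - 1) / |2 * H|) := by
  have hlow : μ * b * √(b ^ 2 - 1) / |2 * H| ∈
      lowerBounds {r : ℝ | ∃ u v : ℝ, r = axisDist (cgcCompanion H (cmcHelicoid μ b H) u v)} := by
    rintro r ⟨u, v, rfl⟩
    exact le_axisDist_cgcCompanion h hH u v
  by_cases hμ : μ = 1
  · have hb := eq_one_of_mem h hμ
    subst hμ hb
    refine ⟨hlow, fun r hr => ?_⟩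
    rw [one_pow, sub_self, Real.sqrt_zero, mul_zero, zero_div]
    -- The companion of this sphere is again a sphere without its points on the axis, at distance
    -- 1/(|2H| cosh u).
    refine ge_of_tendsto' (tendsto_div_cosh (1 / |2 * H|)) fun u => ?_
    refine (hr ⟨u, 0, rfl⟩).trans_eq ?_
    have hc := jacobiSn_sq_add_jacobiCn_sq u 1
    have hpos := Real.cosh_pos u
    rw [axisDist_cgcCompanion h hH,
      show jacobiSn u 1 ^ 2 = 1 - jacobiCn u 1 ^ 2 by linarith, jacobiCn_one,
      show (1 : ℝ) ^ 2 * 1 ^ 4 - 1 ^ 2 * 1 ^ 2 * (1 - (1 / Real.cosh u) ^ 2) =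
        (1 / Real.cosh u) ^ 2 by ring, Real.sqrt_sq (by positivity)]
    ring
  · obtain ⟨u, v, e⟩ := exists_cgcCompanion_eq h hH hμ
    exact ⟨hlow, fun r hr => hr ⟨u, v, e.symm⟩⟩

end

theorem proposition6p3 :
    -- every cmc-`H` helicoid, and its cgc-companion
    (∀ (H pitch : ℝ) (I : Set ℝ) (c : ℝ → E3), IsCmcHelicoid H pitch I c →
      ∃ μ b : ℝ, (μ, b) ∈ helicoidParams ∧
        ParametrizedBy I (helicoidalSurface pitch c) b (cmcHelicoid μ b H) ∧
        (∀ u ∈ I, ∀ v : ℝ,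
          |1 - μ * b ^ 2| / |2 * H| ≤ axisDist (helicoidalSurface pitch c u v) ∧
          axisDist (helicoidalSurface pitch c u v) ≤ (1 + μ * b ^ 2) / |2 * H|) ∧
        (∀ u ∈ I, ∀ v : ℝ,
          μ * b * √(b ^ 2 - 1) / |2 * H| ≤
            axisDist (cgcCompanion H (helicoidalSurface pitch c) u v) ∧
          axisDist (cgcCompanion H (helicoidalSurface pitch c) u v) ≤ μ * b ^ 2 / |2 * H|)) ∧
    -- every helicoidal surface of positive constant Gaussian curvature `K`
    (∀ (K pitch : ℝ) (I : Set ℝ) (c : ℝ → E3), IsCgcHelicoid K pitch I c →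
      ∃ μ b : ℝ, (μ, b) ∈ helicoidParams ∧ 0 < μ ∧
        ParametrizedBy I (helicoidalSurface pitch c) b
          (cgcCompanion (√K / 2) (cmcHelicoid μ b (√K / 2))) ∧
        (∀ u ∈ I, ∀ v : ℝ,
          μ * b * √(b ^ 2 - 1) / √K ≤ axisDist (helicoidalSurface pitch c u v) ∧
          axisDist (helicoidalSurface pitch c u v) ≤ μ * b ^ 2 / √K) ∧
        (0 < μ * b * √(b ^ 2 - 1) / √K ↔ b ≠ 1)) ∧
    -- the explicit surfaces are cmc-`H` helicoids, and the bounds are sharp on them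
    (∀ (μ b H : ℝ), (μ, b) ∈ helicoidParams → H ≠ 0 →
      IsCmcHelicoid H (-helC μ b / (2 * H)) Set.univ (fun u => cmcHelicoid μ b H u 0) ∧
      (∀ u v : ℝ, cmcHelicoid μ b H u v =
        helicoidalSurface (-helC μ b / (2 * H)) (fun s => cmcHelicoid μ b H s 0) u (v / b)) ∧
      IsGreatest {r : ℝ | ∃ u v : ℝ, r = axisDist (cmcHelicoid μ b H u v)}
        ((1 + μ * b ^ 2) / |2 * H|) ∧
      IsGLB {r : ℝ | ∃ u v : ℝ, r = axisDist (cmcHelicoid μ b H u v)}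
        (|1 - μ * b ^ 2| / |2 * H|) ∧
      (μ ≠ 1 → ∃ u v : ℝ, axisDist (cmcHelicoid μ b H u v) = |1 - μ * b ^ 2| / |2 * H|) ∧
      IsGreatest {r : ℝ | ∃ u v : ℝ, r = axisDist (cgcCompanion H (cmcHelicoid μ b H) u v)}
        (μ * b ^ 2 / |2 * H|) ∧
      IsGLB {r : ℝ | ∃ u v : ℝ, r = axisDist (cgcCompanion H (cmcHelicoid μ b H) u v)}
        (μ * b * √(b ^ 2 - 1) / |2 * H|) ∧
      (μ ≠ 1 → ∃ u v : ℝ, axisDist (cgcCompanion H (cmcHelicoid μ b H) u v) =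
        μ * b * √(b ^ 2 - 1) / |2 * H|)) := by
  refine ⟨fun H pitch I c h => ?_, fun K pitch I c h => ?_, fun μ b H h hH =>
    ⟨isCmcHelicoid_cmcHelicoid h hH, cmcHelicoid_eq_helicoidalSurface μ b H,
      isGreatest_cmcHelicoid h hH, isGLB_cmcHelicoid h hH, exists_cmcHelicoid_eq h,
      isGreatest_cgcCompanion h hH, isGLB_cgcCompanion h hH, exists_cgcCompanion_eq h hH⟩⟩
  · obtain ⟨μ, b, hp, h1, h2⟩ := h.exists_parametrizedBy
    refine ⟨μ, b, hp, h1, fun u hu v => ?_, fun u hu v => ?_⟩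
    · obtain ⟨u', v', e⟩ := h1.exists_axisDist_eq hu v
      rw [e]
      exact ⟨le_axisDist_cmcHelicoid hp h.ne_zero u' v', axisDist_cmcHelicoid_le hp h.ne_zero u' v'⟩
    · obtain ⟨u', v', e⟩ := h2.exists_axisDist_eq hu v
      rw [e]
      exact ⟨le_axisDist_cgcCompanion hp h.ne_zero u' v',
        axisDist_cgcCompanion_le hp h.ne_zero u' v'⟩
  · obtain ⟨μ, b, hp, hμ, h1⟩ := h.exists_parametrizedBy
    have hK := Real.sqrt_pos.2 h.pos
    have hH : √K / 2 ≠ 0 := by positivity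
    have hH2 : |2 * (√K / 2)| = √K := by rw [mul_div_cancel₀ _ two_ne_zero, abs_of_pos hK]
    have hb := (mem_helicoidParams.1 hp).2.1
    refine ⟨μ, b, hp, hμ, h1, fun u hu v => ?_, ?_⟩
    · obtain ⟨u', v', e⟩ := h1.exists_axisDist_eq hu v
      have g1 := le_axisDist_cgcCompanion hp hH u' v'
      have g2 := axisDist_cgcCompanion_le hp hH u' v'
      rw [hH2] at g1 g2
      rw [e]
      exact ⟨g1, g2⟩
    · constructor
      · rintro h0 rfl
        simp at h0
      · intro hb1
        have : 1 < b := lt_of_le_of_ne hb (Ne.symm hb1)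
        have : 0 < √(b ^ 2 - 1) := Real.sqrt_pos.2 (by nlinarith)
        positivity
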